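/- Let $\Omega\subseteq\mathbb R^4$ be open (for instance $\Omega=\mathbb R^4$) and let $\Pi$ be a smooth 2-distribution on $\Omega$, i.e. a smooth field $x\mapsto\Pi_x\subset T_x\mathbb R^4$ of 2-dimensional subspaces. Let $\mathcal D$ be the module of smooth sections of $\Pi$ over $\Omega$, put $\partial^{(0)}\mathcal D=\mathcal D$, $\partial^{(k+1)}\mathcal D=\partial^{(k)}\mathcal D+[\mathcal D,\partial^{(k)}\mathcal D]$, and let $(\partial^{(k)}\Pi)_x\subseteq T_x\mathbb R^4$ be the space of values at $x$ of the fields in $\partial^{(k)}\mathcal D$. Call $\Pi$ regular if for every $k$ the dimension of $(\partial^{(k)}\Pi)_x$ is a locally constant function of $x\in\Omega$. A smooth vector field $v$ on an open set $U$ is a symmetry of $\Pi$ on $U$ if its local flow $\varphi_t$ preserves $\Pi$: $d\varphi_t(\Pi_x)=\Pi_{\varphi_t(x)}$. Suppose that $\Pi$ is regular. Then every point of $\Omega$ has an open neighbourhood $U\subseteq\Omega$ such that: (a) at least one of the following holds on $U$: (1) $\Pi$ is integrable, i.e. there are smooth coordinates $(x^1,\dots,x^4)$ on $U$ in which $\Pi=\{dx^1=dx^2=0\}$;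 (2) there are smooth coordinates $(p,t)\in\mathbb R^3\times\mathbb R$ on $U$ in which $\Pi=C\times\{\mathrm{pt}\}$, i.e. $\Pi_{(p,t)}=C_p\oplus 0$, for a contact distribution $C=\ker\alpha$, $\alpha\wedge d\alpha\neq0$ everywhere, on an open subset of $\mathbb R^3$; (3) $\Pi$ is of general position: $\partial^{(2)}\Pi\ne\partial^{(1)}\Pi\ne\Pi$ and $(\partial^{(2)}\Pi)_x=T_x\mathbb R^4$ at every $x\in U$; (b) there are two symmetries $v,w$ of $\Pi$ on $U$ that are independent and transversal to $\Pi$: for every $x\in U$ the vectors $v_x,w_x$ are linearly independent and $T_x\mathbb R^4=\Pi_x\oplus\langle v_x,w_x\rangle$. -/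

import Mathlib

open scoped ContDiff Topology

noncomputable section

namespace PlaneField

variable {E : Type*} [NormedAddCommGroup E] [NormedSpace ℝ E]

/-- `D` is a smooth distribution of rank `r` on the set `Ω` (used for open `Ω`): near every point
of `Ω` it is spanned by `r` pointwise linearly independent smooth vector fields. -/
def IsDistributionOn (r : ℕ) (Ω : Set E) (D : E → Submodule ℝ E) : Prop :=
  ∀ x ∈ Ω, ∃ U : Set E, IsOpen U ∧ x ∈ U ∧ U ⊆ Ω ∧ ∃ X : Fin r → E → E,
    (∀ i, ContDiffOn ℝ ∞ (X i) U) ∧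
    ∀ y ∈ U, LinearIndependent ℝ (fun i => X i y) ∧
      D y = Submodule.span ℝ (Set.range fun i => X i y)

/-- The module of smooth sections of `D` over `Ω`. The values of a vector field outside `Ω` are
irrelevant. -/
def sections (Ω : Set E) (D : E → Submodule ℝ E) : Submodule ℝ (E → E) where
  carrier := {X | ContDiffOn ℝ ∞ X Ω ∧ ∀ x ∈ Ω, X x ∈ D x}
  add_mem' := fun ha hb => ⟨ha.1.add hb.1, fun x hx => (D x).add_mem (ha.2 x hx) (hb.2 x hx)⟩
  zero_mem' := ⟨contDiffOn_const, fun x _ => (D x).zero_mem⟩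
  smul_mem' := fun c _ ha =>
    ⟨contDiffOn_const.smul ha.1, fun x hx => (D x).smul_mem c (ha.2 x hx)⟩

/-- The module of sections of the `k`-th derivative `∂⁽ᵏ⁾D`:
`∂⁽⁰⁾𝒟 = 𝒟` is the module of sections of `D`, and `∂⁽ᵏ⁺¹⁾𝒟 = ∂⁽ᵏ⁾𝒟 + [𝒟, ∂⁽ᵏ⁾𝒟]`. -/
def derivedSections (Ω : Set E) (D : E → Submodule ℝ E) : ℕ → Submodule ℝ (E → E)
  | 0 => sections Ω D
  | k + 1 => derivedSections Ω D k ⊔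
      Submodule.span ℝ {Z | ∃ X ∈ sections Ω D, ∃ Y ∈ derivedSections Ω D k,
        Z = VectorField.lieBracket ℝ X Y}

/-- The subspace `(∂⁽ᵏ⁾D)ₓ` of the tangent space: the values at `x` of the sections
of `∂⁽ᵏ⁾D`. -/
def derivedSpace (Ω : Set E) (D : E → Submodule ℝ E) (k : ℕ) (x : E) : Submodule ℝ E :=
  (derivedSections Ω D k).map (LinearMap.proj x : (E → E) →ₗ[ℝ] E)

/-- `D` is regular on the open set `Ω`: the dimensions of all the spaces `(∂⁽ᵏ⁾D)ₓ` (equivalently,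
of the graded pieces `(∂⁽ᵏ⁺¹⁾D)ₓ / (∂⁽ᵏ⁾D)ₓ`) are locally constant in `x`. -/
def IsRegularOn (Ω : Set E) (D : E → Submodule ℝ E) : Prop :=
  ∀ k : ℕ, ∀ x ∈ Ω, ∀ᶠ y in 𝓝 x,
    Module.finrank ℝ (derivedSpace Ω D k y) = Module.finrank ℝ (derivedSpace Ω D k x)

/-- `φ` is the smooth local flow in `U` of the vector field `v`, for initial points in the open
set `V ⊆ U` and times in `(-ε, ε)`. -/
structure IsLocalFlow (v : E → E) (U V : Set E) (ε : ℝ) (φ : ℝ → E → E) : Prop where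
  isOpen : IsOpen V
  subset : V ⊆ U
  pos : 0 < ε
  smooth : ContDiffOn ℝ ∞ (fun p : ℝ × E => φ p.1 p.2) (Set.Ioo (-ε) ε ×ˢ V)
  map_zero : ∀ x ∈ V, φ 0 x = x
  mem : ∀ t ∈ Set.Ioo (-ε) ε, ∀ x ∈ V, φ t x ∈ U
  hasDerivAt : ∀ t ∈ Set.Ioo (-ε) ε, ∀ x ∈ V, HasDerivAt (fun s => φ s x) (v (φ t x)) t

/-- The smooth vector field `v` on the open set `U` is a symmetry of `D`: its local flow `φ` takes
`D` to itself, `(φₜ)₊ Dₓ = D` at `φₜ(x)`. As flows are unique and form a local one-parameter group,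
it is enough to ask this for small times near each point. -/
def IsSymmetryOn (D : E → Submodule ℝ E) (U : Set E) (v : E → E) : Prop :=
  ContDiffOn ℝ ∞ v U ∧
  ∀ x ∈ U, ∃ (V : Set E) (ε : ℝ) (φ : ℝ → E → E), x ∈ V ∧ IsLocalFlow v U V ε φ ∧
    ∀ t ∈ Set.Ioo (-ε) ε, ∀ y ∈ V,
      (D y).map (fderiv ℝ (φ t) y : E →ₗ[ℝ] E) = D (φ t y)

/-- A smooth diffeomorphism between an open subset of `E` and an open subset of `F`. -/
def IsSmoothChart {F : Type*} [NormedAddCommGroup F] [NormedSpace ℝ F]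
    (Φ : OpenPartialHomeomorph E F) : Prop :=
  ContDiffOn ℝ ∞ Φ Φ.source ∧ ContDiffOn ℝ ∞ Φ.symm Φ.target

/-- The 3-form `α ∧ dα` of a 1-form `α`, where `dα (u, v) = (D_u α) v - (D_v α) u`. -/
def wedgeD (α : E → E →L[ℝ] ℝ) (x u v w : E) : ℝ :=
  let dα : E → E → ℝ := fun a b => fderiv ℝ α x a b - fderiv ℝ α x b a
  α x u * dα v w + α x v * dα w u + α x w * dα u v

/-- `C` is a contact distribution on the open set `W ⊆ ℝ³`: the kernel of a smooth 1-form `α` with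
`α ∧ dα` nowhere zero. -/
def IsContactOn (W : Set (EuclideanSpace ℝ (Fin 3)))
    (C : EuclideanSpace ℝ (Fin 3) → Submodule ℝ (EuclideanSpace ℝ (Fin 3))) : Prop :=
  ∃ α : EuclideanSpace ℝ (Fin 3) → EuclideanSpace ℝ (Fin 3) →L[ℝ] ℝ, ContDiffOn ℝ ∞ α W ∧
    ∀ p ∈ W, C p = LinearMap.ker (α p : EuclideanSpace ℝ (Fin 3) →ₗ[ℝ] ℝ) ∧
      ∃ u v w, wedgeD α p u v w ≠ 0

/-- On `U` the 2-distribution `D` is tangent to a foliation: in suitable coordinates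
`(a, b) ∈ ℝ² × ℝ²` on `U` it is given by `da = 0`. -/
def IsIntegrableOn (U : Set (EuclideanSpace ℝ (Fin 4)))
    (D : EuclideanSpace ℝ (Fin 4) → Submodule ℝ (EuclideanSpace ℝ (Fin 4))) : Prop :=
  ∃ Φ : OpenPartialHomeomorph (EuclideanSpace ℝ (Fin 4))
      (EuclideanSpace ℝ (Fin 2) × EuclideanSpace ℝ (Fin 2)),
    IsSmoothChart Φ ∧ U ⊆ Φ.source ∧
    ∀ x ∈ U, D x = (Submodule.prod ⊥ ⊤).comap (fderiv ℝ Φ x : EuclideanSpace ℝ (Fin 4) →ₗ[ℝ]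
      EuclideanSpace ℝ (Fin 2) × EuclideanSpace ℝ (Fin 2))

/-- On `U`, in suitable coordinates `(p, t) ∈ ℝ³ × ℝ`, the 2-distribution `D` is the product
`C × {pt}` of a contact distribution `C` on an open subset of `ℝ³` and the zero distribution
on `ℝ`. -/
def IsContactProductOn (U : Set (EuclideanSpace ℝ (Fin 4)))
    (D : EuclideanSpace ℝ (Fin 4) → Submodule ℝ (EuclideanSpace ℝ (Fin 4))) : Prop :=
  ∃ (Φ : OpenPartialHomeomorph (EuclideanSpace ℝ (Fin 4)) (EuclideanSpace ℝ (Fin 3) × ℝ))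
    (W : Set (EuclideanSpace ℝ (Fin 3)))
    (C : EuclideanSpace ℝ (Fin 3) → Submodule ℝ (EuclideanSpace ℝ (Fin 3))),
    IsSmoothChart Φ ∧ U ⊆ Φ.source ∧ IsOpen W ∧ IsContactOn W C ∧
    ∀ x ∈ U, (Φ x).1 ∈ W ∧
      D x = (Submodule.prod (C (Φ x).1) ⊥).comap
        (fderiv ℝ Φ x : EuclideanSpace ℝ (Fin 4) →ₗ[ℝ] EuclideanSpace ℝ (Fin 3) × ℝ)

/-- On `U` the distribution `D` (given on `Ω ⊇ U`) is of general position: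
`∂⁽²⁾D ≠ ∂⁽¹⁾D ≠ D` at every point, and `∂⁽²⁾D` is the whole tangent space. -/
def IsGeneralPositionOn (Ω U : Set E) (D : E → Submodule ℝ E) : Prop :=
  ∀ x ∈ U, derivedSpace Ω D 1 x ≠ D x ∧ derivedSpace Ω D 2 x ≠ derivedSpace Ω D 1 x ∧
    derivedSpace Ω D 2 x = ⊤

end PlaneField

end

/-! Take a local frame `X 0`, `X 1` of Π and put X₂ = [X₀, X₁]. By regularity the ranks of ∂⁽¹⁾Π and
∂⁽²⁾Π are constant near `x₀`, so whether X₂ lies in Π, and whether [X₀, X₂] and [X₁, X₂] lie in ⟨X₀,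
X₁, X₂⟩, can be tested at `x₀` alone. This gives the three cases.

A nonvanishing field v with [v, Π] ⊆ Π is a symmetry: in a flow box of v the distribution does not
depend on the flow coordinate and the flow is a translation (`isSymmetryOn_of_lieBracket_mem`). By
continuity it then suffices to find two such infinitesimal symmetries that are independent modulo Π
at `x₀` (`exists_transversal_symmetries`). The main device is `lieBracket_corrected_mem`: if [v, Π]
⊆ ∂⁽¹⁾Π and X₀, X₁, X₂ are independent, a unique choice of f, g makes v + fX₀ + gX₁ preserve Π,
because f and g enter [v, X₁] and [v, X₀] as multiples of X₂.

If Π is involutive, the Frobenius theorem gives (1), and the coordinate fields transversal to the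
leaves are symmetries. If ∂⁽¹⁾Π is involutive of rank 3, it is the kernel of some dt. Correcting a
field with dt(v) = 1, and correcting X₂, gives two symmetries, and straightening the first one while
keeping t as a coordinate exhibits Π as a contact distribution times a point.

In general position (an Engel distribution) Π contains a characteristic line field L with [L, ∂⁽¹⁾Π]
⊆ ∂⁽¹⁾Π. On the 3-dimensional local leaf space of L, ∂⁽¹⁾Π induces a contact distribution. A contact
field there, given by any generating function, lifts to a symmetry of Π (`exists_engel_lift`), so
there are enough generating functions to obtain two transversal symmetries.

The smooth local flow behind the flow boxes is constructed by solving the integral equation in the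
Banach space of continuous paths with the inverse function theorem. -/

namespace PlaneField

universe u

set_option linter.unusedSectionVars false

/-! ### Superposition operators on spaces of continuous maps. -/

section Nemytskii

variable {K : Type*} [TopologicalSpace K] [CompactSpace K]
variable {E F : Type u} [NormedAddCommGroup E] [NormedSpace ℝ E]
  [NormedAddCommGroup F] [NormedSpace ℝ F]

/-- Pointwise application of a continuous family of operators to a continuous map. -/
noncomputable def pointwiseApply :
    C(K, E →L[ℝ] F) →L[ℝ] C(K, E) →L[ℝ] C(K, F) :=
  LinearMap.mkContinuous₂
    (LinearMap.mk₂ ℝ (fun (A : C(K, E →L[ℝ] F)) (h : C(K, E)) =>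
        (⟨fun s => A s (h s), by fun_prop⟩ : C(K, F)))
      (fun _ _ _ => by ext; simp) (fun _ _ _ => by ext; simp)
      (fun _ _ _ => by ext; simp) (fun _ _ _ => by ext; simp)) 1 (by
    intro A h
    rw [ContinuousMap.norm_le _ (by positivity)]
    intro s
    calc ‖A s (h s)‖ ≤ ‖A s‖ * ‖h s‖ := (A s).le_opNorm _
      _ ≤ 1 * ‖A‖ * ‖h‖ := by
        rw [one_mul]
        gcongr
        · exact A.norm_coe_le_norm s
        · exact h.norm_coe_le_norm s)

@[simp]
theorem pointwiseApply_apply (A : C(K, E →L[ℝ] F)) (h : C(K, E)) (s : K) :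
    pointwiseApply A h s = A s (h s) := rfl

/-- The superposition operator `u ↦ v ∘ u`. -/
def superposition (v : E → F) (hv : Continuous v) (u : C(K, E)) : C(K, F) :=
  ⟨fun s => v (u s), by fun_prop⟩

@[simp]
theorem superposition_apply (v : E → F) (hv : Continuous v) (u : C(K, E)) (s : K) :
    superposition v hv u s = v (u s) := rfl

/-- The derivative of `v` is uniformly continuous at the compact range of `u`, so one δ serves every
`s`; the mean value inequality at each `s` then bounds the remainder in the sup norm. -/
theorem hasFDerivAt_superposition {v : E → F} (hv : ContDiff ℝ 1 v) (u : C(K, E)) :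
    HasFDerivAt (superposition (K := K) v hv.continuous)
      (pointwiseApply (superposition (fderiv ℝ v) (hv.continuous_fderiv (by norm_num)) u)) u := by
  have hc : Continuous (fderiv ℝ v) := hv.continuous_fderiv (by norm_num)
  rw [hasFDerivAt_iff_isLittleO_nhds_zero, Asymptotics.isLittleO_iff]
  intro c hc0
  have hcomp : IsCompact (Set.range u) := isCompact_range u.continuous
  have := hcomp.uniformContinuousAt_of_continuousAt (fderiv ℝ v)
    (fun a _ => hc.continuousAt) (Metric.dist_mem_uniformity hc0)
  obtain ⟨δ, hδ, hsub⟩ := Metric.mem_uniformity_dist.1 this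
  filter_upwards [Metric.ball_mem_nhds (0 : C(K, E)) hδ] with h hh
  rw [mem_ball_zero_iff] at hh
  rw [ContinuousMap.norm_le _ (by positivity)]
  intro s
  have hs : ‖h s‖ < δ := (h.norm_coe_le_norm s).trans_lt hh
  have key := (convex_ball (u s) δ).norm_image_sub_le_of_norm_fderiv_le' (𝕜 := ℝ) (f := v)
    (φ := fderiv ℝ v (u s)) (C := c) (x := u s) (y := u s + h s)
    (fun x _ => (hv.differentiable (by norm_num)) x)
    (fun x hx => by
      have := hsub (a := u s) (b := x) (by rwa [dist_comm]) (Set.mem_range_self s)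
      rw [Set.mem_ofPred_eq, dist_comm, dist_eq_norm] at this
      exact this.le) (Metric.mem_ball_self hδ) (by simpa [dist_eq_norm] using hs)
  rw [add_sub_cancel_left] at key
  refine key.trans ?_
  gcongr
  exact h.norm_coe_le_norm s

/-- The derivative is superposition by `fderiv ℝ v` followed by the bounded linear map
`pointwiseApply`. The induction changes the target from `F` to `E →L[ℝ] F`, hence the quantification
over `F`. -/
theorem contDiff_superposition_nat (n : ℕ) : ∀ {F : Type u} [NormedAddCommGroup F]
    [NormedSpace ℝ F] {v : E → F} (hv : ContDiff ℝ ∞ v),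
    ContDiff ℝ n (superposition (K := K) v hv.continuous) := by
  induction n with
  | zero =>
    intro F _ _ v hv
    have h1 : ContDiff ℝ 1 v := hv.of_le (by exact_mod_cast le_top)
    exact contDiff_zero.2 (continuous_iff_continuousAt.2 fun u =>
      (hasFDerivAt_superposition h1 u).continuousAt)
  | succ n ih =>
    intro F _ _ v hv
    have h1 : ContDiff ℝ 1 v := hv.of_le (by exact_mod_cast le_top)
    have hd : ContDiff ℝ ∞ (fderiv ℝ v) := hv.fderiv_right (by exact_mod_cast le_top)
    have := contDiff_succ_iff_hasFDerivAt (𝕜 := ℝ) (n := n)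
      (f := superposition (K := K) v hv.continuous)
    have hB : ContDiff ℝ n (pointwiseApply (K := K) (E := E) (F := F)) :=
      ContinuousLinearMap.contDiff _
    push_cast at this ⊢
    exact this.2 ⟨fun u => pointwiseApply (superposition (fderiv ℝ v) hd.continuous u),
      hB.comp (ih hd),
      fun u => hasFDerivAt_superposition h1 u⟩

theorem contDiff_superposition {v : E → F} (hv : ContDiff ℝ ∞ v) :
    ContDiff ℝ ∞ (superposition (K := K) v hv.continuous) :=
  contDiff_infty.2 fun n => contDiff_superposition_nat n hv

end Nemytskii

/-! ### Inverse function theorem in the form of a chart. -/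

section InverseFunction

variable {E F : Type*} [NormedAddCommGroup E] [NormedSpace ℝ E] [CompleteSpace E]
  [NormedAddCommGroup F] [NormedSpace ℝ F]

/-- The inverse is smooth at the image of every point where the derivative is invertible. Invertible
operators form an open set, so restricting to `V` makes the inverse smooth on its whole domain. -/
theorem exists_chart_of_fderiv_equiv {f : E → F} {U : Set E} (hU : IsOpen U)
    (hf : ContDiffOn ℝ ∞ f U) {x₀ : E} (hx₀ : x₀ ∈ U) (e : E ≃L[ℝ] F)
    (he : HasFDerivAt f (e : E →L[ℝ] F) x₀) :
    ∃ Φ : OpenPartialHomeomorph E F, x₀ ∈ Φ.source ∧ Φ.source ⊆ U ∧ IsSmoothChart Φ ∧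
      ⇑Φ = f ∧ ∀ x ∈ Φ.source, ∃ e' : E ≃L[ℝ] F, HasFDerivAt f (e' : E →L[ℝ] F) x := by
  have hfx : ContDiffAt ℝ ∞ f x₀ := hf.contDiffAt (hU.mem_nhds hx₀)
  have hd : ContinuousOn (fderiv ℝ f) U :=
    hf.continuousOn_fderiv_of_isOpen hU (by exact_mod_cast le_top)
  let V : Set E := U ∩ fderiv ℝ f ⁻¹' Set.range ((↑) : (E ≃L[ℝ] F) → E →L[ℝ] F)
  have hV : IsOpen V := hd.isOpen_inter_preimage hU (ContinuousLinearEquiv.isOpen)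
  have hxV : x₀ ∈ V := ⟨hx₀, e, by rw [he.fderiv]⟩
  let Ψ := hfx.toOpenPartialHomeomorph f he (by simp)
  let Φ := Ψ.restrOpen V hV
  have hsrc : Φ.source = Ψ.source ∩ V := rfl
  have hder : ∀ x ∈ V, ∃ e' : E ≃L[ℝ] F, HasFDerivAt f (e' : E →L[ℝ] F) x := by
    rintro x ⟨hxU, e', he'⟩
    refine ⟨e', ?_⟩
    rw [he']
    exact ((hf.contDiffAt (hU.mem_nhds hxU)).differentiableAt (by simp)).hasFDerivAt
  have hΦf : ⇑Φ = f := rfl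
  refine ⟨Φ, ⟨hfx.mem_toOpenPartialHomeomorph_source he (by simp), hxV⟩,
    fun x hx => hx.2.1, ⟨hf.mono fun x hx => hx.2.1, ?_⟩, rfl, fun x hx => hder x hx.2⟩
  intro y hy
  have hys : Φ.symm y ∈ Φ.source := Φ.map_target hy
  obtain ⟨e', he'⟩ := hder _ hys.2
  exact (Φ.contDiffAt_symm hy (f₀' := e') (by rw [hΦf]; exact he')
    (by rw [hΦf]; exact hf.contDiffAt (hU.mem_nhds hys.2.1))).contDiffWithinAt

end InverseFunction

/-! ### Smooth local flows from the integral equation. -/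

section Flow

variable {E : Type u} [NormedAddCommGroup E] [NormedSpace ℝ E] [CompleteSpace E]

/-- Integration from `0`, as an operator on continuous paths parametrized by `[0, 1]`. -/
noncomputable def pathIntegral : C(unitInterval, E) →L[ℝ] C(unitInterval, E) :=
  LinearMap.mkContinuous
    { toFun := fun u => ⟨fun s => ∫ τ in (0 : ℝ)..s, u (Set.projIcc 0 1 zero_le_one τ), by
        have h : Continuous fun τ : ℝ => u (Set.projIcc 0 1 zero_le_one τ) := by fun_prop
        exact (intervalIntegral.continuous_primitive (fun a b => h.intervalIntegrable a b) 0).comp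
          continuous_subtype_val⟩
      map_add' := fun u w => by
        ext s
        have h (u : C(unitInterval, E)) :
          Continuous fun τ : ℝ => u (Set.projIcc 0 1 zero_le_one τ) := by fun_prop
        simpa using intervalIntegral.integral_add ((h u).intervalIntegrable _ _)
          ((h w).intervalIntegrable _ _)
      map_smul' := fun c u => by
        ext s
        simp } 1 (by
    intro u
    rw [ContinuousMap.norm_le _ (by positivity)]
    intro s
    have := intervalIntegral.norm_integral_le_of_norm_le_const (a := 0) (b := (s : ℝ))
      (C := ‖u‖) (f := fun τ : ℝ => u (Set.projIcc 0 1 zero_le_one τ))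
      (fun τ _ => u.norm_coe_le_norm _)
    refine this.trans ?_
    rw [sub_zero, one_mul, abs_of_nonneg s.2.1]
    exact mul_le_of_le_one_right (norm_nonneg _) s.2.2)

theorem pathIntegral_apply (u : C(unitInterval, E)) (s : unitInterval) :
    pathIntegral u s = ∫ τ in (0 : ℝ)..s, u (Set.projIcc 0 1 zero_le_one τ) := rfl

theorem norm_pathIntegral_le (u : C(unitInterval, E)) : ‖pathIntegral u‖ ≤ ‖u‖ := by
  simpa using (pathIntegral (E := E)).le_of_opNorm_le
    (LinearMap.mkContinuous_norm_le _ zero_le_one _) u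

/-- The identity satisfied by `s ↦ s • v (u s)` along a rescaled integral curve `u`. -/
theorem smul_comp_eq_pathIntegral {v : E → E} (hv : ContDiff ℝ 1 v) {t : ℝ} {x : E}
    {u w : C(unitInterval, E)}
    (hu : u = ContinuousMap.const _ x + t • pathIntegral (superposition v hv.continuous u))
    (hw : ∀ s, w s = (s : ℝ) • v (u s)) :
    w = pathIntegral (superposition v hv.continuous u) + t • pathIntegral
      (pointwiseApply (superposition (fderiv ℝ v) (hv.continuous_fderiv (by norm_num)) u) w) := by
  have hc : Continuous (fderiv ℝ v) := hv.continuous_fderiv (by norm_num)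
  set p : ℝ → unitInterval := Set.projIcc 0 1 zero_le_one with hp
  have hpc : Continuous p := continuous_projIcc
  have hpm : ∀ τ (hτ : τ ∈ Set.Icc (0 : ℝ) 1), (p τ : ℝ) = τ := fun τ hτ => by
    simp [hp, Set.projIcc_of_mem _ hτ]
  -- `U` extends `u` to the real line through the integral equation. Integrating the derivative of τ
  -- ↦ τ v(U τ) from 0 to s gives the identity.
  let U : ℝ → E := fun τ => x + t • ∫ σ in (0 : ℝ)..τ, v (u (p σ))
  have hcont : Continuous fun σ => v (u (p σ)) := hv.continuous.comp (u.continuous.comp hpc)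
  have hU : ∀ τ, HasDerivAt U (t • v (u (p τ))) τ := fun τ =>
    ((intervalIntegral.integral_hasDerivAt_right (hcont.intervalIntegrable _ _)
      (hcont.stronglyMeasurableAtFilter _ _) hcont.continuousAt).const_smul t).const_add x
  have hUu : ∀ s : unitInterval, U s = u s := fun s => by
    conv_rhs => rw [hu]
    simp [pathIntegral_apply, U, hp]
  have hUp : ∀ τ ∈ Set.Icc (0 : ℝ) 1, U τ = u (p τ) := fun τ hτ => by
    rw [← hUu, hpm τ hτ]
  have hUc : Continuous U := continuous_iff_continuousAt.2 fun τ => (hU τ).continuousAt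
  have hder : ∀ τ, HasDerivAt (fun τ => τ • v (U τ))
      (τ • fderiv ℝ v (U τ) (t • v (u (p τ))) + v (U τ)) τ := fun τ => by
    have h1 := ((hv.differentiable (by norm_num)) (U τ)).hasFDerivAt.comp_hasDerivAt τ (hU τ)
    have h2 := (hasDerivAt_id τ).smul h1
    simp only [id, one_smul] at h2
    exact h2
  ext s
  have h_int : Continuous fun τ => τ • fderiv ℝ v (U τ) (t • v (u (p τ))) + v (U τ) := by
    have h2 : Continuous fun τ => fderiv ℝ v (U τ) := hc.comp hUc
    have h3 : Continuous fun τ => v (U τ) := hv.continuous.comp hUc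
    fun_prop
  have hF := intervalIntegral.integral_eq_sub_of_hasDerivAt (a := 0) (b := (s : ℝ))
    (fun τ _ => hder τ) (h_int.intervalIntegrable _ _)
  simp only [zero_smul, sub_zero] at hF
  rw [hw, ← hUu, ← hF]
  simp only [ContinuousMap.add_apply, ContinuousMap.smul_apply, pathIntegral_apply]
  rw [← intervalIntegral.integral_smul, ← intervalIntegral.integral_add]
  · apply intervalIntegral.integral_congr
    intro τ hτ
    rw [Set.uIcc_of_le s.2.1] at hτ
    have hτ' : τ ∈ Set.Icc (0 : ℝ) 1 := ⟨hτ.1, hτ.2.trans s.2.2⟩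
    simp only [superposition_apply, pointwiseApply_apply, hw]
    change _ = v (u (p τ)) + t • fderiv ℝ v (u (p τ)) ((p τ : ℝ) • v (u (p τ)))
    rw [hUp τ hτ', hpm τ hτ', map_smul, map_smul, add_comm, smul_comm]
  · exact hcont.intervalIntegrable _ _
  · have : Continuous fun τ => t • (pointwiseApply (superposition (fderiv ℝ v) hc u) w) (p τ) := by
      fun_prop
    exact this.intervalIntegrable _ _

/-- A smooth vector field with bounded derivative has a smooth local flow. -/
theorem exists_flow_of_bounded_fderiv {v : E → E} (hv : ContDiff ℝ ∞ v) {C : ℝ}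
    (hC : ∀ x, ‖fderiv ℝ v x‖ ≤ C) (x₀ : E) :
    ∃ (W : Set (ℝ × E)) (φ : ℝ × E → E), IsOpen W ∧ (0, x₀) ∈ W ∧ ContDiffOn ℝ ∞ φ W ∧
      (∀ x, (0, x) ∈ W → φ (0, x) = x) ∧
      ∀ t x, (t, x) ∈ W → HasDerivAt (fun s => φ (s, x)) (v (φ (t, x))) t := by
  let X := C(unitInterval, E)
  have hv1 : ContDiff ℝ 1 v := hv.of_le (by exact_mod_cast le_top)
  let N : X → X := superposition v hv.continuous
  have hN : ContDiff ℝ ∞ N := contDiff_superposition hv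
  let cst : E →L[ℝ] X := LinearMap.mkContinuous
    { toFun := fun x => ContinuousMap.const _ x
      map_add' := fun _ _ => rfl
      map_smul' := fun _ _ => rfl } 1 (fun x => by
        rw [ContinuousMap.norm_le _ (by positivity)]
        intro s
        rw [one_mul]
        exact le_rfl)
  -- The rescaled curve u(s) = φ(st, x) on [0, 1] solves u = x + t ∫₀ˢ v(u), that is, f((t, x), u) =
  -- ((t, x), 0). At t = 0 the partial derivative in u is the identity, so u depends smoothly on (t,
  -- x); the flow is its value at s = 1.
  let f : (ℝ × E) × X → (ℝ × E) × X := fun q =>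
    (q.1, q.2 - cst q.1.2 - q.1.1 • pathIntegral (N q.2))
  have hf : ContDiff ℝ ∞ f := by
    have h1 : ContDiff ℝ ∞ fun q : (ℝ × E) × X => pathIntegral (N q.2) :=
      (pathIntegral (E := E)).contDiff.comp (hN.comp contDiff_snd)
    have h2 : ContDiff ℝ ∞ fun q : (ℝ × E) × X => cst q.1.2 :=
      cst.contDiff.comp (contDiff_snd.comp contDiff_fst)
    exact contDiff_fst.prodMk ((contDiff_snd.sub h2).sub
      ((contDiff_fst.comp contDiff_fst).smul h1))
  let u₀ : X := cst x₀
  let S : ℝ × E →L[ℝ] X := -(cst.comp (ContinuousLinearMap.snd ℝ ℝ E)) -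
    (ContinuousLinearMap.fst ℝ ℝ E).smulRight (pathIntegral (N u₀))
  let e : ((ℝ × E) × X) ≃L[ℝ] (ℝ × E) × X :=
    ContinuousLinearEquiv.skewProd (ContinuousLinearEquiv.refl ℝ _)
      (ContinuousLinearEquiv.refl ℝ _) S
  have he : HasFDerivAt f (e : ((ℝ × E) × X) →L[ℝ] (ℝ × E) × X) ((0, x₀), u₀) := by
    have h1 : DifferentiableAt ℝ (fun q : (ℝ × E) × X => pathIntegral (N q.2)) ((0, x₀), u₀) :=
      ((pathIntegral (E := E)).contDiff.comp (hN.comp contDiff_snd)).differentiable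
        (by simp) _
    have h2 := (((ContinuousLinearMap.snd ℝ (ℝ × E) X).hasFDerivAt (x := ((0, x₀), u₀))).sub
      ((cst.comp ((ContinuousLinearMap.snd ℝ ℝ E).comp
        (ContinuousLinearMap.fst ℝ (ℝ × E) X))).hasFDerivAt (x := ((0, x₀), u₀)))).sub
      (((ContinuousLinearMap.fst ℝ ℝ E).comp
        (ContinuousLinearMap.fst ℝ (ℝ × E) X)).hasFDerivAt (x := ((0, x₀), u₀)) |>.smul
          h1.hasFDerivAt)
    have h3 := ((ContinuousLinearMap.fst ℝ (ℝ × E) X).hasFDerivAt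
      (x := ((0, x₀), u₀))).prodMk h2
    refine h3.congr_fderiv ?_
    refine ContinuousLinearMap.ext fun q => ?_
    refine Prod.ext rfl ?_
    change q.2 - cst q.1.2 - ((0 : ℝ) • _ + q.1.1 • pathIntegral (N u₀)) =
      q.2 + (-(cst q.1.2) - q.1.1 • pathIntegral (N u₀))
    rw [zero_smul]
    abel
  obtain ⟨Φ, hx₀, -, hΦ, hΦf, -⟩ := exists_chart_of_fderiv_equiv isOpen_univ hf.contDiffOn
    (Set.mem_univ _) e he
  have hf0 : f ((0, x₀), u₀) = ((0, x₀), 0) := by simp [f, u₀]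
  let ι : ℝ × E → (ℝ × E) × X := fun p => (p, 0)
  have hι : ContDiff ℝ ∞ ι := contDiff_id.prodMk contDiff_const
  -- The bound |t| C < 1 makes the linearised integral equation uniquely solvable.
  let W : Set (ℝ × E) := ι ⁻¹' Φ.target ∩ {p | |p.1| * C < 1}
  have hW : IsOpen W := (Φ.open_target.preimage hι.continuous).inter
    (isOpen_lt (by fun_prop) continuous_const)
  let u : ℝ × E → X := fun p => (Φ.symm (ι p)).2
  have hu : ContDiffOn ℝ ∞ u W :=
    contDiff_snd.comp_contDiffOn (hΦ.2.comp hι.contDiffOn fun p hp => hp.1)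
  have heq : ∀ p ∈ W, u p = cst p.2 + p.1 • pathIntegral (N (u p)) := by
    intro p hp
    have h1 : f (Φ.symm (ι p)) = ι p := by rw [← hΦf]; exact Φ.right_inv hp.1
    have h2 : (Φ.symm (ι p)).1 = p := congrArg Prod.fst h1
    have h3 : (f (Φ.symm (ι p))).2 = 0 := congrArg Prod.snd h1
    simp only [f, h2] at h3
    rw [sub_sub, sub_eq_zero] at h3
    exact h3
  let ev : X →L[ℝ] E := ContinuousMap.evalCLM ℝ (1 : unitInterval)
  refine ⟨W, fun p => u p 1, hW, ⟨?_, by simp⟩, ?_, ?_, ?_⟩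
  · have := Φ.map_source hx₀
    rwa [hΦf, hf0] at this
  · exact ev.contDiff.comp_contDiffOn hu
  · intro x hx
    have := heq _ hx
    simp only [zero_smul, add_zero] at this
    change u (0, x) 1 = x
    rw [this]
    rfl
  · intro t x hx
    have hud : DifferentiableAt ℝ u (t, x) :=
      (hu.contDiffAt (hW.mem_nhds hx)).differentiableAt (by simp)
    have hcurve : HasDerivAt (fun s : ℝ => (s, x)) ((1, 0) : ℝ × E) t :=
      (hasDerivAt_id t).prodMk (hasDerivAt_const t x)
    let w : X := fderiv ℝ u (t, x) (1, 0)
    have hw : HasDerivAt (fun s => u (s, x)) w t := by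
      have := hud.hasFDerivAt.comp_hasDerivAt t hcurve
      exact this
    have hNd := hasFDerivAt_superposition hv1 (u (t, x))
    have hJ : HasDerivAt (fun s => cst x + s • pathIntegral (N (u (s, x))))
        (pathIntegral (N (u (t, x))) + t • pathIntegral (pointwiseApply (superposition (fderiv ℝ v)
          (hv1.continuous_fderiv (by norm_num)) (u (t, x))) w)) t := by
      have h1 := (pathIntegral (E := E)).hasFDerivAt.comp_hasDerivAt t
        (hNd.comp_hasDerivAt t hw)
      have h2 := ((hasDerivAt_id t).smul h1).const_add (cst x)
      refine h2.congr_deriv ?_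
      simp only [id, one_smul]
      rw [add_comm]
      rfl
    have hev : (fun s => cst x + s • pathIntegral (N (u (s, x)))) =ᶠ[𝓝 t]
        fun s => u (s, x) := by
      have : ∀ᶠ s in 𝓝 t, (s, x) ∈ W :=
        hcurve.continuousAt.preimage_mem_nhds (hW.mem_nhds hx)
      filter_upwards [this] with s hs using (heq _ hs).symm
    have hwe := hw.unique (hJ.congr_of_eventuallyEq hev.symm)
    -- The expected value of ∂ₜu is s v(u(s)). Both it and `w` solve the linearised equation; since
    -- integration has norm at most 1, their difference is bounded by |t| C < 1 times itself and
    -- vanishes.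
    let w' : X := ⟨fun s => (s : ℝ) • v (u (t, x) s),
      continuous_subtype_val.smul (hv.continuous.comp (u (t, x)).continuous)⟩
    have hw' := smul_comp_eq_pathIntegral hv1 (w := w') (heq _ hx) (fun s => rfl)
    have hd : w - w' = t • pathIntegral (pointwiseApply (superposition (fderiv ℝ v)
          (hv1.continuous_fderiv (by norm_num)) (u (t, x))) (w - w')) := by
      conv_lhs => rw [hwe, hw']
      rw [map_sub, map_sub, smul_sub]
      exact add_sub_add_left_eq_sub _ _ _
    have hle : ‖w - w'‖ ≤ |t| * C * ‖w - w'‖ := by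
      conv_lhs => rw [hd]
      rw [norm_smul, mul_assoc, Real.norm_eq_abs]
      gcongr
      refine (norm_pathIntegral_le _).trans ?_
      have hC0 : 0 ≤ C := (norm_nonneg _).trans (hC 0)
      rw [ContinuousMap.norm_le _ (by positivity)]
      intro s
      refine (ContinuousLinearMap.le_opNorm _ _).trans ?_
      gcongr
      · exact hC _
      · exact (w - w').norm_coe_le_norm s
    have h0 : w = w' := by
      have hlt : |t| * C < 1 := hx.2
      have : ‖w - w'‖ ≤ 0 := by nlinarith [norm_nonneg (w - w')]
      rwa [norm_le_zero_iff, sub_eq_zero] at this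
    have := ev.hasFDerivAt.comp_hasDerivAt t hw
    refine this.congr_deriv ?_
    rw [h0]
    change ((1 : unitInterval) : ℝ) • v (u (t, x) 1) = _
    simp

end Flow

/-! ### Cutoffs and flows of locally defined fields. -/

section FiniteDimensional

variable {E : Type u} [NormedAddCommGroup E] [NormedSpace ℝ E] [FiniteDimensional ℝ E]

/-- A locally defined smooth field agrees near a given point with a global compactly supported one
that is everywhere a multiple of it. -/
theorem exists_cutoff {F : Type*} [NormedAddCommGroup F] [NormedSpace ℝ F] {X : E → F} {U : Set E}
    (hU : IsOpen U) (hX : ContDiffOn ℝ ∞ X U) {x₀ : E} (hx₀ : x₀ ∈ U) :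
    ∃ X' : E → F, ContDiff ℝ ∞ X' ∧ HasCompactSupport X' ∧ X' =ᶠ[𝓝 x₀] X ∧
      (∀ y ∈ U, ∃ c : ℝ, X' y = c • X y) ∧ ∀ y ∉ U, X' y = 0 := by
  obtain ⟨r, hr, hrU⟩ := Metric.nhds_basis_closedBall.mem_iff.1 (hU.mem_nhds hx₀)
  let χ : ContDiffBump x₀ := ⟨r / 2, r, by linarith, by linarith⟩
  have hts : tsupport χ ⊆ U := by rw [χ.tsupport_eq]; exact hrU
  have hsupp : tsupport (fun y => χ y • X y) ⊆ tsupport χ :=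
    closure_mono (Function.support_smul_subset_left _ _)
  refine ⟨fun y => χ y • X y, ?_, χ.hasCompactSupport.smul_right, ?_, fun y _ => ⟨χ y, rfl⟩, ?_⟩
  · refine contDiff_iff_contDiffAt.2 fun y => ?_
    by_cases hy : y ∈ tsupport (fun y => χ y • X y)
    · exact χ.contDiffAt.smul (hX.contDiffAt (hU.mem_nhds (hts (hsupp hy))))
    · exact contDiffAt_const.congr_of_eventuallyEq (notMem_tsupport_iff_eventuallyEq.1 hy)
  · filter_upwards [χ.eventuallyEq_one] with y hy
    simp [hy]
  · intro y hy
    have : χ y = 0 := image_eq_zero_of_notMem_tsupport fun h => hy (hts h)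
    simp [this]

/-- A smooth vector field has a smooth local flow near every point. -/
theorem exists_local_flow {v : E → E} {U : Set E} (hU : IsOpen U) (hv : ContDiffOn ℝ ∞ v U)
    {x₀ : E} (hx₀ : x₀ ∈ U) :
    ∃ (W : Set (ℝ × E)) (φ : ℝ × E → E), IsOpen W ∧ (0, x₀) ∈ W ∧ ContDiffOn ℝ ∞ φ W ∧
      (∀ x, (0, x) ∈ W → φ (0, x) = x) ∧
      ∀ t x, (t, x) ∈ W → φ (t, x) ∈ U ∧
        HasDerivAt (fun s => φ (s, x)) (v (φ (t, x))) t := by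
  obtain ⟨v', hv', hc, heq, -, -⟩ := exists_cutoff hU hv hx₀
  obtain ⟨C, hC⟩ := (hc.fderiv (𝕜 := ℝ)).exists_bound_of_continuous
    (hv'.continuous_fderiv (by simp))
  obtain ⟨W, φ, hW, hx₀W, hφ, hφ0, hφd⟩ := exists_flow_of_bounded_fderiv hv' hC x₀
  -- As long as a curve stays in `V`, where `v'` and `v` agree, an integral curve of `v'` is one of
  -- `v`.
  obtain ⟨V, hVs, hV, hx₀V⟩ := mem_nhds_iff.1 (Filter.inter_mem heq (hU.mem_nhds hx₀))
  refine ⟨W ∩ φ ⁻¹' V, φ, hφ.continuousOn.isOpen_inter_preimage hW hV,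
    ⟨hx₀W, by rwa [Set.mem_preimage, hφ0 _ hx₀W]⟩, hφ.mono Set.inter_subset_left,
    fun x hx => hφ0 x hx.1, fun t x hx => ⟨(hVs hx.2).2, ?_⟩⟩
  have h1 : v' (φ (t, x)) = v (φ (t, x)) := (hVs hx.2).1
  rw [← h1]
  exact hφd t x hx.1

end FiniteDimensional

/-! ### Frames and dual frames. -/

section Frames

variable {E : Type*} [NormedAddCommGroup E] [NormedSpace ℝ E]

theorem contDiffOn_det {n : Type*} [Fintype n] [DecidableEq n] {U : Set E}
    {M : E → Matrix n n ℝ} (hM : ∀ i j, ContDiffOn ℝ ∞ (fun x => M x i j) U) :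
    ContDiffOn ℝ ∞ (fun x => (M x).det) U := by
  simp only [Matrix.det_apply]
  refine ContDiffOn.sum fun σ _ => ?_
  exact (contDiffOn_prod fun i _ => hM _ _).const_smul _

theorem contDiffOn_inv_apply {n : Type*} [Fintype n] [DecidableEq n] {U : Set E}
    {M : E → Matrix n n ℝ} (hM : ∀ i j, ContDiffOn ℝ ∞ (fun x => M x i j) U)
    (hdet : ∀ x ∈ U, (M x).det ≠ 0) (i j : n) : ContDiffOn ℝ ∞ (fun x => (M x)⁻¹ i j) U := by
  simp only [Matrix.inv_def, Ring.inverse_eq_inv', Matrix.smul_apply, smul_eq_mul,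
    Matrix.adjugate_apply]
  refine ((contDiffOn_det hM).inv hdet).mul (contDiffOn_det fun k l => ?_)
  by_cases hk : k = j
  · subst hk
    simp only [Matrix.updateRow_self]
    exact contDiffOn_const
  · simpa only [Matrix.updateRow_ne hk] using hM k l

theorem linearIndependent_of_dual {ι : Type*} [Fintype ι] [DecidableEq ι] {X : ι → E}
    {ξ : ι → E →L[ℝ] ℝ} (h : ∀ i j, ξ i (X j) = if i = j then 1 else 0) :
    LinearIndependent ℝ X := by
  rw [Fintype.linearIndependent_iff]
  intro g hg i
  have := congrArg (ξ i) hg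
  simpa [map_sum, h] using this

theorem eq_sum_of_mem_span_of_dual {ι : Type*} [Fintype ι] [DecidableEq ι] {X : ι → E}
    {ξ : ι → E →L[ℝ] ℝ} (h : ∀ i j, ξ i (X j) = if i = j then 1 else 0) {w : E}
    (hw : w ∈ Submodule.span ℝ (Set.range X)) : w = ∑ i, ξ i w • X i := by
  obtain ⟨c, rfl⟩ := (Submodule.mem_span_range_iff_exists_fun ℝ).1 hw
  refine Finset.sum_congr rfl fun i _ => ?_
  simp [map_sum, h]

/-- Near a point where they are independent, smooth vector fields span the same distribution as
a frame `Z` that is dual to constant functionals `π`. -/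
theorem exists_graph_frame {r : ℕ} {X : Fin r → E → E} {U : Set E} (hU : IsOpen U)
    (hX : ∀ i, ContDiffOn ℝ ∞ (X i) U) {x₀ : E} (hx₀ : x₀ ∈ U)
    (hli : LinearIndependent ℝ fun i => X i x₀) [FiniteDimensional ℝ E] :
    ∃ V : Set E, IsOpen V ∧ x₀ ∈ V ∧ V ⊆ U ∧
      ∃ (π : Fin r → E →L[ℝ] ℝ) (N : Fin r → Fin r → E → ℝ),
        (∀ i j, ContDiffOn ℝ ∞ (N i j) V) ∧
        (∀ x ∈ V, ∀ i j, π i (∑ k, N k j x • X k x) = if i = j then 1 else 0) ∧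
        ∀ x ∈ V, ∀ i j, ∑ k, N i k x * π k (X j x) = if i = j then 1 else 0 := by
  let L : (Fin r → ℝ) →ₗ[ℝ] E := Fintype.linearCombination ℝ fun i => X i x₀
  have hL : LinearMap.ker L = ⊥ := LinearMap.ker_eq_bot.2
    (by exact hli.fintypeLinearCombination_injective)
  obtain ⟨P, hP⟩ := L.exists_leftInverse_of_injective hL
  let π : Fin r → E →L[ℝ] ℝ := fun i => ((LinearMap.proj i).comp P).toContinuousLinearMap
  -- `π` consists of the coordinates of a left inverse of the frame at `x₀`, so `M` is the identity
  -- there and invertible nearby; the new frame is obtained with its inverse.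
  let M : E → Matrix (Fin r) (Fin r) ℝ := fun x => Matrix.of fun i j => π i (X j x)
  have hM : ∀ i j, ContDiffOn ℝ ∞ (fun x => M x i j) U := fun i j =>
    (π i).contDiff.comp_contDiffOn (hX j)
  have hM0 : M x₀ = 1 := by
    ext i j
    have h1 : L (Pi.single j 1) = X j x₀ := by
      simp [L, Fintype.linearCombination_apply]
    have h2 : P (X j x₀) = Pi.single j 1 := by
      rw [← h1]; exact LinearMap.congr_fun hP _
    simp [M, π, h2, Matrix.one_apply, Pi.single_apply]
  let V : Set E := U ∩ (fun x => (M x).det) ⁻¹' {0}ᶜ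
  have hV : IsOpen V :=
    (contDiffOn_det hM).continuousOn.isOpen_inter_preimage hU isOpen_compl_singleton
  have hdet : ∀ x ∈ V, IsUnit (M x).det := fun x hx => isUnit_iff_ne_zero.2 hx.2
  refine ⟨V, hV, ⟨hx₀, by simp [hM0]⟩, Set.inter_subset_left, π, fun i j x => (M x)⁻¹ i j,
    fun i j => contDiffOn_inv_apply (fun i j => (hM i j).mono Set.inter_subset_left)
      (fun x hx => hx.2) i j, fun x hx i j => ?_, fun x hx i j => ?_⟩
  · have := congrFun (congrFun (Matrix.mul_nonsing_inv (M x) (hdet x hx)) i) j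
    rw [Matrix.mul_apply, Matrix.one_apply] at this
    rw [← this, map_sum]
    refine Finset.sum_congr rfl fun k _ => ?_
    simp [M, mul_comm]
  · have := congrFun (congrFun (Matrix.nonsing_inv_mul (M x) (hdet x hx)) i) j
    rw [Matrix.mul_apply, Matrix.one_apply] at this
    exact this

/-- The dual forms supply smooth coefficients: a smooth section of the span of the frame is the sum
of the products `ξ i` of it with `X i`. -/
theorem exists_dual_frame {r : ℕ} {X : Fin r → E → E} {U : Set E} (hU : IsOpen U)
    (hX : ∀ i, ContDiffOn ℝ ∞ (X i) U) {x₀ : E} (hx₀ : x₀ ∈ U)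
    (hli : LinearIndependent ℝ fun i => X i x₀) [FiniteDimensional ℝ E] :
    ∃ V : Set E, IsOpen V ∧ x₀ ∈ V ∧ V ⊆ U ∧ ∃ ξ : Fin r → E → E →L[ℝ] ℝ,
      (∀ i, ContDiffOn ℝ ∞ (ξ i) V) ∧
      ∀ x ∈ V, ∀ i j, ξ i x (X j x) = if i = j then 1 else 0 := by
  obtain ⟨V, hV, hx₀V, hVU, π, N, hN, -, h⟩ := exists_graph_frame hU hX hx₀ hli
  refine ⟨V, hV, hx₀V, hVU, fun i x => ∑ k, N i k x • π k,
    fun i => ContDiffOn.sum fun k _ => (hN i k).smul contDiffOn_const, fun x hx i j => ?_⟩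
  rw [← h x hx i j]
  simp

theorem exists_linearIndependent_nhds {r : ℕ} {X : Fin r → E → E} {U : Set E} (hU : IsOpen U)
    (hX : ∀ i, ContDiffOn ℝ ∞ (X i) U) {x₀ : E} (hx₀ : x₀ ∈ U)
    (hli : LinearIndependent ℝ fun i => X i x₀) [FiniteDimensional ℝ E] :
    ∃ V : Set E, IsOpen V ∧ x₀ ∈ V ∧ V ⊆ U ∧ ∀ x ∈ V, LinearIndependent ℝ fun i => X i x := by
  obtain ⟨V, hV, hx₀V, hVU, ξ, -, h⟩ := exists_dual_frame hU hX hx₀ hli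
  exact ⟨V, hV, hx₀V, hVU, fun x hx => linearIndependent_of_dual (h x hx)⟩

end Frames

/-! ### Lie brackets of combinations of fields. -/

section Bracket

open VectorField

variable {E : Type*} [NormedAddCommGroup E] [NormedSpace ℝ E]

theorem lieBracket_sum_smul_right {ι : Type*} [Fintype ι] {V W : E → E} {x : E} {Y : ι → E → E}
    {g : ι → E → ℝ} (hW : W =ᶠ[𝓝 x] fun y => ∑ i, g i y • Y i y)
    (hg : ∀ i, DifferentiableAt ℝ (g i) x) (hY : ∀ i, DifferentiableAt ℝ (Y i) x) :
    lieBracket ℝ V W x = ∑ i, (fderiv ℝ (g i) x (V x) • Y i x +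
      g i x • lieBracket ℝ V (Y i) x) := by
  have h1 : HasFDerivAt W (∑ i, (g i x • fderiv ℝ (Y i) x +
      (fderiv ℝ (g i) x).smulRight (Y i x))) x :=
    (HasFDerivAt.fun_sum fun i _ =>
      (hg i).hasFDerivAt.smul (hY i).hasFDerivAt).congr_of_eventuallyEq hW
  simp only [lieBracket, h1.fderiv, hW.eq_of_nhds, map_sum, map_smul, smul_sub]
  rw [sum_apply, ← Finset.sum_sub_distrib]
  refine Finset.sum_congr rfl fun i _ => ?_
  simp only [add_apply, smul_apply,
    ContinuousLinearMap.smulRight_apply]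
  abel

theorem lieBracket_sum_smul_right_mem {ι : Type*} [Fintype ι] {V W : E → E} {x : E}
    {Y : ι → E → E} {g : ι → E → ℝ} (hW : W =ᶠ[𝓝 x] fun y => ∑ i, g i y • Y i y)
    (hg : ∀ i, DifferentiableAt ℝ (g i) x) (hY : ∀ i, DifferentiableAt ℝ (Y i) x)
    {S : Submodule ℝ E} (hYS : ∀ i, Y i x ∈ S) (hVS : ∀ i, lieBracket ℝ V (Y i) x ∈ S) :
    lieBracket ℝ V W x ∈ S := by
  rw [lieBracket_sum_smul_right hW hg hY]
  exact S.sum_mem fun i _ => S.add_mem (S.smul_mem _ (hYS i)) (S.smul_mem _ (hVS i))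

/-- The derivative terms in the Leibniz rule are multiples of the frame fields themselves, so once
these lie in `S` only the brackets of frame fields have to be checked. -/
theorem lieBracket_sum_smul_mem {ι κ : Type*} [Fintype ι] [Fintype κ] {V W : E → E} {x : E}
    {X : ι → E → E} {Y : κ → E → E} {f : ι → E → ℝ} {g : κ → E → ℝ}
    (hV : V =ᶠ[𝓝 x] fun y => ∑ i, f i y • X i y) (hf : ∀ i, DifferentiableAt ℝ (f i) x)
    (hX : ∀ i, DifferentiableAt ℝ (X i) x)
    (hW : W =ᶠ[𝓝 x] fun y => ∑ i, g i y • Y i y)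
    (hg : ∀ i, DifferentiableAt ℝ (g i) x) (hY : ∀ i, DifferentiableAt ℝ (Y i) x)
    {S : Submodule ℝ E} (hXS : ∀ i, X i x ∈ S) (hYS : ∀ i, Y i x ∈ S)
    (hXY : ∀ i j, lieBracket ℝ (X i) (Y j) x ∈ S) : lieBracket ℝ V W x ∈ S := by
  refine lieBracket_sum_smul_right_mem hW hg hY hYS fun j => ?_
  rw [lieBracket_swap]
  refine S.neg_mem (lieBracket_sum_smul_right_mem hV hf hX hXS fun i => ?_)
  rw [lieBracket_swap]
  exact S.neg_mem (hXY i j)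

theorem contDiffOn_lieBracket {V W : E → E} {U : Set E} (hU : IsOpen U)
    (hV : ContDiffOn ℝ ∞ V U) (hW : ContDiffOn ℝ ∞ W U) :
    ContDiffOn ℝ ∞ (lieBracket ℝ V W) U := fun x hx =>
  ((hV.contDiffAt (hU.mem_nhds hx)).lieBracket_vectorField (hW.contDiffAt (hU.mem_nhds hx))
    (m := ∞) (by simp)).contDiffWithinAt

theorem fderiv_lieBracket {F : Type*} [NormedAddCommGroup F] [NormedSpace ℝ F] {f : E → F}
    {V W : E → E} {U : Set E} (hU : IsOpen U) (hf : ContDiffOn ℝ ∞ f U)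
    (hV : ContDiffOn ℝ ∞ V U) (hW : ContDiffOn ℝ ∞ W U) {x : E} (hx : x ∈ U) :
    fderiv ℝ f x (lieBracket ℝ V W x) = fderiv ℝ (fun y => fderiv ℝ f y (W y)) x (V x) -
      fderiv ℝ (fun y => fderiv ℝ f y (V y)) x (W x) :=
  fderiv_apply_lieBracket (hf.contDiffAt (hU.mem_nhds hx))
    (by simpa using (mod_cast le_top : ((2 : ℕ∞) : WithTop ℕ∞) ≤ ∞))
    ((hW.contDiffAt (hU.mem_nhds hx)).differentiableAt (by simp))
    ((hV.contDiffAt (hU.mem_nhds hx)).differentiableAt (by simp))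

end Bracket

/-! ### Charts and the flow box theorem. -/

section Charts

variable {E F : Type*} [NormedAddCommGroup E] [NormedSpace ℝ E]
  [NormedAddCommGroup F] [NormedSpace ℝ F]

namespace IsSmoothChart

variable {Φ : OpenPartialHomeomorph E F}

theorem differentiableAt (hΦ : IsSmoothChart Φ) {x : E} (hx : x ∈ Φ.source) :
    DifferentiableAt ℝ Φ x :=
  (hΦ.1.contDiffAt (Φ.open_source.mem_nhds hx)).differentiableAt (by simp)

theorem differentiableAt_symm (hΦ : IsSmoothChart Φ) {y : F} (hy : y ∈ Φ.target) :
    DifferentiableAt ℝ Φ.symm y :=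
  (hΦ.2.contDiffAt (Φ.open_target.mem_nhds hy)).differentiableAt (by simp)

theorem fderiv_symm_fderiv (hΦ : IsSmoothChart Φ) {x : E} (hx : x ∈ Φ.source) (u : E) :
    fderiv ℝ Φ.symm (Φ x) (fderiv ℝ Φ x u) = u := by
  have h1 := (hΦ.differentiableAt_symm (Φ.map_source hx)).hasFDerivAt.comp x
    (hΦ.differentiableAt hx).hasFDerivAt
  have h2 : (Φ.symm ∘ Φ) =ᶠ[𝓝 x] id := by
    filter_upwards [Φ.open_source.mem_nhds hx] with y hy using Φ.left_inv hy
  have h3 := h1.unique ((hasFDerivAt_id x).congr_of_eventuallyEq h2)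
  exact congrArg (fun A : E →L[ℝ] E => A u) h3

theorem symm (hΦ : IsSmoothChart Φ) : IsSmoothChart Φ.symm := ⟨hΦ.2, by simpa using hΦ.1⟩

theorem fderiv_fderiv_symm (hΦ : IsSmoothChart Φ) {x : E} (hx : x ∈ Φ.source) (q : F) :
    fderiv ℝ Φ x (fderiv ℝ Φ.symm (Φ x) q) = q := by
  have := hΦ.symm.fderiv_symm_fderiv (x := Φ x) (Φ.map_source hx) q
  rw [Φ.left_inv hx] at this
  simpa using this

theorem fderiv_injective (hΦ : IsSmoothChart Φ) {x : E} (hx : x ∈ Φ.source) :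
    Function.Injective (fderiv ℝ Φ x) :=
  Function.LeftInverse.injective (hΦ.fderiv_symm_fderiv hx)

end IsSmoothChart

theorem exists_chart_of_injective_fderiv [FiniteDimensional ℝ E] [FiniteDimensional ℝ F]
    (hdim : Module.finrank ℝ E = Module.finrank ℝ F) {f : E → F} {U : Set E} (hU : IsOpen U)
    (hf : ContDiffOn ℝ ∞ f U) {x₀ : E} (hx₀ : x₀ ∈ U)
    (hinj : ∀ u, fderiv ℝ f x₀ u = 0 → u = 0) :
    ∃ Φ : OpenPartialHomeomorph E F, x₀ ∈ Φ.source ∧ Φ.source ⊆ U ∧ IsSmoothChart Φ ∧ ⇑Φ = f := by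
  let e : E ≃ₗ[ℝ] F := LinearMap.linearEquivOfInjective (fderiv ℝ f x₀ : E →ₗ[ℝ] F)
    ((injective_iff_map_eq_zero _).2 hinj) hdim
  have he : (e.toContinuousLinearEquiv : E →L[ℝ] F) = fderiv ℝ f x₀ := by
    ext u; rfl
  obtain ⟨Φ, h1, h2, h3, h4, -⟩ := exists_chart_of_fderiv_equiv hU hf hx₀
    e.toContinuousLinearEquiv (by
      rw [he]
      exact ((hf.contDiffAt (hU.mem_nhds hx₀)).differentiableAt (by simp)).hasFDerivAt)
  exact ⟨Φ, h1, h2, h3, h4⟩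

/-- Flow box theorem. -/
theorem exists_flow_box [FiniteDimensional ℝ E] [FiniteDimensional ℝ F]
    (hdim : Module.finrank ℝ E = Module.finrank ℝ F + 1) {v : E → E} {U : Set E} (hU : IsOpen U)
    (hv : ContDiffOn ℝ ∞ v U) {x₀ : E} (hx₀ : x₀ ∈ U) (hvx : v x₀ ≠ 0) :
    ∃ Φ : OpenPartialHomeomorph E (F × ℝ), x₀ ∈ Φ.source ∧ Φ.source ⊆ U ∧ IsSmoothChart Φ ∧
      Φ x₀ = 0 ∧ ∀ x ∈ Φ.source, fderiv ℝ Φ x (v x) = (0, 1) := by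
  obtain ⟨W, φ, hW, hW0, hφ, hφ0, hφd⟩ := exists_local_flow hU hv hx₀
  let A₀ : (F × ℝ) ≃L[ℝ] E := ContinuousLinearEquiv.ofFinrankEq (by simp [hdim])
  obtain ⟨B, hB⟩ := SeparatingDual.exists_continuousLinearEquiv_apply_eq (R := ℝ)
    (x := A₀ (0, 1)) (y := v x₀) (by simp) hvx
  let A : (F × ℝ) ≃L[ℝ] E := A₀.trans B
  have hA : A (0, 1) = v x₀ := hB
  -- The map Ψ(p, t) = φ(t, x₀ + A(p, 0)) flows off a hyperplane transversal to `v`. Since A(0, 1) =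
  -- v(x₀), the derivative of Ψ at 0 is `A` itself, and Ψ⁻¹ is the flow box.
  let ι : F × ℝ → ℝ × E := fun q => (q.2, x₀ + A (q.1, 0))
  let ι' : F × ℝ →L[ℝ] ℝ × E := (ContinuousLinearMap.snd ℝ F ℝ).prod
    ((A : (F × ℝ) →L[ℝ] E).comp ((ContinuousLinearMap.fst ℝ F ℝ).prod 0))
  have hι' : ∀ q, HasFDerivAt ι ι' q := fun q =>
    (ContinuousLinearMap.snd ℝ F ℝ).hasFDerivAt.prodMk
      ((((A : (F × ℝ) →L[ℝ] E).comp
        ((ContinuousLinearMap.fst ℝ F ℝ).prod 0)).hasFDerivAt).const_add x₀)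
  have hι : ContDiff ℝ ∞ ι := contDiff_snd.prodMk
    (contDiff_const.add (A.contDiff.comp (contDiff_fst.prodMk contDiff_const)))
  have hι0 : ι 0 = (0, x₀) := by simp [ι, ← Prod.zero_eq_mk]
  let W' : Set (F × ℝ) := ι ⁻¹' W
  have hW' : IsOpen W' := hW.preimage hι.continuous
  have h0W' : (0 : F × ℝ) ∈ W' := by rw [Set.mem_preimage, hι0]; exact hW0
  let Ψ : F × ℝ → E := φ ∘ ι
  have hΨ : ContDiffOn ℝ ∞ Ψ W' := hφ.comp hι.contDiffOn fun q hq => hq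
  have hφdiff : ∀ p ∈ W, HasFDerivAt φ (fderiv ℝ φ p) p := fun p hp =>
    ((hφ.contDiffAt (hW.mem_nhds hp)).differentiableAt (by simp)).hasFDerivAt
  have hφt : ∀ t x, (t, x) ∈ W → fderiv ℝ φ (t, x) (1, 0) = v (φ (t, x)) := by
    intro t x hx
    have hcurve : HasDerivAt (fun s : ℝ => (s, x)) ((1, 0) : ℝ × E) t :=
      (hasDerivAt_id t).prodMk (hasDerivAt_const t x)
    have h1 := (hφdiff _ hx).comp_hasDerivAt t hcurve
    exact h1.unique (hφd t x hx).2
  have hφx : ∀ h, fderiv ℝ φ (0, x₀) (0, h) = h := by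
    intro h
    have h1 := (hφdiff _ hW0).comp x₀ ((hasFDerivAt_const (0 : ℝ) x₀).prodMk (hasFDerivAt_id x₀))
    have h2 : (φ ∘ fun x : E => ((0 : ℝ), x)) =ᶠ[𝓝 x₀] id := by
      have : ∀ᶠ x in 𝓝 x₀, ((0 : ℝ), x) ∈ W :=
        (Continuous.prodMk_right (0 : ℝ)).continuousAt.preimage_mem_nhds (hW.mem_nhds hW0)
      filter_upwards [this] with x hx using hφ0 x hx
    have h3 := h1.unique ((hasFDerivAt_id x₀).congr_of_eventuallyEq h2)
    simpa using congrArg (fun A : E →L[ℝ] E => A h) h3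
  have hΨ0 : HasFDerivAt Ψ (A : (F × ℝ) →L[ℝ] E) 0 := by
    have h1 := (hφdiff (ι 0) h0W').comp 0 (hι' 0)
    refine h1.congr_fderiv (ContinuousLinearMap.ext fun q => ?_)
    rw [hι0]
    change fderiv ℝ φ (0, x₀) (q.2, A (q.1, 0)) = A q
    have h2 : (q.2, A (q.1, 0)) = q.2 • ((1, 0) : ℝ × E) + (0, A (q.1, 0)) := by
      simp
    rw [h2, map_add, map_smul, hφx, hφt 0 x₀ hW0, hφ0 x₀ hW0, ← hA, ← map_smul, ← map_add]
    simp
  obtain ⟨Φ, h0, hsrc, hΦ, hΦΨ, -⟩ := exists_chart_of_fderiv_equiv hW' hΨ h0W' A hΨ0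
  have hΨ00 : Ψ 0 = x₀ := by
    change φ (ι 0) = x₀
    rw [hι0, hφ0 x₀ hW0]
  have hΦ0 : Φ 0 = x₀ := by rw [hΦΨ, hΨ00]
  refine ⟨Φ.symm, ?_, ?_, hΦ.symm, ?_, ?_⟩
  · rw [← hΦ0]; exact Φ.map_source h0
  · intro x hx
    have h1 := Φ.right_inv hx
    have h2 := hsrc (Φ.map_target hx)
    rw [hΦΨ] at h1
    rw [← h1]
    exact (hφd _ _ h2).1
  · rw [← hΦ0]; exact Φ.left_inv h0
  · intro x hx
    obtain ⟨q, hq, rfl⟩ : ∃ q ∈ Φ.source, Φ q = x := ⟨_, Φ.map_target hx, Φ.right_inv hx⟩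
    have h2 := hsrc hq
    have h3 : fderiv ℝ Φ q (0, 1) = v (Φ q) := by
      rw [hΦΨ]
      have h4 := (hφdiff (ι q) h2).comp q (hι' q)
      rw [h4.fderiv]
      change fderiv ℝ φ (ι q) (1, A (0, 0)) = _
      rw [← Prod.zero_eq_mk, map_zero]
      exact hφt _ _ h2
    rw [← h3, hΦ.fderiv_symm_fderiv hq]

end Charts

open VectorField

/-! ### Vector fields written in a chart. -/

section Push

variable {E F : Type*} [NormedAddCommGroup E] [NormedSpace ℝ E]
  [NormedAddCommGroup F] [NormedSpace ℝ F]

/-- The vector field `X` written in the chart `Φ`. -/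
noncomputable def pushField (Φ : OpenPartialHomeomorph E F) (X : E → E) : F → F :=
  fun q => fderiv ℝ Φ (Φ.symm q) (X (Φ.symm q))

variable {Φ : OpenPartialHomeomorph E F}

theorem pushField_apply (X : E → E) {x : E} (hx : x ∈ Φ.source) :
    pushField Φ X (Φ x) = fderiv ℝ Φ x (X x) := by
  rw [pushField, Φ.left_inv hx]

theorem contDiffOn_fderiv_apply {f : E → F} {U : Set E} (hU : IsOpen U) (hf : ContDiffOn ℝ ∞ f U)
    {X : E → E} (hX : ContDiffOn ℝ ∞ X U) : ContDiffOn ℝ ∞ (fun x => fderiv ℝ f x (X x)) U :=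
  (hf.fderiv_of_isOpen hU (by simp)).clm_apply hX

theorem contDiffOn_pushField (hΦ : IsSmoothChart Φ) {X : E → E}
    (hX : ContDiffOn ℝ ∞ X Φ.source) : ContDiffOn ℝ ∞ (pushField Φ X) Φ.target :=
  (contDiffOn_fderiv_apply Φ.open_source hΦ.1 hX).comp hΦ.2 fun _ hq => Φ.map_target hq

theorem fderiv_pushField (hΦ : IsSmoothChart Φ) {X : E → E} (hX : ContDiffOn ℝ ∞ X Φ.source)
    {x : E} (hx : x ∈ Φ.source) (w : E) :
    fderiv ℝ (pushField Φ X) (Φ x) (fderiv ℝ Φ x w) =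
      fderiv ℝ (fun y => fderiv ℝ Φ y (X y)) x w := by
  have h1 : DifferentiableAt ℝ (pushField Φ X) (Φ x) :=
    ((contDiffOn_pushField hΦ hX).contDiffAt
      (Φ.open_target.mem_nhds (Φ.map_source hx))).differentiableAt (by simp)
  have h2 := h1.hasFDerivAt.comp x (hΦ.differentiableAt hx).hasFDerivAt
  have h3 : (fun y => fderiv ℝ Φ y (X y)) =ᶠ[𝓝 x] pushField Φ X ∘ Φ := by
    filter_upwards [Φ.open_source.mem_nhds hx] with y hy using (pushField_apply X hy).symm
  rw [h3.fderiv_eq, h2.fderiv]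
  rfl

theorem pushField_lieBracket (hΦ : IsSmoothChart Φ) {X Y : E → E}
    (hX : ContDiffOn ℝ ∞ X Φ.source) (hY : ContDiffOn ℝ ∞ Y Φ.source) {q : F}
    (hq : q ∈ Φ.target) :
    pushField Φ (lieBracket ℝ X Y) q = lieBracket ℝ (pushField Φ X) (pushField Φ Y) q := by
  obtain ⟨x, hx, rfl⟩ : ∃ x ∈ Φ.source, Φ x = q := ⟨_, Φ.map_target hq, Φ.right_inv hq⟩
  rw [pushField_apply _ hx, fderiv_lieBracket Φ.open_source hΦ.1 hX hY hx, lieBracket,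
    pushField_apply _ hx, pushField_apply _ hx, fderiv_pushField hΦ hX hx,
    fderiv_pushField hΦ hY hx]

theorem map_fderiv_span {ι : Type*} (X : ι → E → E) {x : E} (hx : x ∈ Φ.source) :
    (Submodule.span ℝ (Set.range fun i => X i x)).map (fderiv ℝ Φ x : E →ₗ[ℝ] F) =
      Submodule.span ℝ (Set.range fun i => pushField Φ (X i) (Φ x)) := by
  rw [Submodule.map_span, ← Set.range_comp]
  congr 2
  ext i
  exact (pushField_apply _ hx).symm

theorem linearIndependent_pushField (hΦ : IsSmoothChart Φ) {ι : Type*} {X : ι → E → E} {x : E}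
    (hx : x ∈ Φ.source) (hX : LinearIndependent ℝ fun i => X i x) :
    LinearIndependent ℝ fun i => pushField Φ (X i) (Φ x) := by
  have h1 : (fun i => pushField Φ (X i) (Φ x)) =
      (fderiv ℝ Φ x : E →ₗ[ℝ] F) ∘ fun i => X i x := by
    ext i; exact pushField_apply _ hx
  rw [h1]
  exact hX.map' _ (LinearMap.ker_eq_bot.2 (hΦ.fderiv_injective hx))

/-- In a flow box of `v`, bracketing with `v` is differentiation along the last coordinate. -/
theorem fderiv_pushField_flow_box {G : Type*} [NormedAddCommGroup G] [NormedSpace ℝ G]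
    {Φ : OpenPartialHomeomorph E (G × ℝ)} (hΦ : IsSmoothChart Φ) {v X : E → E}
    (hv : ContDiffOn ℝ ∞ v Φ.source) (hX : ContDiffOn ℝ ∞ X Φ.source)
    (hvΦ : ∀ x ∈ Φ.source, fderiv ℝ Φ x (v x) = (0, 1)) {q : G × ℝ} (hq : q ∈ Φ.target) :
    fderiv ℝ (pushField Φ X) q (0, 1) = pushField Φ (lieBracket ℝ v X) q := by
  have h1 : pushField Φ v =ᶠ[𝓝 q] fun _ => (0, 1) := by
    filter_upwards [Φ.open_target.mem_nhds hq] with y hy using hvΦ _ (Φ.map_target hy)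
  rw [pushField_lieBracket hΦ hv hX hq, lieBracket, h1.fderiv_eq, h1.eq_of_nhds]
  simp

end Push

/-! ### Distributions invariant under a field, and symmetries. -/

section Invariance

variable {E F : Type*} [NormedAddCommGroup E] [NormedSpace ℝ E] [FiniteDimensional ℝ E]
  [NormedAddCommGroup F] [NormedSpace ℝ F] [FiniteDimensional ℝ F]

theorem eq_of_fderiv_along_eq_zero {F G : Type*} [NormedAddCommGroup F] [NormedSpace ℝ F]
    [NormedAddCommGroup G] [NormedSpace ℝ G] {f : F × ℝ → G} {p : F} {t₀ δ : ℝ}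
    (hf : ∀ t ∈ Metric.ball t₀ δ, DifferentiableAt ℝ f (p, t))
    (hf' : ∀ t ∈ Metric.ball t₀ δ, fderiv ℝ f (p, t) (0, 1) = 0) {t s : ℝ}
    (ht : t ∈ Metric.ball t₀ δ) (hs : s ∈ Metric.ball t₀ δ) : f (p, t) = f (p, s) := by
  have hd : ∀ τ ∈ Metric.ball t₀ δ, HasDerivAt (fun τ => f (p, τ)) 0 τ := by
    intro τ hτ
    have h2 : HasDerivAt (fun τ : ℝ => (p, τ)) ((0, 1) : F × ℝ) τ :=
      (hasDerivAt_const τ p).prodMk (hasDerivAt_id τ)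
    have h3 := (hf τ hτ).hasFDerivAt.comp_hasDerivAt τ h2
    rw [hf' τ hτ] at h3
    exact h3
  refine (convex_ball t₀ δ).is_const_of_fderivWithin_eq_zero (𝕜 := ℝ)
    (f := fun τ => f (p, τ)) ?_ ?_ ht hs
  · exact fun τ hτ => (hd τ hτ).differentiableAt.differentiableWithinAt
  · intro τ hτ
    rw [(hd τ hτ).hasFDerivAt.hasFDerivWithinAt.fderivWithin
      (Metric.isOpen_ball.uniqueDiffWithinAt hτ)]
    simp

/-- Because the functionals `π i` are constant, they kill every derivative of the `Z j`, and hence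
every bracket of two of them. A derivative or bracket that is also known to lie in the span must
therefore be zero. Both the invariance lemma and the Frobenius theorem rest on this. -/
theorem exists_frame_dual_to_const {r : ℕ} {X : Fin r → E → E} {U : Set E} (hU : IsOpen U)
    (hX : ∀ i, ContDiffOn ℝ ∞ (X i) U) {x₀ : E} (hx₀ : x₀ ∈ U)
    (hli : LinearIndependent ℝ fun i => X i x₀) :
    ∃ V : Set E, IsOpen V ∧ x₀ ∈ V ∧ V ⊆ U ∧
      ∃ (π : Fin r → E →L[ℝ] ℝ) (N : Fin r → Fin r → E → ℝ) (Z : Fin r → E → E),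
        (∀ i j, ContDiffOn ℝ ∞ (N i j) V) ∧ (∀ j, ContDiffOn ℝ ∞ (Z j) V) ∧
        (∀ j x, Z j x = ∑ k, N k j x • X k x) ∧
        (∀ x ∈ V, ∀ i j, π i (Z j x) = if i = j then 1 else 0) ∧
        ∀ x ∈ V, Submodule.span ℝ (Set.range fun i => Z i x) =
          Submodule.span ℝ (Set.range fun i => X i x) := by
  obtain ⟨V, hV, hx₀V, hVU, π, N, hN, h1, h2⟩ := exists_graph_frame hU hX hx₀ hli
  refine ⟨V, hV, hx₀V, hVU, π, N, fun j x => ∑ k, N k j x • X k x, hN,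
    fun j => ContDiffOn.sum fun k _ => (hN k j).smul ((hX k).mono hVU), fun _ _ => rfl, h1,
    fun x hx => le_antisymm ?_ ?_⟩
  · rw [Submodule.span_le]
    rintro _ ⟨j, rfl⟩
    exact Submodule.sum_mem _ fun k _ =>
      Submodule.smul_mem _ _ (Submodule.subset_span ⟨k, rfl⟩)
  · rw [Submodule.span_le]
    rintro _ ⟨j, rfl⟩
    have h3 : X j x = ∑ i, π i (X j x) • ∑ k, N k i x • X k x := by
      simp only [Finset.smul_sum, smul_smul]
      rw [Finset.sum_comm]
      simp only [← Finset.sum_smul]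
      have h4 : ∀ k, ∑ i, π i (X j x) * N k i x = if k = j then 1 else 0 := fun k => by
        rw [← h2 x hx k j]
        exact Finset.sum_congr rfl fun _ _ => mul_comm _ _
      simp [h4]
    change X j x ∈ _
    rw [h3]
    exact Submodule.sum_mem _ fun k _ =>
      Submodule.smul_mem _ _ (Submodule.subset_span ⟨k, rfl⟩)

/-- A distribution on a product with an interval whose frame has derivatives along the interval
tangent to the distribution does not depend on the interval coordinate. -/
theorem exists_span_eq_of_fderiv_mem {r : ℕ} {A : Fin r → F × ℝ → F × ℝ} {W : Set (F × ℝ)}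
    (hW : IsOpen W) (hA : ∀ i, ContDiffOn ℝ ∞ (A i) W) {p₀ : F} {t₀ : ℝ} (h₀ : (p₀, t₀) ∈ W)
    (hli : LinearIndependent ℝ fun i => A i (p₀, t₀))
    (hder : ∀ q ∈ W, ∀ i, fderiv ℝ (A i) q (0, 1) ∈
      Submodule.span ℝ (Set.range fun i => A i q)) :
    ∃ δ > 0, Metric.ball p₀ δ ×ˢ Metric.ball t₀ δ ⊆ W ∧
      ∀ p ∈ Metric.ball p₀ δ, ∀ t ∈ Metric.ball t₀ δ, ∀ s ∈ Metric.ball t₀ δ,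
        Submodule.span ℝ (Set.range fun i => A i (p, t)) =
          Submodule.span ℝ (Set.range fun i => A i (p, s)) := by
  obtain ⟨V, hV, h₀V, hVW, π, N, Z, hN, hZ, hZN, hπ, hspan⟩ :=
    exists_frame_dual_to_const hW hA h₀ hli
  obtain ⟨δ, hδ, hδV⟩ := Metric.isOpen_iff.1 hV _ h₀V
  rw [← ball_prod_same] at hδV
  refine ⟨δ, hδ, hδV.trans hVW, fun p hp t ht s hs => ?_⟩
  have hdiff : ∀ {G : Type _} [NormedAddCommGroup G] [NormedSpace ℝ G] {f : F × ℝ → G},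
      ContDiffOn ℝ ∞ f V → ∀ q ∈ V, DifferentiableAt ℝ f q := fun hf q hq =>
    (hf.contDiffAt (hV.mem_nhds hq)).differentiableAt (by simp)
  have hZ0 : ∀ q ∈ V, ∀ j, fderiv ℝ (Z j) q (0, 1) = 0 := by
    intro q hq j
    have hmem : fderiv ℝ (Z j) q (0, 1) ∈ Submodule.span ℝ (Set.range fun i => Z i q) := by
      rw [hspan q hq]
      have h1 : HasFDerivAt (Z j) (∑ k, (N k j q • fderiv ℝ (A k) q +
          (fderiv ℝ (N k j) q).smulRight (A k q))) q := by
        have : Z j = fun x => ∑ k, N k j x • A k x := funext (hZN j)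
        rw [this]
        exact HasFDerivAt.fun_sum fun k _ =>
          ((hN k j).contDiffAt (hV.mem_nhds hq)).differentiableAt (by simp) |>.hasFDerivAt.smul
            (((hA k).mono hVW).contDiffAt (hV.mem_nhds hq) |>.differentiableAt
              (by simp)).hasFDerivAt
      rw [h1.fderiv, sum_apply]
      exact Submodule.sum_mem _ fun k _ => Submodule.add_mem _
        (Submodule.smul_mem _ _ (hder q (hVW hq) k))
        (Submodule.smul_mem _ _ (Submodule.subset_span ⟨k, rfl⟩))
    rw [eq_sum_of_mem_span_of_dual (hπ q hq) hmem]
    refine Finset.sum_eq_zero fun i _ => ?_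
    have h2 : (fun x => π i (Z j x)) =ᶠ[𝓝 q] fun _ => if i = j then 1 else 0 := by
      filter_upwards [hV.mem_nhds hq] with x hx using hπ x hx i j
    have h3 := (π i).hasFDerivAt.comp q (hdiff (hZ j) q hq).hasFDerivAt
    have h4 : fderiv ℝ (fun x => π i (Z j x)) q (0, 1) = π i (fderiv ℝ (Z j) q (0, 1)) := by
      rw [show (fun x => π i (Z j x)) = π i ∘ Z j from rfl, h3.fderiv]; rfl
    rw [← h4, h2.fderiv_eq]
    simp
  have hconst : ∀ j, Z j (p, t) = Z j (p, s) := by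
    intro j
    exact eq_of_fderiv_along_eq_zero (fun τ hτ => hdiff (hZ j) _ (hδV ⟨hp, hτ⟩))
      (fun τ hτ => hZ0 _ (hδV ⟨hp, hτ⟩) j) ht hs
  rw [← hspan _ (hδV ⟨hp, ht⟩), ← hspan _ (hδV ⟨hp, hs⟩)]
  simp only [hconst]

/-- A nowhere vanishing field that infinitesimally preserves a distribution is a symmetry. -/
theorem isSymmetryOn_of_lieBracket_mem {r : ℕ} {D : E → Submodule ℝ E} {U : Set E}
    (hU : IsOpen U) {X : Fin r → E → E} (hX : ∀ i, ContDiffOn ℝ ∞ (X i) U)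
    (hli : ∀ x ∈ U, LinearIndependent ℝ fun i => X i x)
    (hD : ∀ x ∈ U, D x = Submodule.span ℝ (Set.range fun i => X i x))
    {v : E → E} (hv : ContDiffOn ℝ ∞ v U) (hv0 : ∀ x ∈ U, v x ≠ 0)
    (hvX : ∀ x ∈ U, ∀ i, lieBracket ℝ v (X i) x ∈ D x) : IsSymmetryOn D U v := by
  refine ⟨hv, fun x hx => ?_⟩
  let G := EuclideanSpace ℝ (Fin (Module.finrank ℝ E - 1))
  have hdim : Module.finrank ℝ E = Module.finrank ℝ G + 1 := by
    have : Nontrivial E := ⟨_, _, hv0 x hx⟩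
    have := Module.finrank_pos (R := ℝ) (M := E)
    simp only [G, finrank_euclideanSpace, Fintype.card_fin]
    omega
  obtain ⟨Φ, hxs, hsU, hΦ, hΦx, hΦv⟩ := exists_flow_box (F := G) hdim hU hv hx (hv0 x hx)
  have hXs : ∀ i, ContDiffOn ℝ ∞ (X i) Φ.source := fun i => (hX i).mono hsU
  obtain ⟨δ, hδ, hbox, hinv⟩ := exists_span_eq_of_fderiv_mem (F := G) (p₀ := 0) (t₀ := 0)
    (A := fun i => pushField Φ (X i)) Φ.open_target (fun i => contDiffOn_pushField hΦ (hXs i))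
    (by
      have := Φ.map_source hxs
      rwa [hΦx] at this)
    (by
      have := linearIndependent_pushField hΦ hxs (hli x hx)
      rwa [hΦx] at this)
    (by
      intro q hq i
      have hy := Φ.map_target hq
      rw [fderiv_pushField_flow_box hΦ (hv.mono hsU) (hXs i) hΦv hq]
      have h1 := map_fderiv_span X hy
      rw [Φ.right_inv hq] at h1
      rw [← h1, ← hD _ (hsU hy)]
      exact Submodule.mem_map_of_mem (hvX _ (hsU hy) i))
  -- In the flow box the flow is translation of the last coordinate. Starting within δ/2 of the
  -- origin and moving for time less than δ/2 remains in the box of size δ, where the span does not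
  -- depend on that coordinate.
  let V : Set E := Φ.source ∩ Φ ⁻¹' Metric.ball 0 (δ / 2)
  have hVs : V ⊆ Φ.source := Set.inter_subset_left
  have hVbox : ∀ y ∈ V, ∀ t ∈ Set.Ioo (-(δ / 2)) (δ / 2),
      (Φ y).1 ∈ Metric.ball 0 δ ∧ (Φ y).2 ∈ Metric.ball 0 δ ∧ (Φ y).2 + t ∈ Metric.ball 0 δ := by
    intro y hy t ht
    have h1 : Φ y ∈ Metric.ball 0 (δ / 2) := hy.2
    rw [mem_ball_zero_iff, Prod.norm_def, max_lt_iff] at h1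
    have ht' : |t| < δ / 2 := abs_lt.2 ht
    have h2 : |(Φ y).2| < δ / 2 := h1.2
    simp only [mem_ball_zero_iff, Real.norm_eq_abs]
    refine ⟨by linarith, by linarith, (abs_add_le _ _).trans_lt (by linarith)⟩
  have htgt : ∀ y ∈ V, ∀ t ∈ Set.Ioo (-(δ / 2)) (δ / 2), Φ y + (0, t) ∈ Φ.target := by
    intro y hy t ht
    obtain ⟨h1, -, h3⟩ := hVbox y hy t ht
    exact hbox ⟨by simpa using h1, by simpa using h3⟩
  refine ⟨V, δ / 2, fun t y => Φ.symm (Φ y + (0, t)), ⟨hxs, ?_⟩,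
    ⟨Φ.continuousOn.isOpen_inter_preimage Φ.open_source Metric.isOpen_ball, hVs.trans hsU,
      half_pos hδ, ?_, ?_, ?_, ?_⟩, ?_⟩
  · rw [Set.mem_preimage, hΦx]; exact Metric.mem_ball_self (half_pos hδ)
  · refine hΦ.2.comp (ContDiffOn.add (hΦ.1.comp contDiff_snd.contDiffOn ?_)
      (contDiff_const.prodMk contDiff_fst).contDiffOn) ?_
    · exact fun p hp => hVs hp.2
    · exact fun p hp => htgt _ hp.2 _ hp.1
  · intro y hy
    simp [← Prod.zero_eq_mk, Φ.left_inv (hVs hy)]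
  · exact fun t ht y hy => hsU (Φ.map_target (htgt y hy t ht))
  · intro t ht y hy
    have hq := htgt y hy t ht
    have h1 : HasDerivAt (fun s : ℝ => Φ y + ((0 : G), s)) (0, 1) t :=
      ((hasDerivAt_const t (0 : G)).prodMk (hasDerivAt_id t)).const_add _
    have h2 := (hΦ.differentiableAt_symm hq).hasFDerivAt.comp_hasDerivAt t h1
    have hz := Φ.map_target hq
    have h3 := hΦ.fderiv_symm_fderiv hz (v (Φ.symm (Φ y + (0, t))))
    rw [hΦv _ hz, Φ.right_inv hq] at h3
    rw [← h3]
    exact h2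
  · intro t ht y hy
    have hq := htgt y hy t ht
    have hz := Φ.map_target hq
    have hys := hVs hy
    have h1 : HasFDerivAt (fun y => Φ.symm (Φ y + (0, t)))
        ((fderiv ℝ Φ.symm (Φ y + (0, t))).comp (fderiv ℝ Φ y)) y :=
      (hΦ.differentiableAt_symm hq).hasFDerivAt.comp y
        ((hΦ.differentiableAt hys).hasFDerivAt.add_const _)
    rw [h1.fderiv, hD y (hsU hys), hD _ (hsU hz)]
    have h2 := map_fderiv_span X hys
    have h3 := map_fderiv_span X hz
    obtain ⟨hp, ht1, ht2⟩ := hVbox y hy t ht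
    have h4 := hinv _ hp _ ht1 _ ht2
    have h5 : ((Φ y).1, (Φ y).2 + t) = Φ y + (0, t) := by ext <;> simp
    rw [h5, Prod.mk.eta, ← h2] at h4
    rw [Φ.right_inv hq, ← h4] at h3
    have h6 : (((fderiv ℝ Φ.symm (Φ y + (0, t))).comp (fderiv ℝ Φ y) : E →L[ℝ] E) : E →ₗ[ℝ] E) =
        (fderiv ℝ Φ.symm (Φ y + (0, t)) : G × ℝ →ₗ[ℝ] E).comp
          (fderiv ℝ Φ y : E →ₗ[ℝ] G × ℝ) := rfl
    rw [h6, Submodule.map_comp, ← h3, ← Submodule.map_comp]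
    convert Submodule.map_id _
    ext w
    have := hΦ.fderiv_symm_fderiv hz w
    rw [Φ.right_inv hq] at this
    exact this

end Invariance

/-! ### Restriction of fields on a product to a slice. -/

section Slice

variable {F : Type*} [NormedAddCommGroup F] [NormedSpace ℝ F]

/-- The horizontal part of a field on `F × ℝ` along the slice `F × {s}`. -/
def sliceField (s : ℝ) (A : F × ℝ → F × ℝ) : F → F := fun p => (A (p, s)).1

theorem hasFDerivAt_sliceField {s : ℝ} {A : F × ℝ → F × ℝ} {p : F}
    (hA : DifferentiableAt ℝ A (p, s)) :
    HasFDerivAt (sliceField s A) ((ContinuousLinearMap.fst ℝ F ℝ).comp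
      ((fderiv ℝ A (p, s)).comp (ContinuousLinearMap.inl ℝ F ℝ))) p := by
  have h1 : HasFDerivAt (fun p : F => (p, s)) (ContinuousLinearMap.inl ℝ F ℝ) p :=
    (hasFDerivAt_id p).prodMk (hasFDerivAt_const s p)
  exact (ContinuousLinearMap.fst ℝ F ℝ).hasFDerivAt.comp p (hA.hasFDerivAt.comp p h1)

theorem contDiffOn_sliceField {s : ℝ} {A : F × ℝ → F × ℝ} {W : Set (F × ℝ)} {B : Set F}
    (hA : ContDiffOn ℝ ∞ A W) (hB : ∀ p ∈ B, (p, s) ∈ W) :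
    ContDiffOn ℝ ∞ (sliceField s A) B :=
  contDiff_fst.comp_contDiffOn
    (hA.comp (contDiff_id.prodMk contDiff_const).contDiffOn fun p hp => hB p hp)

/-- The vertical components enter only through derivatives along the interval. The correction terms
vanish for horizontal fields and for fields independent of the interval coordinate, the two
situations that occur. -/
theorem fst_lieBracket_eq {s : ℝ} {A B : F × ℝ → F × ℝ} {p : F}
    (hA : DifferentiableAt ℝ A (p, s)) (hB : DifferentiableAt ℝ B (p, s)) :
    (lieBracket ℝ A B (p, s)).1 = lieBracket ℝ (sliceField s A) (sliceField s B) p +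
      (A (p, s)).2 • (fderiv ℝ B (p, s) (0, 1)).1 -
      (B (p, s)).2 • (fderiv ℝ A (p, s) (0, 1)).1 := by
  have hsplit : ∀ (w : F × ℝ), w = (w.1, 0) + w.2 • (0, 1) := fun w => by ext <;> simp
  have h1 : ∀ (C : F × ℝ → F × ℝ) (w : F × ℝ), fderiv ℝ C (p, s) w =
      fderiv ℝ C (p, s) (w.1, 0) + w.2 • fderiv ℝ C (p, s) (0, 1) := fun C w => by
    conv_lhs => rw [hsplit w, map_add, map_smul]
  simp only [lieBracket, (hasFDerivAt_sliceField hA).fderiv, (hasFDerivAt_sliceField hB).fderiv]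
  rw [h1 B (A (p, s)), h1 A (B (p, s))]
  simp only [Prod.fst_sub, Prod.fst_add, Prod.smul_fst]
  simp only [ContinuousLinearMap.comp_apply, ContinuousLinearMap.inl_apply,
    ContinuousLinearMap.coe_fst', sliceField]
  abel

theorem linearIndependent_fst_of_vertical {r : ℕ} {A : Fin (r + 1) → F × ℝ} (h0 : A 0 = (0, 1))
    (hA : LinearIndependent ℝ A) : LinearIndependent ℝ fun i : Fin r => (A i.succ).1 := by
  rw [Fintype.linearIndependent_iff] at hA ⊢
  intro g hg i
  have h1 : ∑ j, (Fin.cons (-∑ k, g k * (A k.succ).2) g : Fin (r + 1) → ℝ) j • A j = 0 := by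
    rw [Fin.sum_univ_succ]
    simp only [Fin.cons_zero, Fin.cons_succ, h0]
    ext
    · simpa [Prod.fst_sum] using hg
    · simp [Prod.snd_sum]
  simpa using hA _ h1 i.succ

theorem fst_mem_span_iff_of_vertical {r : ℕ} {A : Fin (r + 1) → F × ℝ} (h0 : A 0 = (0, 1))
    (w : F × ℝ) : w.1 ∈ Submodule.span ℝ (Set.range fun i : Fin r => (A i.succ).1) ↔
      w ∈ Submodule.span ℝ (Set.range A) := by
  rw [Submodule.mem_span_range_iff_exists_fun, Submodule.mem_span_range_iff_exists_fun]
  constructor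
  · rintro ⟨c, hc⟩
    refine ⟨Fin.cons (w.2 - ∑ k, c k * (A k.succ).2) c, ?_⟩
    rw [Fin.sum_univ_succ]
    simp only [Fin.cons_zero, Fin.cons_succ, h0]
    ext
    · simpa [Prod.fst_sum] using hc
    · simp [Prod.snd_sum]
  · rintro ⟨c, hc⟩
    refine ⟨fun i => c i.succ, ?_⟩
    rw [← hc, Fin.sum_univ_succ, h0]
    simp [Prod.fst_sum]

end Slice

/-! ### The Frobenius theorem. -/

/-- Commuting independent fields are locally the vertical fields of a submersion. -/
theorem exists_submersion_of_commuting (r : ℕ) : ∀ {E G : Type} [NormedAddCommGroup E]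
    [NormedSpace ℝ E] [FiniteDimensional ℝ E] [NormedAddCommGroup G] [NormedSpace ℝ G]
    [FiniteDimensional ℝ G], Module.finrank ℝ E = Module.finrank ℝ G + r →
    ∀ {X : Fin r → E → E} {U : Set E}, IsOpen U → (∀ i, ContDiffOn ℝ ∞ (X i) U) →
    ∀ {x₀ : E}, x₀ ∈ U → LinearIndependent ℝ (fun i => X i x₀) →
    (∀ x ∈ U, ∀ i j, lieBracket ℝ (X i) (X j) x = 0) →
    ∃ (V : Set E) (g : E → G), IsOpen V ∧ x₀ ∈ V ∧ V ⊆ U ∧ ContDiffOn ℝ ∞ g V ∧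
      ∀ x ∈ V, ∀ u, fderiv ℝ g x u = 0 ↔ u ∈ Submodule.span ℝ (Set.range fun i => X i x) := by
  induction r with
  | zero =>
    intro E G _ _ _ _ _ _ hdim X U hU _ x₀ hx₀ _ _
    let e : E ≃L[ℝ] G := ContinuousLinearEquiv.ofFinrankEq (by simpa using hdim)
    refine ⟨U, e, hU, hx₀, subset_rfl, e.contDiff.contDiffOn, fun x _ u => ?_⟩
    simp [e.fderiv]
  | succ r ih =>
    intro E G _ _ _ _ _ _ hdim X U hU hX x₀ hx₀ hli hcomm
    let F := EuclideanSpace ℝ (Fin (Module.finrank ℝ G + r))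
    have hdimF : Module.finrank ℝ E = Module.finrank ℝ F + 1 := by
      simp only [F, finrank_euclideanSpace, Fintype.card_fin]; omega
    -- Once `X 0` is straightened, fields commuting with it do not depend on the last coordinate.
    -- Their horizontal parts are `r` commuting independent fields on the slice, and the submersion
    -- found there is pulled back along the projection.
    obtain ⟨Φ, hxs, hsU, hΦ, hΦx, hΦv⟩ :=
      exists_flow_box (F := F) hdimF hU (hX 0) hx₀ (hli.ne_zero 0)
    have hXs : ∀ i, ContDiffOn ℝ ∞ (X i) Φ.source := fun i => (hX i).mono hsU
    let A : Fin (r + 1) → F × ℝ → F × ℝ := fun i => pushField Φ (X i)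
    have hA : ∀ i, ContDiffOn ℝ ∞ (A i) Φ.target := fun i => contDiffOn_pushField hΦ (hXs i)
    have hAd : ∀ i, ∀ q ∈ Φ.target, DifferentiableAt ℝ (A i) q := fun i q hq =>
      ((hA i).contDiffAt (Φ.open_target.mem_nhds hq)).differentiableAt (by simp)
    have hbr : ∀ i j, ∀ q ∈ Φ.target, pushField Φ (lieBracket ℝ (X i) (X j)) q = 0 := by
      intro i j q hq
      rw [pushField, hcomm _ (hsU (Φ.map_target hq)), map_zero]
    have hA0 : ∀ q ∈ Φ.target, A 0 q = (0, 1) := fun q hq => hΦv _ (Φ.map_target hq)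
    have hAt : ∀ i, ∀ q ∈ Φ.target, fderiv ℝ (A i) q (0, 1) = 0 := fun i q hq => by
      rw [fderiv_pushField_flow_box hΦ (hXs 0) (hXs i) hΦv hq, hbr 0 i q hq]
    have h0t : (0 : F × ℝ) ∈ Φ.target := by rw [← hΦx]; exact Φ.map_source hxs
    obtain ⟨δ, hδ, hbox⟩ := Metric.isOpen_iff.1 Φ.open_target _ h0t
    have hbox' : Metric.ball (0 : F) δ ×ˢ Metric.ball (0 : ℝ) δ ⊆ Φ.target := by
      rw [ball_prod_same]; exact hbox
    have h0 : (0 : ℝ) ∈ Metric.ball (0 : ℝ) δ := Metric.mem_ball_self hδ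
    have hAc : ∀ i, ∀ p ∈ Metric.ball (0 : F) δ, ∀ t ∈ Metric.ball (0 : ℝ) δ,
        A i (p, t) = A i (p, 0) := fun i p hp t ht =>
      eq_of_fderiv_along_eq_zero (fun τ hτ => hAd i _ (hbox' ⟨hp, hτ⟩))
        (fun τ hτ => hAt i _ (hbox' ⟨hp, hτ⟩)) ht h0
    let Y : Fin r → F → F := fun i => sliceField 0 (A i.succ)
    have hYli : LinearIndependent ℝ fun i => Y i 0 := by
      have h1 := linearIndependent_pushField hΦ hxs hli
      rw [hΦx, ← Prod.mk_zero_zero] at h1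
      exact linearIndependent_fst_of_vertical (A := fun i => A i (0, 0))
        (hA0 _ (hbox' ⟨Metric.mem_ball_self hδ, h0⟩)) h1
    have hYc : ∀ p ∈ Metric.ball (0 : F) δ, ∀ i j, lieBracket ℝ (Y i) (Y j) p = 0 := by
      intro p hp i j
      have hq : (p, (0 : ℝ)) ∈ Φ.target := hbox' ⟨hp, h0⟩
      have h1 := fst_lieBracket_eq (hAd i.succ _ hq) (hAd j.succ _ hq)
      have h2 : lieBracket ℝ (A i.succ) (A j.succ) (p, 0) = 0 := by
        rw [← hbr i.succ j.succ _ hq, pushField_lieBracket hΦ (hXs _) (hXs _) hq]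
      rw [hAt i.succ _ hq, hAt j.succ _ hq, h2] at h1
      simpa using h1.symm
    obtain ⟨V, g, hV, h0V, hVB, hg, hgY⟩ := ih (E := F) (G := G) (X := Y)
      (U := Metric.ball 0 δ) (x₀ := 0) (by simp [F]) Metric.isOpen_ball
      (fun i => contDiffOn_sliceField (hA i.succ) fun p hp => hbox' ⟨hp, h0⟩)
      (Metric.mem_ball_self hδ) hYli hYc
    let W : Set (F × ℝ) := V ×ˢ Metric.ball 0 δ
    have hW : IsOpen W := hV.prod Metric.isOpen_ball
    have hWx : ∀ x ∈ Φ.source ∩ Φ ⁻¹' W, (Φ x).1 ∈ V := fun x hx => hx.2.1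
    refine ⟨Φ.source ∩ Φ ⁻¹' W, fun x => g (Φ x).1,
      Φ.continuousOn.isOpen_inter_preimage Φ.open_source hW,
      ⟨hxs, by rw [Set.mem_preimage, hΦx]; exact ⟨h0V, h0⟩⟩,
      fun x hx => hsU hx.1,
      hg.comp (contDiff_fst.comp_contDiffOn (hΦ.1.mono Set.inter_subset_left)) hWx, ?_⟩
    intro x hx u
    have h1 : HasFDerivAt (fun x => g (Φ x).1) ((fderiv ℝ g (Φ x).1).comp
        ((ContinuousLinearMap.fst ℝ F ℝ).comp (fderiv ℝ Φ x))) x :=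
      ((hg.contDiffAt (hV.mem_nhds (hWx x hx))).differentiableAt (by simp)).hasFDerivAt.comp x
        ((ContinuousLinearMap.fst ℝ F ℝ).hasFDerivAt.comp x
          (hΦ.differentiableAt hx.1).hasFDerivAt)
    rw [h1.fderiv]
    change fderiv ℝ g (Φ x).1 (fderiv ℝ Φ x u).1 = 0 ↔ _
    rw [hgY _ (hWx x hx)]
    have h2 : ∀ i, A i ((Φ x).1, 0) = A i (Φ x) := fun i =>
      (hAc i _ (hVB (hWx x hx)) _ hx.2.2).symm
    have h3 : (fun i : Fin r => Y i (Φ x).1) = fun i : Fin r => (A i.succ (Φ x)).1 := by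
      funext i
      change (A i.succ ((Φ x).1, 0)).1 = _
      rw [h2]
    rw [h3, fst_mem_span_iff_of_vertical (A := fun i => A i (Φ x)) (hA0 _ (Φ.map_source hx.1)),
      ← map_fderiv_span X hx.1]
    constructor
    · rintro ⟨w, hw, hwu⟩
      rwa [← hΦ.fderiv_injective hx.1 hwu]
    · exact fun hu => Submodule.mem_map_of_mem hu

/-- Frobenius theorem. -/
theorem exists_submersion_of_involutive {r : ℕ} {E G : Type} [NormedAddCommGroup E]
    [NormedSpace ℝ E] [FiniteDimensional ℝ E] [NormedAddCommGroup G] [NormedSpace ℝ G]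
    [FiniteDimensional ℝ G] (hdim : Module.finrank ℝ E = Module.finrank ℝ G + r)
    {X : Fin r → E → E} {U : Set E} (hU : IsOpen U) (hX : ∀ i, ContDiffOn ℝ ∞ (X i) U)
    {x₀ : E} (hx₀ : x₀ ∈ U) (hli : LinearIndependent ℝ (fun i => X i x₀))
    (hinv : ∀ x ∈ U, ∀ i j, lieBracket ℝ (X i) (X j) x ∈
      Submodule.span ℝ (Set.range fun i => X i x)) :
    ∃ (V : Set E) (g : E → G), IsOpen V ∧ x₀ ∈ V ∧ V ⊆ U ∧ ContDiffOn ℝ ∞ g V ∧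
      ∀ x ∈ V, ∀ u, fderiv ℝ g x u = 0 ↔ u ∈ Submodule.span ℝ (Set.range fun i => X i x) := by
  obtain ⟨V, hV, hx₀V, hVU, π, N, Z, hN, hZ, hZN, hπ, hspan⟩ :=
    exists_frame_dual_to_const hU hX hx₀ hli
  -- The frame `Z` commutes: its brackets lie in the span by involutivity, and every `π k` kills
  -- them, being constant on each `Z j`.
  obtain ⟨V', g, hV', hx₀V', hVV', hg, hgZ⟩ := exists_submersion_of_commuting r hdim hV hZ hx₀V
    (linearIndependent_of_dual (hπ x₀ hx₀V)) (by
      intro x hx i j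
      have hZs : ∀ j, Z j = fun x => ∑ k, N k j x • X k x := fun j => funext (hZN j)
      have hNd : ∀ i j, DifferentiableAt ℝ (N i j) x := fun i j =>
        ((hN i j).contDiffAt (hV.mem_nhds hx)).differentiableAt (by simp)
      have hXd : ∀ i, DifferentiableAt ℝ (X i) x := fun i =>
        ((hX i).contDiffAt (hU.mem_nhds (hVU hx))).differentiableAt (by simp)
      have hmem : lieBracket ℝ (Z i) (Z j) x ∈ Submodule.span ℝ (Set.range fun i => Z i x) := by
        rw [hspan x hx]
        exact lieBracket_sum_smul_mem (hZs i).eventuallyEq (fun k => hNd k i) hXd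
          (hZs j).eventuallyEq (fun k => hNd k j) hXd
          (fun k => Submodule.subset_span ⟨k, rfl⟩) (fun k => Submodule.subset_span ⟨k, rfl⟩)
          (hinv x (hVU hx))
      rw [eq_sum_of_mem_span_of_dual (hπ x hx) hmem]
      refine Finset.sum_eq_zero fun k _ => ?_
      have h1 := fderiv_lieBracket hV (π k).contDiff.contDiffOn (hZ i) (hZ j) hx
      have h2 : ∀ l, (fun y => fderiv ℝ (π k) y (Z l y)) =ᶠ[𝓝 x]
          fun _ => if k = l then 1 else 0 := fun l => by
        filter_upwards [hV.mem_nhds hx] with y hy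
        rw [(π k).fderiv, hπ y hy]
      rw [(h2 i).fderiv_eq, (h2 j).fderiv_eq, (π k).fderiv] at h1
      rw [h1]
      simp)
  refine ⟨V', g, hV', hx₀V', hVV'.trans hVU, hg, fun x hx u => ?_⟩
  rw [hgZ x hx, hspan x (hVV' hx)]

/-! ### Linear algebra of spans. -/

section LinearAlgebra

variable {E : Type*} [NormedAddCommGroup E] [NormedSpace ℝ E]

theorem mem_span_range_two {x : Fin 2 → E} {u : E} :
    u ∈ Submodule.span ℝ (Set.range x) ↔ ∃ a b : ℝ, a • x 0 + b • x 1 = u := by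
  rw [Submodule.mem_span_range_iff_exists_fun]
  simp only [Fin.sum_univ_two]
  exact ⟨fun ⟨c, hc⟩ => ⟨c 0, c 1, hc⟩, fun ⟨a, b, h⟩ => ⟨![a, b], by simpa using h⟩⟩

theorem mem_span_range_three {x : Fin 3 → E} {u : E} :
    u ∈ Submodule.span ℝ (Set.range x) ↔ ∃ a b c : ℝ, a • x 0 + b • x 1 + c • x 2 = u := by
  rw [Submodule.mem_span_range_iff_exists_fun]
  simp only [Fin.sum_univ_three]
  exact ⟨fun ⟨c, hc⟩ => ⟨c 0, c 1, c 2, hc⟩, fun ⟨a, b, c, h⟩ => ⟨![a, b, c], by simpa using h⟩⟩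

theorem eq_sum_of_dual_of_card_eq_finrank [FiniteDimensional ℝ E] {ι : Type*} [Fintype ι]
    [DecidableEq ι] {X : ι → E} {ξ : ι → E →L[ℝ] ℝ}
    (h : ∀ i j, ξ i (X j) = if i = j then 1 else 0)
    (hcard : Fintype.card ι = Module.finrank ℝ E) (w : E) : w = ∑ i, ξ i w • X i := by
  apply eq_sum_of_mem_span_of_dual h
  rw [(linearIndependent_of_dual h).span_eq_top_of_card_eq_finrank' hcard]
  trivial

theorem isCompl_span_of_linearIndependent_four [FiniteDimensional ℝ E]
    (hdim : Module.finrank ℝ E = 4) {a b v w : E} (h : LinearIndependent ℝ ![a, b, v, w]) :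
    LinearIndependent ℝ ![v, w] ∧
      IsCompl (Submodule.span ℝ (Set.range ![a, b])) (Submodule.span ℝ {v, w}) := by
  have hz := Fintype.linearIndependent_iff.1 h
  have hz' : ∀ c₀ c₁ c₂ c₃ : ℝ, c₀ • a + c₁ • b + c₂ • v + c₃ • w = 0 →
      c₀ = 0 ∧ c₁ = 0 ∧ c₂ = 0 ∧ c₃ = 0 := by
    intro c₀ c₁ c₂ c₃ hc
    have := hz ![c₀, c₁, c₂, c₃] (by simpa [Fin.sum_univ_four] using hc)
    exact ⟨this 0, this 1, this 2, this 3⟩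
  refine ⟨?_, IsCompl.of_eq ?_ ?_⟩
  · rw [LinearIndependent.pair_iff]
    intro s t hst
    obtain ⟨-, -, h2, h3⟩ := hz' 0 0 s t (by simpa using hst)
    exact ⟨h2, h3⟩
  · rw [Submodule.eq_bot_iff]
    rintro u ⟨hu1, hu2⟩
    obtain ⟨p, q, hpq⟩ := mem_span_range_two.1 hu1
    obtain ⟨s, t, hst⟩ := Submodule.mem_span_pair.1 hu2
    simp only [Matrix.cons_val_zero, Matrix.cons_val_one] at hpq
    obtain ⟨h0, h1, -, -⟩ := hz' p q (-s) (-t) (by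
      rw [hpq, ← hst]; module)
    rw [← hpq, h0, h1]; simp
  · rw [eq_top_iff, ← h.span_eq_top_of_card_eq_finrank' (by simp [hdim]), Submodule.span_le]
    rintro _ ⟨i, rfl⟩
    fin_cases i
    · exact Submodule.mem_sup_left (Submodule.subset_span ⟨0, rfl⟩)
    · exact Submodule.mem_sup_left (Submodule.subset_span ⟨1, rfl⟩)
    · exact Submodule.mem_sup_right (Submodule.subset_span (by simp))
    · exact Submodule.mem_sup_right (Submodule.subset_span (by simp))

end LinearAlgebra

/-! ### Infinitesimal symmetries and contact forms. -/

section Symmetries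

variable {E : Type*} [NormedAddCommGroup E] [NormedSpace ℝ E]

/-- Two infinitesimal symmetries transversal to a 2-distribution at a point are transversal
symmetries near it. -/
theorem exists_transversal_symmetries [FiniteDimensional ℝ E] (hdim : Module.finrank ℝ E = 4)
    {D : E → Submodule ℝ E} {U : Set E} (hU : IsOpen U) {X₀ X₁ : E → E}
    (hX₀ : ContDiffOn ℝ ∞ X₀ U) (hX₁ : ContDiffOn ℝ ∞ X₁ U)
    (hD : ∀ x ∈ U, D x = Submodule.span ℝ (Set.range ![X₀ x, X₁ x]))
    {v w : E → E} (hv : ContDiffOn ℝ ∞ v U) (hw : ContDiffOn ℝ ∞ w U)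
    (hv₀ : ∀ x ∈ U, lieBracket ℝ v X₀ x ∈ D x) (hv₁ : ∀ x ∈ U, lieBracket ℝ v X₁ x ∈ D x)
    (hw₀ : ∀ x ∈ U, lieBracket ℝ w X₀ x ∈ D x) (hw₁ : ∀ x ∈ U, lieBracket ℝ w X₁ x ∈ D x)
    {x₀ : E} (hx₀ : x₀ ∈ U) (hli : LinearIndependent ℝ ![X₀ x₀, X₁ x₀, v x₀, w x₀]) :
    ∃ V : Set E, IsOpen V ∧ x₀ ∈ V ∧ V ⊆ U ∧ IsSymmetryOn D V v ∧ IsSymmetryOn D V w ∧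
      ∀ x ∈ V, LinearIndependent ℝ ![v x, w x] ∧
        IsCompl (D x) (Submodule.span ℝ {v x, w x}) := by
  have hfr : ∀ x, (fun i => (![X₀, X₁, v, w] : Fin 4 → E → E) i x) =
      ![X₀ x, X₁ x, v x, w x] := fun x => by
    funext i; fin_cases i <;> rfl
  have hfr2 : ∀ x, (fun i => (![X₀, X₁] : Fin 2 → E → E) i x) = ![X₀ x, X₁ x] := fun x => by
    funext i; fin_cases i <;> rfl
  obtain ⟨V, hV, hxV, hVU, hVli⟩ := exists_linearIndependent_nhds (X := ![X₀, X₁, v, w]) hU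
    (by intro i; fin_cases i <;> assumption) hx₀ (by rw [hfr]; exact hli)
  simp only [hfr] at hVli
  have hsm : ∀ i, ContDiffOn ℝ ∞ ((![X₀, X₁] : Fin 2 → E → E) i) V := by
    intro i
    fin_cases i
    exacts [hX₀.mono hVU, hX₁.mono hVU]
  have h2 : ∀ x ∈ V, LinearIndependent ℝ fun i => (![X₀, X₁] : Fin 2 → E → E) i x := by
    intro x hx
    rw [hfr2]
    have := (hVli x hx).comp ![0, 1] (by decide)
    convert this using 1
    funext i; fin_cases i <;> rfl
  have hD' : ∀ x ∈ V, D x =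
      Submodule.span ℝ (Set.range fun i => (![X₀, X₁] : Fin 2 → E → E) i x) := fun x hx => by
    rw [hfr2, hD x (hVU hx)]
  refine ⟨V, hV, hxV, hVU,
    isSymmetryOn_of_lieBracket_mem hV hsm h2 hD' (hv.mono hVU)
      (fun x hx => (hVli x hx).ne_zero 2) ?_,
    isSymmetryOn_of_lieBracket_mem hV hsm h2 hD' (hw.mono hVU)
      (fun x hx => (hVli x hx).ne_zero 3) ?_, fun x hx => ?_⟩
  · intro x hx i
    fin_cases i
    exacts [hv₀ x (hVU hx), hv₁ x (hVU hx)]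
  · intro x hx i
    fin_cases i
    exacts [hw₀ x (hVU hx), hw₁ x (hVU hx)]
  · rw [hD x (hVU hx)]
    exact isCompl_span_of_linearIndependent_four hdim (hVli x hx)

theorem lieBracket_add_smul_add_smul {v X Y W : E → E} {f g : E → ℝ} {x : E}
    (hv : DifferentiableAt ℝ v x) (hX : DifferentiableAt ℝ X x) (hY : DifferentiableAt ℝ Y x)
    (hf : DifferentiableAt ℝ f x) (hg : DifferentiableAt ℝ g x) :
    lieBracket ℝ (fun y => v y + f y • X y + g y • Y y) W x =
      lieBracket ℝ v W x + f x • lieBracket ℝ X W x + g x • lieBracket ℝ Y W x -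
        fderiv ℝ f x (W x) • X x - fderiv ℝ g x (W x) • Y x := by
  have h1 : HasFDerivAt (fun y => v y + f y • X y + g y • Y y)
      (fderiv ℝ v x + (f x • fderiv ℝ X x + (fderiv ℝ f x).smulRight (X x)) +
        (g x • fderiv ℝ Y x + (fderiv ℝ g x).smulRight (Y x))) x :=
    (hv.hasFDerivAt.add (hf.hasFDerivAt.smul hX.hasFDerivAt)).add
      (hg.hasFDerivAt.smul hY.hasFDerivAt)
  simp only [lieBracket, h1.fderiv, map_add, map_smul, add_apply, smul_apply,
    ContinuousLinearMap.smulRight_apply]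
  module

/-- The frame `X₀, X₁, [X₀, X₁]` attached to a pair of vector fields. -/
noncomputable def contactFrame (X : Fin 2 → E → E) : Fin 3 → E → E :=
  ![X 0, X 1, lieBracket ℝ (X 0) (X 1)]

theorem contDiffOn_contactFrame {X : Fin 2 → E → E} {U : Set E} (hU : IsOpen U)
    (hX : ∀ i, ContDiffOn ℝ ∞ (X i) U) (i : Fin 3) : ContDiffOn ℝ ∞ (contactFrame X i) U := by
  fin_cases i
  exacts [hX 0, hX 1, contDiffOn_lieBracket hU (hX 0) (hX 1)]

/-- A field preserving the span of `X₀, X₁, [X₀, X₁]` up to that span can be corrected by a section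
of `⟨X₀, X₁⟩` to an infinitesimal symmetry of `⟨X₀, X₁⟩`. -/
theorem lieBracket_corrected_mem {X : Fin 2 → E → E} {U : Set E} (hU : IsOpen U)
    (hX : ∀ i, ContDiffOn ℝ ∞ (X i) U) {ξ : Fin 3 → E → E →L[ℝ] ℝ}
    (hξ : ∀ i, ContDiffOn ℝ ∞ (ξ i) U)
    (hdual : ∀ x ∈ U, ∀ i j, ξ i x (contactFrame X j x) = if i = j then 1 else 0)
    {v : E → E} (hv : ContDiffOn ℝ ∞ v U)
    (hvX : ∀ x ∈ U, ∀ i, lieBracket ℝ v (X i) x ∈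
      Submodule.span ℝ (Set.range fun j => contactFrame X j x)) :
    ContDiffOn ℝ ∞ (fun x => v x + (-ξ 2 x (lieBracket ℝ v (X 1) x)) • X 0 x +
      ξ 2 x (lieBracket ℝ v (X 0) x) • X 1 x) U ∧
    ∀ x ∈ U, ∀ i, lieBracket ℝ (fun x => v x + (-ξ 2 x (lieBracket ℝ v (X 1) x)) • X 0 x +
      ξ 2 x (lieBracket ℝ v (X 0) x) • X 1 x) (X i) x ∈
        Submodule.span ℝ (Set.range fun j => X j x) := by
  have ha : ∀ i, ContDiffOn ℝ ∞ (fun x => ξ 2 x (lieBracket ℝ v (X i) x)) U := fun i =>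
    (hξ 2).clm_apply (contDiffOn_lieBracket hU hv (hX i))
  refine ⟨(hv.add ((ha 1).neg.smul (hX 0))).add ((ha 0).smul (hX 1)), fun x hx i => ?_⟩
  have hd : ∀ {G : Type _} [NormedAddCommGroup G] [NormedSpace ℝ G] {f : E → G},
      ContDiffOn ℝ ∞ f U → DifferentiableAt ℝ f x := fun hf =>
    (hf.contDiffAt (hU.mem_nhds hx)).differentiableAt (by simp)
  have hd1 : DifferentiableAt ℝ (fun x => -ξ 2 x (lieBracket ℝ v (X 1) x)) x :=
    ((ha 1).neg.contDiffAt (hU.mem_nhds hx)).differentiableAt (by simp)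
  have hd0 : DifferentiableAt ℝ (fun x => ξ 2 x (lieBracket ℝ v (X 0) x)) x :=
    ((ha 0).contDiffAt (hU.mem_nhds hx)).differentiableAt (by simp)
  rw [lieBracket_add_smul_add_smul (hd hv) (hd (hX 0)) (hd (hX 1)) hd1 hd0]
  have hexp : ∀ i, lieBracket ℝ v (X i) x = ξ 0 x (lieBracket ℝ v (X i) x) • X 0 x +
      ξ 1 x (lieBracket ℝ v (X i) x) • X 1 x +
      ξ 2 x (lieBracket ℝ v (X i) x) • lieBracket ℝ (X 0) (X 1) x := fun i => by
    have := eq_sum_of_mem_span_of_dual (hdual x hx) (hvX x hx i)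
    rwa [Fin.sum_univ_three] at this
  have h0 : X 0 x ∈ Submodule.span ℝ (Set.range fun j => X j x) :=
    Submodule.subset_span ⟨0, rfl⟩
  have h1 : X 1 x ∈ Submodule.span ℝ (Set.range fun j => X j x) :=
    Submodule.subset_span ⟨1, rfl⟩
  -- Adding fX₀ + gX₁ changes the X₂-coefficient of [v, X₁] by f and that of [v, X₀] by −g, which
  -- dictates f = −ξ₂[v, X₁] and g = ξ₂[v, X₀]. The derivatives of f and g contribute only multiples
  -- of X₀ and X₁.
  have hkey : lieBracket ℝ v (X i) x + (-ξ 2 x (lieBracket ℝ v (X 1) x)) •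
      lieBracket ℝ (X 0) (X i) x + ξ 2 x (lieBracket ℝ v (X 0) x) • lieBracket ℝ (X 1) (X i) x =
      ξ 0 x (lieBracket ℝ v (X i) x) • X 0 x + ξ 1 x (lieBracket ℝ v (X i) x) • X 1 x := by
    conv_lhs => rw [hexp i]
    fin_cases i
    · simp only [Fin.zero_eta, lieBracket_self, Pi.zero_apply, smul_zero]
      rw [lieBracket_swap (V := X 1)]
      module
    · simp only [Fin.mk_one, lieBracket_self, Pi.zero_apply, smul_zero]
      module
  rw [hkey]
  exact Submodule.sub_mem _ (Submodule.sub_mem _ (Submodule.add_mem _ (Submodule.smul_mem _ _ h0)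
    (Submodule.smul_mem _ _ h1)) (Submodule.smul_mem _ _ h0)) (Submodule.smul_mem _ _ h1)

/-- The exterior derivative formula for a 1-form annihilating both fields. -/
theorem form_lieBracket {F : Type*} [NormedAddCommGroup F] [NormedSpace ℝ F]
    {θ : E → E →L[ℝ] F} {V W : E → E} {x : E} (hθ : DifferentiableAt ℝ θ x)
    (hV : DifferentiableAt ℝ V x) (hW : DifferentiableAt ℝ W x)
    (hθV : ∀ᶠ y in 𝓝 x, θ y (V y) = 0) (hθW : ∀ᶠ y in 𝓝 x, θ y (W y) = 0) :
    θ x (lieBracket ℝ V W x) = fderiv ℝ θ x (W x) (V x) - fderiv ℝ θ x (V x) (W x) := by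
  have key : ∀ {Z : E → E}, DifferentiableAt ℝ Z x → (∀ᶠ y in 𝓝 x, θ y (Z y) = 0) → ∀ u,
      θ x (fderiv ℝ Z x u) = -fderiv ℝ θ x u (Z x) := by
    intro Z hZ h0 u
    have h1 := hθ.hasFDerivAt.clm_apply hZ.hasFDerivAt
    have h2 : (fun y => θ y (Z y)) =ᶠ[𝓝 x] fun _ => 0 := h0
    have h3 := h1.unique ((hasFDerivAt_const (0 : F) x).congr_of_eventuallyEq h2)
    have h4 := congrArg (fun A : E →L[ℝ] F => A u) h3
    simp only [add_apply, ContinuousLinearMap.comp_apply, ContinuousLinearMap.flip_apply,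
      zero_apply] at h4
    exact eq_neg_of_add_eq_zero_left h4
  rw [lieBracket, map_sub, key hW hθW, key hV hθV]
  abel

/-- The form η₂ vanishes on Y₀ and Y₁ and equals 1 on [Y₀, Y₁], so dη₂(Y₀, Y₁) = −1 and η₂ ∧ dη₂
takes the value −1 on ([Y₀, Y₁], Y₀, Y₁). -/
theorem isContactOn_ker {W : Set (EuclideanSpace ℝ (Fin 3))} (hW : IsOpen W)
    {Y : Fin 2 → EuclideanSpace ℝ (Fin 3) → EuclideanSpace ℝ (Fin 3)}
    (hY : ∀ i, ContDiffOn ℝ ∞ (Y i) W)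
    {η : Fin 3 → EuclideanSpace ℝ (Fin 3) → EuclideanSpace ℝ (Fin 3) →L[ℝ] ℝ}
    (hη : ∀ i, ContDiffOn ℝ ∞ (η i) W)
    (hdual : ∀ p ∈ W, ∀ i j, η i p (contactFrame Y j p) = if i = j then 1 else 0) :
    IsContactOn W fun p =>
      LinearMap.ker (η 2 p : EuclideanSpace ℝ (Fin 3) →ₗ[ℝ] ℝ) := by
  refine ⟨η 2, hη 2, fun p hp => ⟨rfl, lieBracket ℝ (Y 0) (Y 1) p, Y 0 p, Y 1 p, ?_⟩⟩
  have h0 : ∀ q ∈ W, η 2 q (Y 0 q) = 0 := fun q hq => hdual q hq 2 0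
  have h1 : ∀ q ∈ W, η 2 q (Y 1 q) = 0 := fun q hq => hdual q hq 2 1
  have h2 : η 2 p (lieBracket ℝ (Y 0) (Y 1) p) = 1 := hdual p hp 2 2
  have hb := form_lieBracket (θ := η 2) (V := Y 0) (W := Y 1) (x := p)
    (((hη 2).contDiffAt (hW.mem_nhds hp)).differentiableAt (by simp))
    (((hY 0).contDiffAt (hW.mem_nhds hp)).differentiableAt (by simp))
    (((hY 1).contDiffAt (hW.mem_nhds hp)).differentiableAt (by simp))
    (Filter.eventually_of_mem (hW.mem_nhds hp) h0) (Filter.eventually_of_mem (hW.mem_nhds hp) h1)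
  rw [h2] at hb
  simp only [wedgeD, h0 p hp, h1 p hp, h2]
  intro h
  linarith

end Symmetries

/-! ### The integrable case. -/

/-- Euclidean `n`-space. -/
abbrev Euc (n : ℕ) := EuclideanSpace ℝ (Fin n)

/-- On `U` there are two symmetries of `D` spanning a complement of `D`. -/
def HasTransversalSymmetriesOn (D : Euc 4 → Submodule ℝ (Euc 4)) (U : Set (Euc 4)) : Prop :=
  ∃ v w : Euc 4 → Euc 4, IsSymmetryOn D U v ∧ IsSymmetryOn D U w ∧
    ∀ x ∈ U, LinearIndependent ℝ ![v x, w x] ∧ IsCompl (D x) (Submodule.span ℝ {v x, w x})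

theorem IsIntegrableOn.mono {U V : Set (Euc 4)} {D : Euc 4 → Submodule ℝ (Euc 4)}
    (h : IsIntegrableOn U D) (hVU : V ⊆ U) : IsIntegrableOn V D := by
  obtain ⟨Φ, h1, h2, h3⟩ := h
  exact ⟨Φ, h1, hVU.trans h2, fun x hx => h3 x (hVU hx)⟩

theorem IsContactProductOn.mono {U V : Set (Euc 4)} {D : Euc 4 → Submodule ℝ (Euc 4)}
    (h : IsContactProductOn U D) (hVU : V ⊆ U) : IsContactProductOn V D := by
  obtain ⟨Φ, W, C, h1, h2, h3, h4, h5⟩ := h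
  exact ⟨Φ, W, C, h1, hVU.trans h2, h3, h4, fun x hx => h5 x (hVU hx)⟩

theorem range_eq_pair {E : Type*} (X : Fin 2 → E → E) (x : E) :
    (fun i => X i x) = ![X 0 x, X 1 x] := by
  funext i; fin_cases i <;> rfl

/-- The involutive case. -/
theorem exists_integrable_of_involutive {D : Euc 4 → Submodule ℝ (Euc 4)} {U : Set (Euc 4)}
    (hU : IsOpen U) {X : Fin 2 → Euc 4 → Euc 4} (hX : ∀ i, ContDiffOn ℝ ∞ (X i) U)
    (hli : ∀ x ∈ U, LinearIndependent ℝ fun i => X i x)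
    (hD : ∀ x ∈ U, D x = Submodule.span ℝ (Set.range fun i => X i x))
    (hinv : ∀ x ∈ U, lieBracket ℝ (X 0) (X 1) x ∈ D x) {x₀ : Euc 4} (hx₀ : x₀ ∈ U) :
    ∃ V : Set (Euc 4), IsOpen V ∧ x₀ ∈ V ∧ V ⊆ U ∧ IsIntegrableOn V D ∧
      HasTransversalSymmetriesOn D V := by
  obtain ⟨V, g, hV, hxV, hVU, hg, hgX⟩ := exists_submersion_of_involutive (G := Euc 2) (by simp)
    hU hX hx₀ (hli x₀ hx₀) (by
      intro x hx i j
      rw [← hD x hx]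
      fin_cases i <;> fin_cases j
      · simp
      · exact hinv x hx
      · change lieBracket ℝ (X 1) (X 0) x ∈ _
        rw [lieBracket_swap]
        exact Submodule.neg_mem _ (hinv x hx)
      · simp)
  obtain ⟨V', -, hxV', -, ξ, -, hξ⟩ := exists_dual_frame hU hX hx₀ (hli x₀ hx₀)
  -- Coordinates along the leaves: the kernel of dg at `x₀` is spanned by the X i, on which `π` is
  -- injective, so (g, π) is a chart near `x₀`.
  let π : Euc 4 →L[ℝ] Euc 2 := ((EuclideanSpace.equiv (Fin 2) ℝ).symm :
    (Fin 2 → ℝ) →L[ℝ] Euc 2).comp (ContinuousLinearMap.pi fun i => ξ i x₀)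
  have hπ : ∀ u i, π u i = ξ i x₀ u := fun u i => rfl
  have hgd : ∀ x ∈ V, DifferentiableAt ℝ g x := fun x hx =>
    (hg.contDiffAt (hV.mem_nhds hx)).differentiableAt (by simp)
  have hfd : ∀ x ∈ V, HasFDerivAt (fun x => (g x, π x)) ((fderiv ℝ g x).prod π) x := fun x hx =>
    (hgd x hx).hasFDerivAt.prodMk π.hasFDerivAt
  obtain ⟨Φ, hxs, hsV, hΦ, hΦf⟩ := exists_chart_of_injective_fderiv (F := Euc 2 × Euc 2) (by simp)
    hV (hg.prodMk π.contDiff.contDiffOn) hxV (by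
      intro u hu
      rw [(hfd x₀ hxV).fderiv] at hu
      have h1 : fderiv ℝ g x₀ u = 0 := congrArg Prod.fst hu
      have h2 : π u = 0 := congrArg Prod.snd hu
      rw [hgX x₀ hxV] at h1
      rw [eq_sum_of_mem_span_of_dual (hξ x₀ hxV') h1]
      refine Finset.sum_eq_zero fun i _ => ?_
      rw [← hπ, h2]
      simp)
  have hΦd : ∀ x ∈ Φ.source, ∀ u, fderiv ℝ Φ x u = (fderiv ℝ g x u, π u) := fun x hx u => by
    rw [hΦf, (hfd x (hsV hx)).fderiv]; rfl
  have h_int : IsIntegrableOn Φ.source D := by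
    refine ⟨Φ, hΦ, subset_rfl, fun x hx => ?_⟩
    ext u
    rw [hD x (hVU (hsV hx)), ← hgX x (hsV hx), Submodule.mem_comap, Submodule.mem_prod]
    change _ ↔ (fderiv ℝ Φ x u).1 ∈ (⊥ : Submodule ℝ (Euc 2)) ∧ _
    rw [hΦd x hx u]
    simp
  -- The coordinate fields transversal to the leaves: dg(v e) = e is constant and dg(X i) = 0, so dg
  -- kills [v e, X i].
  let v : Euc 2 → Euc 4 → Euc 4 := fun e x => fderiv ℝ Φ.symm (Φ x) (e, 0)
  have hv : ∀ e, ContDiffOn ℝ ∞ (v e) Φ.source := fun e =>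
    ((hΦ.2.fderiv_of_isOpen Φ.open_target (m := ∞) (by simp)).comp hΦ.1
      fun x hx => Φ.map_source hx).clm_apply contDiffOn_const
  have hgv : ∀ e, ∀ x ∈ Φ.source, fderiv ℝ g x (v e x) = e := fun e x hx => by
    have h1 := hΦ.fderiv_fderiv_symm hx (e, 0)
    rw [hΦd x hx] at h1
    exact congrArg Prod.fst h1
  have hgX0 : ∀ i, ∀ x ∈ Φ.source, fderiv ℝ g x (X i x) = 0 := fun i x hx => by
    rw [hgX x (hsV hx)]; exact Submodule.subset_span ⟨i, rfl⟩
  have hbr : ∀ e i, ∀ x ∈ Φ.source, lieBracket ℝ (v e) (X i) x ∈ D x := by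
    intro e i x hx
    rw [hD x (hVU (hsV hx)), ← hgX x (hsV hx),
      fderiv_lieBracket Φ.open_source (hg.mono hsV) (hv e) ((hX i).mono (hsV.trans hVU)) hx]
    have h1 : (fun y => fderiv ℝ g y (X i y)) =ᶠ[𝓝 x] fun _ => 0 := by
      filter_upwards [Φ.open_source.mem_nhds hx] with y hy using hgX0 i y hy
    have h2 : (fun y => fderiv ℝ g y (v e y)) =ᶠ[𝓝 x] fun _ => e := by
      filter_upwards [Φ.open_source.mem_nhds hx] with y hy using hgv e y hy
    rw [h1.fderiv_eq, h2.fderiv_eq]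
    simp
  let e₀ : Euc 2 := EuclideanSpace.single 0 1
  let e₁ : Euc 2 := EuclideanSpace.single 1 1
  have hli4 : LinearIndependent ℝ ![X 0 x₀, X 1 x₀, v e₀ x₀, v e₁ x₀] := by
    rw [Fintype.linearIndependent_iff]
    intro c hc
    simp only [Fin.sum_univ_four, Matrix.cons_val] at hc
    have h1 := congrArg (fderiv ℝ g x₀) hc
    simp only [map_add, map_smul, hgX0 _ x₀ hxs, hgv _ x₀ hxs, map_zero, smul_zero,
      zero_add] at h1
    have h2 : c 2 = 0 := by simpa [e₀, e₁] using congrArg (fun z : Euc 2 => z 0) h1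
    have h3 : c 3 = 0 := by simpa [e₀, e₁] using congrArg (fun z : Euc 2 => z 1) h1
    rw [h2, h3, zero_smul, zero_smul, add_zero, add_zero] at hc
    have h4 := hli x₀ hx₀
    rw [range_eq_pair, LinearIndependent.pair_iff] at h4
    obtain ⟨h5, h6⟩ := h4 _ _ hc
    intro i
    fin_cases i
    exacts [h5, h6, h2, h3]
  obtain ⟨V₁, hV₁, hxV₁, hV₁s, hs1, hs2, hs3⟩ := exists_transversal_symmetries (by simp)
    Φ.open_source ((hX 0).mono (hsV.trans hVU)) ((hX 1).mono (hsV.trans hVU))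
    (fun x hx => by rw [hD x (hVU (hsV hx)), range_eq_pair]) (hv e₀) (hv e₁)
    (hbr e₀ 0) (hbr e₀ 1) (hbr e₁ 0) (hbr e₁ 1) hxs hli4
  exact ⟨V₁, hV₁, hxV₁, hV₁s.trans (hsV.trans hVU), h_int.mono hV₁s, v e₀, v e₁, hs1, hs2, hs3⟩

/-! ### Contact distributions on a slice transversal to an invariance field. -/

section ContactSlice

variable {E F : Type*} [NormedAddCommGroup E] [NormedSpace ℝ E]
  [NormedAddCommGroup F] [NormedSpace ℝ F] [FiniteDimensional ℝ F]

/-- In a chart straightening `v`, a horizontal 2-distribution invariant under `v` and bracket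
generating a third direction is locally the product of a contact distribution and a point. -/
theorem exists_contact_slice {Φ : OpenPartialHomeomorph E (F × ℝ)} (hΦ : IsSmoothChart Φ)
    {v : E → E} (hv : ContDiffOn ℝ ∞ v Φ.source)
    (hvΦ : ∀ x ∈ Φ.source, fderiv ℝ Φ x (v x) = (0, 1)) {X : Fin 2 → E → E}
    (hX : ∀ i, ContDiffOn ℝ ∞ (X i) Φ.source)
    (hXt : ∀ x ∈ Φ.source, ∀ i, (fderiv ℝ Φ x (X i x)).2 = 0)
    (hli : ∀ x ∈ Φ.source, LinearIndependent ℝ fun i => contactFrame X i x)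
    (hvX : ∀ x ∈ Φ.source, ∀ i, lieBracket ℝ v (X i) x ∈
      Submodule.span ℝ (Set.range fun i => X i x)) {x₀ : E} (hx₀ : x₀ ∈ Φ.source) :
    ∃ (V : Set E) (W : Set F) (Y : Fin 2 → F → F) (η : Fin 3 → F → F →L[ℝ] ℝ),
      IsOpen V ∧ x₀ ∈ V ∧ V ⊆ Φ.source ∧ IsOpen W ∧ (∀ x ∈ V, (Φ x).1 ∈ W) ∧
      (∀ i, ContDiffOn ℝ ∞ (Y i) W) ∧ (∀ i, ContDiffOn ℝ ∞ (η i) W) ∧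
      (∀ p ∈ W, ∀ i j, η i p (contactFrame Y j p) = if i = j then 1 else 0) ∧
      (∀ i, (fderiv ℝ Φ x₀ (X i x₀)).1 = Y i (Φ x₀).1) ∧
      ∀ x ∈ V, ∀ u, u ∈ Submodule.span ℝ (Set.range fun i => X i x) ↔
        (fderiv ℝ Φ x u).2 = 0 ∧
          (fderiv ℝ Φ x u).1 ∈ Submodule.span ℝ (Set.range fun i => Y i (Φ x).1) := by
  let A : Fin 2 → F × ℝ → F × ℝ := fun i => pushField Φ (X i)
  have hA : ∀ i, ContDiffOn ℝ ∞ (A i) Φ.target := fun i => contDiffOn_pushField hΦ (hX i)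
  have hAd : ∀ i, ∀ q ∈ Φ.target, DifferentiableAt ℝ (A i) q := fun i q hq =>
    ((hA i).contDiffAt (Φ.open_target.mem_nhds hq)).differentiableAt (by simp)
  have hA2 : ∀ i, ∀ q ∈ Φ.target, (A i q).2 = 0 := fun i q hq => hXt _ (Φ.map_target hq) i
  have hli2 : ∀ x ∈ Φ.source, LinearIndependent ℝ fun i => X i x := fun x hx => by
    have := (hli x hx).comp ![0, 1] (by decide)
    convert this using 1
    funext i; fin_cases i <;> rfl
  set p₀ := (Φ x₀).1 with hp₀
  set t₀ := (Φ x₀).2 with ht₀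
  have hpt : (p₀, t₀) = Φ x₀ := rfl
  obtain ⟨δ, hδ, hbox, hinv⟩ := exists_span_eq_of_fderiv_mem (p₀ := p₀) (t₀ := t₀)
    (A := A) Φ.open_target hA (Φ.map_source hx₀) (linearIndependent_pushField hΦ hx₀ (hli2 x₀ hx₀))
    (by
      intro q hq i
      have hy := Φ.map_target hq
      rw [fderiv_pushField_flow_box hΦ hv (hX i) hvΦ hq]
      have h1 := map_fderiv_span X hy
      rw [Φ.right_inv hq] at h1
      change _ ∈ Submodule.span ℝ (Set.range fun i => pushField Φ (X i) q)
      rw [← h1]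
      exact Submodule.mem_map_of_mem (hvX _ hy i))
  have hts : t₀ ∈ Metric.ball t₀ δ := Metric.mem_ball_self hδ
  have hps : p₀ ∈ Metric.ball p₀ δ := Metric.mem_ball_self hδ
  -- The slice passes through `x₀`, so at `x₀` the `Y i` are the actual images of the `X i`. At
  -- other heights only the spans agree.
  let Y : Fin 2 → F → F := fun i => sliceField t₀ (A i)
  have hY : ∀ i, ContDiffOn ℝ ∞ (Y i) (Metric.ball p₀ δ) := fun i =>
    contDiffOn_sliceField (hA i) fun p hp => hbox ⟨hp, hts⟩
  -- The fields are horizontal on the whole chart domain, so the last coordinate of their bracket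
  -- also vanishes, and its horizontal part is the bracket taken in the slice.
  have hframe : ∀ p ∈ Metric.ball p₀ δ, ∀ i,
      pushField Φ (contactFrame X i) (p, t₀) = (contactFrame Y i p, 0) := by
    intro p hp i
    have hq : (p, t₀) ∈ Φ.target := hbox ⟨hp, hts⟩
    have hbase : ∀ i, A i (p, t₀) = (Y i p, 0) := fun i => Prod.ext rfl (hA2 i _ hq)
    fin_cases i
    · exact hbase 0
    · exact hbase 1
    · change pushField Φ (lieBracket ℝ (X 0) (X 1)) (p, t₀) = (lieBracket ℝ (Y 0) (Y 1) p, 0)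
      have h1 := fst_lieBracket_eq (hAd 0 _ hq) (hAd 1 _ hq)
      rw [hA2 0 _ hq, hA2 1 _ hq, zero_smul, zero_smul, add_zero, sub_zero] at h1
      refine Prod.ext ?_ ?_
      · rw [pushField_lieBracket hΦ (hX 0) (hX 1) hq]
        exact h1
      · have hx := Φ.map_target hq
        have h2 := fderiv_lieBracket (f := fun x => (Φ x).2) Φ.open_source
          (contDiff_snd.comp_contDiffOn hΦ.1) (hX 0) (hX 1) hx
        have h3 : ∀ x ∈ Φ.source, ∀ u, fderiv ℝ (fun x => (Φ x).2) x u = (fderiv ℝ Φ x u).2 :=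
          fun x hx u => by rw [fderiv.snd (hΦ.differentiableAt hx)]; rfl
        have h4 : ∀ i, (fun y => fderiv ℝ (fun x => (Φ x).2) y (X i y)) =ᶠ[𝓝 (Φ.symm (p, t₀))]
            fun _ => 0 := fun i => by
          filter_upwards [Φ.open_source.mem_nhds hx] with y hy
          rw [h3 y hy, hXt y hy]
        rw [(h4 0).fderiv_eq, (h4 1).fderiv_eq, h3 _ hx] at h2
        simpa [pushField] using h2
  have hYli : LinearIndependent ℝ fun i => contactFrame Y i p₀ := by
    have h1 := linearIndependent_pushField hΦ hx₀ (hli x₀ hx₀)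
    rw [← hpt] at h1
    simp only [hframe p₀ hps] at h1
    rw [Fintype.linearIndependent_iff] at h1 ⊢
    intro g hg
    refine h1 g ?_
    ext
    · simpa [Prod.fst_sum] using hg
    · simp [Prod.snd_sum]
  obtain ⟨W, hW, hpW, hWB, η, hη, hdual⟩ := exists_dual_frame (X := contactFrame Y)
    Metric.isOpen_ball (contDiffOn_contactFrame Metric.isOpen_ball hY) hps hYli
  have hΩ : IsOpen (W ×ˢ Metric.ball t₀ δ) := hW.prod Metric.isOpen_ball
  refine ⟨Φ.source ∩ Φ ⁻¹' (W ×ˢ Metric.ball t₀ δ), W, Y, η,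
    Φ.continuousOn.isOpen_inter_preimage Φ.open_source hΩ, ⟨hx₀, hpW, hts⟩,
    Set.inter_subset_left, hW, fun x hx => hx.2.1, fun i => (hY i).mono hWB, hη, hdual, ?_, ?_⟩
  · intro i
    rw [← pushField_apply (X i) hx₀]
    rfl
  · intro x hx u
    have hp := hWB hx.2.1
    have h1 : u ∈ Submodule.span ℝ (Set.range fun i => X i x) ↔
        fderiv ℝ Φ x u ∈ Submodule.span ℝ (Set.range fun i => A i ((Φ x).1, t₀)) := by
      rw [← hinv _ hp _ hx.2.2 _ hts, Prod.mk.eta, ← map_fderiv_span X hx.1]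
      constructor
      · exact fun hu => Submodule.mem_map_of_mem hu
      · rintro ⟨w, hw, hwu⟩
        rwa [← hΦ.fderiv_injective hx.1 hwu]
    have h2 : ∀ i, A i ((Φ x).1, t₀) = (Y i (Φ x).1, 0) := fun i =>
      Prod.ext rfl (hA2 i _ (hbox ⟨hp, hts⟩))
    rw [h1]
    simp only [h2, mem_span_range_two]
    constructor
    · rintro ⟨a, b, hab⟩
      refine ⟨?_, a, b, ?_⟩
      · rw [← hab]; simp
      · rw [← hab]; simp
    · rintro ⟨h0, a, b, hab⟩
      exact ⟨a, b, Prod.ext (by simpa using hab) (by simpa using h0.symm)⟩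

end ContactSlice

/-! ### Brackets of fields related by a map. -/

section Related

variable {E F : Type*} [NormedAddCommGroup E] [NormedSpace ℝ E]
  [NormedAddCommGroup F] [NormedSpace ℝ F]

/-- [V, W]f = V(Wf) − W(Vf), and both inner derivatives are constant. -/
theorem fderiv_lieBracket_eq_zero {f : E → F} {V W : E → E} {U : Set E} (hU : IsOpen U)
    (hf : ContDiffOn ℝ ∞ f U) (hV : ContDiffOn ℝ ∞ V U) (hW : ContDiffOn ℝ ∞ W U) {a b : F}
    (ha : ∀ x ∈ U, fderiv ℝ f x (V x) = a) (hb : ∀ x ∈ U, fderiv ℝ f x (W x) = b)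
    {x : E} (hx : x ∈ U) : fderiv ℝ f x (lieBracket ℝ V W x) = 0 := by
  have h1 : (fun y => fderiv ℝ f y (V y)) =ᶠ[𝓝 x] fun _ => a := by
    filter_upwards [hU.mem_nhds hx] with y hy using ha y hy
  have h2 : (fun y => fderiv ℝ f y (W y)) =ᶠ[𝓝 x] fun _ => b := by
    filter_upwards [hU.mem_nhds hx] with y hy using hb y hy
  rw [fderiv_lieBracket hU hf hV hW hx, h1.fderiv_eq, h2.fderiv_eq]
  simp

/-- If `v` is `P`-related to `w` and `X` projects to a combination of the fields `Y i`, then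
`[v, X]` projects to a combination of the `Y i` and `[w, Y i]`. -/
theorem fderiv_lieBracket_mem_of_related {ι : Type*} [Fintype ι] {P : E → F} {v X : E → E}
    {w : F → F} {Y : ι → F → F} {c : ι → E → ℝ} {U : Set E} {W : Set F} (hU : IsOpen U)
    (hW : IsOpen W) (hP : ContDiffOn ℝ ∞ P U) (hPW : ∀ x ∈ U, P x ∈ W)
    (hv : ContDiffOn ℝ ∞ v U) (hX : ContDiffOn ℝ ∞ X U) (hw : ContDiffOn ℝ ∞ w W)
    (hY : ∀ i, ContDiffOn ℝ ∞ (Y i) W) (hc : ∀ i, ContDiffOn ℝ ∞ (c i) U)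
    (hPv : ∀ x ∈ U, fderiv ℝ P x (v x) = w (P x))
    (hPX : ∀ x ∈ U, fderiv ℝ P x (X x) = ∑ i, c i x • Y i (P x)) {x : E} (hx : x ∈ U)
    {S : Submodule ℝ F} (hYS : ∀ i, Y i (P x) ∈ S)
    (hwS : ∀ i, lieBracket ℝ w (Y i) (P x) ∈ S) :
    fderiv ℝ P x (lieBracket ℝ v X x) ∈ S := by
  have hPd : HasFDerivAt P (fderiv ℝ P x) x :=
    ((hP.contDiffAt (hU.mem_nhds hx)).differentiableAt (by simp)).hasFDerivAt
  have hwd : HasFDerivAt w (fderiv ℝ w (P x)) (P x) :=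
    ((hw.contDiffAt (hW.mem_nhds (hPW x hx))).differentiableAt (by simp)).hasFDerivAt
  have hYd : ∀ i, HasFDerivAt (Y i) (fderiv ℝ (Y i) (P x)) (P x) := fun i =>
    (((hY i).contDiffAt (hW.mem_nhds (hPW x hx))).differentiableAt (by simp)).hasFDerivAt
  have hcd : ∀ i, HasFDerivAt (c i) (fderiv ℝ (c i) x) x := fun i =>
    (((hc i).contDiffAt (hU.mem_nhds hx)).differentiableAt (by simp)).hasFDerivAt
  have h1 : HasFDerivAt (fun y => fderiv ℝ P y (v y)) ((fderiv ℝ w (P x)).comp (fderiv ℝ P x))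
      x := by
    refine (hwd.comp x hPd).congr_of_eventuallyEq ?_
    filter_upwards [hU.mem_nhds hx] with y hy using hPv y hy
  have h2 : HasFDerivAt (fun y => fderiv ℝ P y (X y)) (∑ i, (c i x •
      ((fderiv ℝ (Y i) (P x)).comp (fderiv ℝ P x)) +
        (fderiv ℝ (c i) x).smulRight (Y i (P x)))) x := by
    refine (HasFDerivAt.fun_sum fun i _ =>
      (hcd i).smul ((hYd i).comp x hPd)).congr_of_eventuallyEq ?_
    filter_upwards [hU.mem_nhds hx] with y hy using hPX y hy
  rw [fderiv_lieBracket hU hP hv hX hx, h1.fderiv, h2.fderiv, sum_apply,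
    ContinuousLinearMap.comp_apply, hPX x hx, map_sum, ← Finset.sum_sub_distrib]
  refine S.sum_mem fun i _ => ?_
  have h3 := S.add_mem (S.smul_mem (c i x) (hwS i)) (S.smul_mem (fderiv ℝ (c i) x (v x)) (hYS i))
  convert h3 using 1
  simp only [add_apply, smul_apply, ContinuousLinearMap.comp_apply,
    ContinuousLinearMap.smulRight_apply, hPv x hx, map_smul, lieBracket]
  module

end Related

/-! ### The product of a contact distribution and a point. -/

section ContactProduct

/-- A 2-distribution whose first derived distribution is an involutive 3-distribution. -/
theorem exists_contactProduct {D : Euc 4 → Submodule ℝ (Euc 4)} {U : Set (Euc 4)}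
    (hU : IsOpen U) {X : Fin 2 → Euc 4 → Euc 4} (hX : ∀ i, ContDiffOn ℝ ∞ (X i) U)
    (hli : ∀ x ∈ U, LinearIndependent ℝ fun i => contactFrame X i x)
    (hD : ∀ x ∈ U, D x = Submodule.span ℝ (Set.range fun i => X i x))
    (hinv : ∀ x ∈ U, ∀ i, lieBracket ℝ (X i) (lieBracket ℝ (X 0) (X 1)) x ∈
      Submodule.span ℝ (Set.range fun i => contactFrame X i x)) {x₀ : Euc 4} (hx₀ : x₀ ∈ U) :
    ∃ V : Set (Euc 4), IsOpen V ∧ x₀ ∈ V ∧ V ⊆ U ∧ IsContactProductOn V D ∧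
      HasTransversalSymmetriesOn D V := by
  have hZ := contDiffOn_contactFrame hU hX
  have hmem : ∀ x i, contactFrame X i x ∈
      Submodule.span ℝ (Set.range fun i => contactFrame X i x) := fun x i =>
    Submodule.subset_span ⟨i, rfl⟩
  obtain ⟨V₁, t, hV₁, hxV₁, hV₁U, ht, htX⟩ := exists_submersion_of_involutive (G := ℝ)
    (by simp) hU hZ hx₀ (hli x₀ hx₀) (by
      intro x hx
      have hswap : ∀ i j, lieBracket ℝ (contactFrame X i) (contactFrame X j) x ∈
          Submodule.span ℝ (Set.range fun i => contactFrame X i x) →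
          lieBracket ℝ (contactFrame X j) (contactFrame X i) x ∈
          Submodule.span ℝ (Set.range fun i => contactFrame X i x) := fun i j h => by
        rw [lieBracket_swap]; exact Submodule.neg_mem _ h
      have h01 : lieBracket ℝ (contactFrame X 0) (contactFrame X 1) x ∈
          Submodule.span ℝ (Set.range fun i => contactFrame X i x) := hmem x 2
      have h02 : lieBracket ℝ (contactFrame X 0) (contactFrame X 2) x ∈
          Submodule.span ℝ (Set.range fun i => contactFrame X i x) := hinv x hx 0
      have h12 : lieBracket ℝ (contactFrame X 1) (contactFrame X 2) x ∈
          Submodule.span ℝ (Set.range fun i => contactFrame X i x) := hinv x hx 1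
      have hself : ∀ i, lieBracket ℝ (contactFrame X i) (contactFrame X i) x ∈
          Submodule.span ℝ (Set.range fun i => contactFrame X i x) := fun i => by simp
      intro i j
      fin_cases i <;> fin_cases j
      exacts [hself 0, h01, h02, hswap _ _ h01, hself 1, h12, hswap _ _ h02, hswap _ _ h12,
        hself 2])
  obtain ⟨c, hc⟩ : ∃ c, fderiv ℝ t x₀ c ≠ 0 := by
    by_contra! hall
    have h1 : Submodule.span ℝ (Set.range fun i => contactFrame X i x₀) = ⊤ :=
      eq_top_iff.2 fun u _ => (htX x₀ hxV₁ u).1 (hall u)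
    have h2 := finrank_range_le_card (R := ℝ) (fun i => contactFrame X i x₀)
    rw [Set.finrank, h1, finrank_top] at h2
    simp at h2
  have htc : ContDiffOn ℝ ∞ (fun x => fderiv ℝ t x c) V₁ :=
    contDiffOn_fderiv_apply hV₁ ht contDiffOn_const
  have hV₂ : IsOpen (V₁ ∩ (fun x => fderiv ℝ t x c) ⁻¹' {0}ᶜ) :=
    htc.continuousOn.isOpen_inter_preimage hV₁ isOpen_compl_singleton
  obtain ⟨V₃, hV₃, hxV₃, hV₃₂, ξ, hξ, hdual⟩ := exists_dual_frame hV₂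
    (fun i => (hZ i).mono (Set.inter_subset_left.trans hV₁U)) ⟨hxV₁, hc⟩ (hli x₀ hx₀)
  have hV₃₁ : V₃ ⊆ V₁ := hV₃₂.trans Set.inter_subset_left
  have hV₃U : V₃ ⊆ U := hV₃₁.trans hV₁U
  have hX₃ : ∀ i, ContDiffOn ℝ ∞ (X i) V₃ := fun i => (hX i).mono hV₃U
  have htZ : ∀ x ∈ V₃, ∀ i, fderiv ℝ t x (contactFrame X i x) = 0 := fun x hx i =>
    (htX x (hV₃₁ hx) _).2 (hmem x i)
  -- With dt(v₀) = 1 constant and dt(X i) = 0, the brackets [v₀, X i] lie in ker dt = ∂⁽¹⁾Π, which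
  -- is what the correction requires.
  let v₀ : Euc 4 → Euc 4 := fun x => (fderiv ℝ t x c)⁻¹ • c
  have hv₀ : ContDiffOn ℝ ∞ v₀ V₃ :=
    ((htc.mono hV₃₁).inv fun x hx => (hV₃₂ hx).2).smul contDiffOn_const
  have htv₀ : ∀ x ∈ V₃, fderiv ℝ t x (v₀ x) = 1 := fun x hx => by
    simp only [v₀, map_smul, smul_eq_mul]
    exact inv_mul_cancel₀ (hV₃₂ hx).2
  obtain ⟨hv, hvX⟩ := lieBracket_corrected_mem hV₃ hX₃ hξ hdual hv₀ (by
    intro x hx i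
    rw [← htX x (hV₃₁ hx)]
    exact fderiv_lieBracket_eq_zero hV₃ (ht.mono hV₃₁) hv₀ (hX₃ i) htv₀ (b := 0)
      (fun y hy => (htX y (hV₃₁ hy) _).2 (by fin_cases i; exacts [hmem y 0, hmem y 1])) hx)
  -- The second candidate is X₂ itself: its brackets with the X i stay in ∂⁽¹⁾Π by involutivity.
  obtain ⟨hw, hwX⟩ := lieBracket_corrected_mem hV₃ hX₃ hξ hdual (v := lieBracket ℝ (X 0) (X 1))
    ((hZ 2).mono hV₃U) (by
      intro x hx i
      rw [lieBracket_swap]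
      exact Submodule.neg_mem _ (hinv x (hV₃U hx) i))
  set v : Euc 4 → Euc 4 := fun x => v₀ x + (-ξ 2 x (lieBracket ℝ v₀ (X 1) x)) • X 0 x +
    ξ 2 x (lieBracket ℝ v₀ (X 0) x) • X 1 x with hvdef
  set w : Euc 4 → Euc 4 := fun x => lieBracket ℝ (X 0) (X 1) x +
    (-ξ 2 x (lieBracket ℝ (lieBracket ℝ (X 0) (X 1)) (X 1) x)) • X 0 x +
    ξ 2 x (lieBracket ℝ (lieBracket ℝ (X 0) (X 1)) (X 0) x) • X 1 x with hwdef
  have htX0 : ∀ x ∈ V₃, fderiv ℝ t x (X 0 x) = 0 := fun x hx => htZ x hx 0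
  have htX1 : ∀ x ∈ V₃, fderiv ℝ t x (X 1 x) = 0 := fun x hx => htZ x hx 1
  have htX2 : ∀ x ∈ V₃, fderiv ℝ t x (lieBracket ℝ (X 0) (X 1) x) = 0 := fun x hx => htZ x hx 2
  have htv : ∀ x ∈ V₃, fderiv ℝ t x (v x) = 1 := fun x hx => by
    simp [hvdef, htv₀ x hx, htX0 x hx, htX1 x hx]
  have htw : ∀ x ∈ V₃, fderiv ℝ t x (w x) = 0 := fun x hx => by
    simp [hwdef, htX2 x hx, htX0 x hx, htX1 x hx]
  have hξw : ξ 2 x₀ (w x₀) = 1 := by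
    have h0 : ξ 2 x₀ (X 0 x₀) = 0 := hdual x₀ hxV₃ 2 0
    have h1 : ξ 2 x₀ (X 1 x₀) = 0 := hdual x₀ hxV₃ 2 1
    have h2 : ξ 2 x₀ (lieBracket ℝ (X 0) (X 1) x₀) = 1 := hdual x₀ hxV₃ 2 2
    simp [hwdef, h0, h1, h2]
  have hv0 : v x₀ ≠ 0 := fun h => by
    have := htv x₀ hxV₃
    rw [h, map_zero] at this
    exact zero_ne_one this
  obtain ⟨Ψ, hxΨ, hΨV, hΨ, -, hΨv⟩ := exists_flow_box (F := Euc 3) (by simp) hV₃ hv hxV₃ hv0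
  have htd : ∀ x ∈ Ψ.source, DifferentiableAt ℝ t x := fun x hx =>
    (ht.contDiffAt (hV₁.mem_nhds (hV₃₁ (hΨV hx)))).differentiableAt (by simp)
  have hfd : ∀ x ∈ Ψ.source, HasFDerivAt (fun x => ((Ψ x).1, t x))
      (((ContinuousLinearMap.fst ℝ (Euc 3) ℝ).comp (fderiv ℝ Ψ x)).prod (fderiv ℝ t x)) x :=
    fun x hx => ((ContinuousLinearMap.fst ℝ (Euc 3) ℝ).hasFDerivAt.comp x
      (hΨ.differentiableAt hx).hasFDerivAt).prodMk (htd x hx).hasFDerivAt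
  -- The last flow box coordinate is replaced by t. Since dt(v) = 1 the field `v` is still (0, 1),
  -- and now the X i, killed by dt, are horizontal.
  obtain ⟨Φ, hxΦ, hΦΨ, hΦ, hΦf⟩ := exists_chart_of_injective_fderiv (F := Euc 3 × ℝ)
    (f := fun x => ((Ψ x).1, t x)) (by simp)
    Ψ.open_source ((contDiff_fst.comp_contDiffOn hΨ.1).prodMk (ht.mono (hΨV.trans hV₃₁))) hxΨ (by
      intro u hu
      rw [(hfd x₀ hxΨ).fderiv] at hu
      have h1 : (fderiv ℝ Ψ x₀ u).1 = 0 := congrArg Prod.fst hu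
      have h2 : fderiv ℝ t x₀ u = 0 := congrArg Prod.snd hu
      have h3 : fderiv ℝ Ψ x₀ u = fderiv ℝ Ψ x₀ ((fderiv ℝ Ψ x₀ u).2 • v x₀) := by
        rw [map_smul, hΨv x₀ hxΨ]
        ext1 <;> simp [h1]
      have h4 := hΨ.fderiv_injective hxΨ h3
      rw [h4, map_smul, htv x₀ hxV₃, smul_eq_mul, mul_one] at h2
      rw [h4, h2, zero_smul])
  have hΦV : Φ.source ⊆ V₃ := hΦΨ.trans hΨV
  have hΦd : ∀ x ∈ Φ.source, ∀ u, fderiv ℝ Φ x u = ((fderiv ℝ Ψ x u).1, fderiv ℝ t x u) :=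
    fun x hx u => by rw [hΦf, (hfd x (hΦΨ hx)).fderiv]; rfl
  obtain ⟨V, W, Y, η, hV, hxV, hVΦ, hW, hVW, hY, hη, hYη, -, hspan⟩ :=
    exists_contact_slice hΦ (hv.mono hΦV)
      (fun x hx => by rw [hΦd x hx, hΨv x (hΦΨ hx), htv x (hΦV hx)])
      (fun i => (hX₃ i).mono hΦV)
      (fun x hx i => by
        rw [hΦd x hx]
        fin_cases i
        exacts [htX0 x (hΦV hx), htX1 x (hΦV hx)])
      (fun x hx => hli x (hV₃U (hΦV hx))) (fun x hx => hvX x (hΦV hx)) hxΦ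
  have hprod : IsContactProductOn V D := by
    refine ⟨Φ, W, _, hΦ, hVΦ, hW, isContactOn_ker hW hY hη hYη, fun x hx => ⟨hVW x hx, ?_⟩⟩
    ext u
    rw [hD x (hV₃U (hΦV (hVΦ hx))), hspan x hx, Submodule.mem_comap, Submodule.mem_prod,
      and_comm]
    refine and_congr ?_ Iff.rfl
    change _ ↔ η 2 (Φ x).1 (fderiv ℝ Φ x u).1 = 0
    constructor
    · intro h
      obtain ⟨a, b, hab⟩ := mem_span_range_two.1 h
      have h0 : η 2 (Φ x).1 (Y 0 (Φ x).1) = 0 := hYη _ (hVW x hx) 2 0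
      have h1 : η 2 (Φ x).1 (Y 1 (Φ x).1) = 0 := hYη _ (hVW x hx) 2 1
      rw [← hab]
      simp [h0, h1]
    · intro h
      rw [eq_sum_of_dual_of_card_eq_finrank (hYη _ (hVW x hx)) (by simp) (fderiv ℝ Φ x u).1,
        Fin.sum_univ_three, h, zero_smul, add_zero]
      exact mem_span_range_two.2 ⟨_, _, rfl⟩
  have hli4 : LinearIndependent ℝ ![X 0 x₀, X 1 x₀, v x₀, w x₀] := by
    rw [Fintype.linearIndependent_iff]
    intro a ha
    simp only [Fin.sum_univ_four, Matrix.cons_val] at ha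
    have h2 : a 2 = 0 := by
      have := congrArg (fderiv ℝ t x₀) ha
      simpa [htX0 x₀ hxV₃, htX1 x₀ hxV₃, htv x₀ hxV₃, htw x₀ hxV₃] using this
    rw [h2, zero_smul, add_zero] at ha
    have hξX : ∀ i j, ξ i x₀ (contactFrame X j x₀) = if i = j then 1 else 0 := hdual x₀ hxV₃
    have hX0 : ∀ i, ξ i x₀ (X 0 x₀) = if i = 0 then 1 else 0 := fun i => hξX i 0
    have hX1 : ∀ i, ξ i x₀ (X 1 x₀) = if i = 1 then 1 else 0 := fun i => hξX i 1
    have h3 : a 3 = 0 := by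
      have := congrArg (ξ 2 x₀) ha
      simpa [hX0, hX1, hξw] using this
    rw [h3, zero_smul, add_zero] at ha
    have h0 : a 0 = 0 := by
      have := congrArg (ξ 0 x₀) ha
      simpa [hX0, hX1] using this
    have h1 : a 1 = 0 := by
      have := congrArg (ξ 1 x₀) ha
      simpa [hX0, hX1] using this
    intro i
    fin_cases i
    exacts [h0, h1, h2, h3]
  have hVV₃ : V ⊆ V₃ := hVΦ.trans hΦV
  have hDm : ∀ x ∈ V, D x = Submodule.span ℝ (Set.range fun i => X i x) := fun x hx =>
    hD x (hV₃U (hVV₃ hx))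
  obtain ⟨V', hV', hxV', hV'V, hs1, hs2, hs3⟩ := exists_transversal_symmetries
    (D := D) (by simp) hV
    ((hX₃ 0).mono hVV₃) ((hX₃ 1).mono hVV₃) (fun x hx => by rw [hDm x hx, range_eq_pair])
    (hv.mono hVV₃) (hw.mono hVV₃)
    (fun x hx => by rw [hDm x hx]; exact hvX x (hVV₃ hx) 0)
    (fun x hx => by rw [hDm x hx]; exact hvX x (hVV₃ hx) 1)
    (fun x hx => by rw [hDm x hx]; exact hwX x (hVV₃ hx) 0)
    (fun x hx => by rw [hDm x hx]; exact hwX x (hVV₃ hx) 1) hxV hli4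
  exact ⟨V', hV', hxV', hV'V.trans (hVV₃.trans hV₃U), hprod.mono hV'V, v, w, hs1, hs2, hs3⟩

end ContactProduct

/-! ### General position: the characteristic field. -/

section Engel

/-- Near a point of general position a 2-distribution is spanned by its characteristic field `L`,
straightened by a chart, and a horizontal field `A`. -/
theorem exists_engel_chart {D : Euc 4 → Submodule ℝ (Euc 4)} {U : Set (Euc 4)}
    (hU : IsOpen U) {X : Fin 2 → Euc 4 → Euc 4} (hX : ∀ i, ContDiffOn ℝ ∞ (X i) U)
    (hD : ∀ x ∈ U, D x = Submodule.span ℝ (Set.range fun i => X i x)) {x₀ : Euc 4} (hx₀ : x₀ ∈ U)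
    (hli : LinearIndependent ℝ fun i => contactFrame X i x₀)
    (hgen : lieBracket ℝ (X 1) (lieBracket ℝ (X 0) (X 1)) x₀ ∉
      Submodule.span ℝ (Set.range fun i => contactFrame X i x₀)) :
    ∃ (Φ : OpenPartialHomeomorph (Euc 4) (Euc 3 × ℝ)) (L A : Euc 4 → Euc 4)
      (β : Euc 4 → Euc 4 →L[ℝ] ℝ), IsSmoothChart Φ ∧ x₀ ∈ Φ.source ∧ Φ.source ⊆ U ∧
      ContDiffOn ℝ ∞ L Φ.source ∧ ContDiffOn ℝ ∞ A Φ.source ∧ ContDiffOn ℝ ∞ β Φ.source ∧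
      ∀ x ∈ Φ.source, fderiv ℝ Φ x (L x) = (0, 1) ∧
        D x = Submodule.span ℝ (Set.range ![L x, A x]) ∧
        (fderiv ℝ Φ x (A x)).2 = 0 ∧ (fderiv ℝ Φ x (lieBracket ℝ L A x)).2 = 0 ∧
        β x (A x) = 0 ∧ β x (lieBracket ℝ L A x) = 1 ∧
        LinearIndependent ℝ (fun i => contactFrame ![A, lieBracket ℝ L A] i x) ∧
        lieBracket ℝ L (lieBracket ℝ L A) x ∈
          Submodule.span ℝ (Set.range ![A x, lieBracket ℝ L A x]) := by
  let X₂ := lieBracket ℝ (X 0) (X 1)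
  have hX₂ : ContDiffOn ℝ ∞ X₂ U := contDiffOn_lieBracket hU (hX 0) (hX 1)
  let X₃ := lieBracket ℝ (X 1) X₂
  have hX₃ : ContDiffOn ℝ ∞ X₃ U := contDiffOn_lieBracket hU (hX 1) hX₂
  let Z : Fin 4 → Euc 4 → Euc 4 := ![X 0, X 1, X₂, X₃]
  have hZ : ∀ i, ContDiffOn ℝ ∞ (Z i) U := by
    intro i
    fin_cases i
    exacts [hX 0, hX 1, hX₂, hX₃]
  have hZli : LinearIndependent ℝ fun i => Z i x₀ := by
    have h1 := linearIndependent_finSnoc.2 ⟨hli, hgen⟩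
    have h2 : (fun i => Z i x₀) = Fin.snoc (fun i => contactFrame X i x₀) (X₃ x₀) := by
      funext i
      fin_cases i <;> rfl
    rw [h2]
    exact h1
  obtain ⟨V, hV, hxV, hVU, ζ, hζ, hdual⟩ := exists_dual_frame hU hZ hx₀ hZli
  have hζ0 : ∀ x ∈ V, ∀ i, ζ i x (X 0 x) = if i = 0 then 1 else 0 := fun x hx i => hdual x hx i 0
  have hζ1 : ∀ x ∈ V, ∀ i, ζ i x (X 1 x) = if i = 1 then 1 else 0 := fun x hx i => hdual x hx i 1
  have hζ2 : ∀ x ∈ V, ∀ i, ζ i x (X₂ x) = if i = 2 then 1 else 0 := fun x hx i => hdual x hx i 2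
  have hζ3 : ∀ x ∈ V, ∀ i, ζ i x (X₃ x) = if i = 3 then 1 else 0 := fun x hx i => hdual x hx i 3
  let c : Euc 4 → ℝ := fun x => ζ 3 x (lieBracket ℝ (X 0) X₂ x)
  have hc : ContDiffOn ℝ ∞ c V :=
    (hζ 3).clm_apply ((contDiffOn_lieBracket hU (hX 0) hX₂).mono hVU)
  -- The kernel of `ζ 3` is ⟨X₀, X₁, X₂⟩, and ζ₃[X₁, X₂] = 1. The function `c` is chosen so that [X₀
  -- − cX₁, X₂] has no X₃-component.
  let L : Euc 4 → Euc 4 := fun x => X 0 x - c x • X 1 x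
  have hL : ContDiffOn ℝ ∞ L V := ((hX 0).mono hVU).sub (hc.smul ((hX 1).mono hVU))
  have hζL : ∀ x ∈ V, ∀ i, ζ i x (L x) = (if i = 0 then 1 else 0) - c x * if i = 1 then 1 else 0 :=
    fun x hx i => by simp only [L, map_sub, map_smul, hζ0 x hx, hζ1 x hx, smul_eq_mul]
  have hL0 : L x₀ ≠ 0 := fun h => by
    have := hζL x₀ hxV 0
    rw [h] at this
    simp at this
  obtain ⟨Φ, hxΦ, hΦV, hΦ, -, hΦL⟩ := exists_flow_box (F := Euc 3) (by simp) hV hL hxV hL0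
  have hS := Φ.open_source
  have hXs : ∀ i, ContDiffOn ℝ ∞ (X i) Φ.source := fun i => (hX i).mono (hΦV.trans hVU)
  have hX₂s : ContDiffOn ℝ ∞ X₂ Φ.source := hX₂.mono (hΦV.trans hVU)
  have hLs : ContDiffOn ℝ ∞ L Φ.source := hL.mono hΦV
  let T : Euc 4 → ℝ := fun x => (Φ x).2
  have hT : ContDiffOn ℝ ∞ T Φ.source := contDiff_snd.comp_contDiffOn hΦ.1
  have hTd : ∀ x ∈ Φ.source, ∀ u, fderiv ℝ T x u = (fderiv ℝ Φ x u).2 := fun x hx u => by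
    rw [fderiv.snd (hΦ.differentiableAt hx)]; rfl
  have hTL : ∀ x ∈ Φ.source, fderiv ℝ T x (L x) = 1 := fun x hx => by
    rw [hTd x hx, hΦL x hx]
  let d : Euc 4 → ℝ := fun x => fderiv ℝ T x (X 1 x)
  have hd : ContDiffOn ℝ ∞ d Φ.source := contDiffOn_fderiv_apply hS hT (hXs 1)
  let A : Euc 4 → Euc 4 := fun x => X 1 x - d x • L x
  have hA : ContDiffOn ℝ ∞ A Φ.source := (hXs 1).sub (hd.smul hLs)
  have hTA : ∀ x ∈ Φ.source, fderiv ℝ T x (A x) = 0 := fun x hx => by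
    simp only [A, map_sub, map_smul, hTL x hx, d]
    simp
  let B := lieBracket ℝ L A
  have hB : ContDiffOn ℝ ∞ B Φ.source := contDiffOn_lieBracket hS hLs hA
  have hTB : ∀ x ∈ Φ.source, fderiv ℝ T x (B x) = 0 := fun x hx =>
    fderiv_lieBracket_eq_zero hS hT hLs hA hTL hTA hx
  -- brackets of fields annihilated by one of the dual forms
  have hform : ∀ k, ∀ {P Q : Euc 4 → Euc 4}, ContDiffOn ℝ ∞ P Φ.source →
      ContDiffOn ℝ ∞ Q Φ.source → (∀ x ∈ Φ.source, ζ k x (P x) = 0) →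
      (∀ x ∈ Φ.source, ζ k x (Q x) = 0) → ∀ x ∈ Φ.source, ζ k x (lieBracket ℝ P Q x) =
        fderiv ℝ (ζ k) x (Q x) (P x) - fderiv ℝ (ζ k) x (P x) (Q x) := by
    intro k P Q hP hQ hP0 hQ0 x hx
    have hn := hS.mem_nhds hx
    exact form_lieBracket
      ((((hζ k).mono hΦV).contDiffAt hn).differentiableAt (by simp))
      ((hP.contDiffAt hn).differentiableAt (by simp))
      ((hQ.contDiffAt hn).differentiableAt (by simp))
      (Filter.eventually_of_mem hn hP0) (Filter.eventually_of_mem hn hQ0)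
  have hζA : ∀ x ∈ Φ.source, ∀ i, ζ i x (A x) = (if i = 1 then 1 else 0) - d x *
      ((if i = 0 then 1 else 0) - c x * if i = 1 then 1 else 0) := fun x hx i => by
    simp only [A, map_sub, map_smul, hζL x (hΦV hx), hζ1 x (hΦV hx), smul_eq_mul]
  have h3X0 : ∀ x ∈ Φ.source, ζ 3 x (X 0 x) = 0 := fun x hx => hζ0 x (hΦV hx) 3
  have h3X1 : ∀ x ∈ Φ.source, ζ 3 x (X 1 x) = 0 := fun x hx => hζ1 x (hΦV hx) 3
  have h3X2 : ∀ x ∈ Φ.source, ζ 3 x (X₂ x) = 0 := fun x hx => hζ2 x (hΦV hx) 3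
  have h3L : ∀ x ∈ Φ.source, ζ 3 x (L x) = 0 := fun x hx => by simp [hζL x (hΦV hx)]
  have h3A : ∀ x ∈ Φ.source, ζ 3 x (A x) = 0 := fun x hx => by simp [hζA x hx]
  have h2X0 : ∀ x ∈ Φ.source, ζ 2 x (X 0 x) = 0 := fun x hx => hζ0 x (hΦV hx) 2
  have h2X1 : ∀ x ∈ Φ.source, ζ 2 x (X 1 x) = 0 := fun x hx => hζ1 x (hΦV hx) 2
  have h2L : ∀ x ∈ Φ.source, ζ 2 x (L x) = 0 := fun x hx => by simp [hζL x (hΦV hx)]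
  have h2A : ∀ x ∈ Φ.source, ζ 2 x (A x) = 0 := fun x hx => by simp [hζA x hx]
  have h01 : ∀ x ∈ Φ.source, fderiv ℝ (ζ 3) x (X 1 x) (X 0 x) -
      fderiv ℝ (ζ 3) x (X 0 x) (X 1 x) = 0 := fun x hx => by
    rw [← hform 3 (hXs 0) (hXs 1) h3X0 h3X1 x hx]; exact h3X2 x hx
  have h02 : ∀ x ∈ Φ.source, fderiv ℝ (ζ 3) x (X₂ x) (X 0 x) -
      fderiv ℝ (ζ 3) x (X 0 x) (X₂ x) = c x := fun x hx => by
    rw [← hform 3 (hXs 0) hX₂s h3X0 h3X2 x hx]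
  have h12 : ∀ x ∈ Φ.source, fderiv ℝ (ζ 3) x (X₂ x) (X 1 x) -
      fderiv ℝ (ζ 3) x (X 1 x) (X₂ x) = 1 := fun x hx => by
    rw [← hform 3 (hXs 1) hX₂s h3X1 h3X2 x hx]; exact hζ3 x (hΦV hx) 3
  have hb01 : ∀ x ∈ Φ.source, fderiv ℝ (ζ 2) x (X 1 x) (X 0 x) -
      fderiv ℝ (ζ 2) x (X 0 x) (X 1 x) = 1 := fun x hx => by
    rw [← hform 2 (hXs 0) (hXs 1) h2X0 h2X1 x hx]; exact hζ2 x (hΦV hx) 2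
  have hexp : ∀ x ∈ Φ.source, ∀ u, ζ 3 x u = 0 →
      u = ζ 0 x u • X 0 x + ζ 1 x u • X 1 x + ζ 2 x u • X₂ x := fun x hx u hu => by
    have := eq_sum_of_dual_of_card_eq_finrank (hdual x (hΦV hx)) (by simp) u
    rwa [Fin.sum_univ_four, hu, zero_smul, add_zero] at this
  -- `L` is characteristic: dζ₃(·, L) vanishes on the kernel of ζ₃. This follows from the values of
  -- dζ₃ on pairs from X₀, X₁, X₂, so bracketing with `L` preserves sections of that kernel.
  have hchar : ∀ x ∈ Φ.source, ∀ u, ζ 3 x u = 0 →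
      fderiv ℝ (ζ 3) x u (L x) - fderiv ℝ (ζ 3) x (L x) u = 0 := fun x hx u hu => by
    rw [hexp x hx u hu]
    simp only [L, map_add, map_sub, map_smul, add_apply, sub_apply, smul_apply, smul_eq_mul]
    linear_combination (ζ 0 x u * c x + ζ 1 x u) * h01 x hx + ζ 2 x u * h02 x hx -
      ζ 2 x u * c x * h12 x hx
  have h3B : ∀ x ∈ Φ.source, ζ 3 x (B x) = 0 := fun x hx => by
    rw [hform 3 hLs hA h3L h3A x hx]
    exact hchar x hx _ (h3A x hx)
  have h2B : ∀ x ∈ Φ.source, ζ 2 x (B x) = 1 := fun x hx => by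
    rw [hform 2 hLs hA h2L h2A x hx]
    simp only [A, L, map_sub, map_smul, sub_apply, smul_apply, smul_eq_mul]
    linear_combination hb01 x hx
  have h3LB : ∀ x ∈ Φ.source, ζ 3 x (lieBracket ℝ L B x) = 0 := fun x hx => by
    rw [hform 3 hLs hB h3L h3B x hx]
    exact hchar x hx _ (h3B x hx)
  have h3AB : ∀ x ∈ Φ.source, ζ 3 x (lieBracket ℝ A B x) = 1 := fun x hx => by
    rw [hform 3 hA hB h3A h3B x hx]
    have h1 := hchar x hx _ (h3B x hx)
    have h2 : fderiv ℝ (ζ 3) x (B x) (X 1 x) - fderiv ℝ (ζ 3) x (X 1 x) (B x) = 1 := by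
      have h3 := hexp x hx _ (h3B x hx)
      rw [h2B x hx, one_smul] at h3
      rw [h3]
      simp only [map_add, map_smul, add_apply, smul_apply, smul_eq_mul]
      linear_combination -ζ 0 x (B x) * h01 x hx + h12 x hx
    have h4 : A x = X 1 x - d x • L x := rfl
    rw [h4]
    simp only [map_sub, map_smul, sub_apply, smul_apply, smul_eq_mul]
    linear_combination h2 - d x * h1
  have hTLB : ∀ x ∈ Φ.source, fderiv ℝ T x (lieBracket ℝ L B x) = 0 := fun x hx =>
    fderiv_lieBracket_eq_zero hS hT hLs hB hTL hTB hx
  have hX1 : ∀ x, X 1 x = A x + d x • L x := fun x => by simp [A]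
  have hX0 : ∀ x, X 0 x = L x + c x • X 1 x := fun x => by simp [L]
  have hA0 : ∀ x ∈ Φ.source, A x ≠ 0 := fun x hx h => by
    have h0 := hζA x hx 0
    have h1 := hζA x hx 1
    rw [h, map_zero] at h0 h1
    simp only [zero_ne_one, if_true, if_false, one_ne_zero] at h0 h1
    have hd0 : d x = 0 := by linarith
    rw [hd0] at h1
    norm_num at h1
  refine ⟨Φ, L, A, ζ 2, hΦ, hxΦ, hΦV.trans hVU, hLs, hA, (hζ 2).mono hΦV, fun x hx =>
    ⟨hΦL x hx, ?_, ?_, ?_, h2A x hx, h2B x hx, ?_, ?_⟩⟩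
  · rw [hD x (hVU (hΦV hx))]
    ext u
    simp only [mem_span_range_two, Matrix.cons_val_zero, Matrix.cons_val_one]
    constructor
    · rintro ⟨a, b, rfl⟩
      refine ⟨a + (a * c x + b) * d x, a * c x + b, ?_⟩
      rw [hX0 x, hX1 x]
      module
    · rintro ⟨a, b, rfl⟩
      refine ⟨a - b * d x, b - (a - b * d x) * c x, ?_⟩
      simp only [A, L]
      module
  · rw [← hTd x hx]; exact hTA x hx
  · rw [← hTd x hx]; exact hTB x hx
  · rw [Fintype.linearIndependent_iff]
    intro g hg
    simp only [Fin.sum_univ_three] at hg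
    change g 0 • A x + g 1 • B x + g 2 • lieBracket ℝ A B x = 0 at hg
    have h2 : g 2 = 0 := by
      have := congrArg (ζ 3 x) hg
      simpa [h3A x hx, h3B x hx, h3AB x hx] using this
    rw [h2, zero_smul, add_zero] at hg
    have h1 : g 1 = 0 := by
      have := congrArg (ζ 2 x) hg
      simpa [h2A x hx, h2B x hx] using this
    rw [h1, zero_smul, add_zero, smul_eq_zero] at hg
    have h0 : g 0 = 0 := hg.resolve_right (hA0 x hx)
    intro i
    fin_cases i
    exacts [h0, h1, h2]
  -- [L, B] lies in ker ζ₃ = ⟨L, A, B⟩ and is horizontal. As `L` is the only one of the three with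
  -- nonzero last coordinate, its coefficient is zero.
  · have hu3 := h3LB x hx
    have hut := hTLB x hx
    change lieBracket ℝ L B x ∈ _
    generalize lieBracket ℝ L B x = u at hu3 hut ⊢
    have h1 := hexp x hx (u - ζ 2 x u • B x) (by simp [hu3, h3B x hx])
    have h2 : ζ 2 x (u - ζ 2 x u • B x) = 0 := by simp [h2B x hx]
    rw [h2, zero_smul, add_zero] at h1
    generalize ζ 0 x (u - ζ 2 x u • B x) = a at h1
    generalize ζ 1 x (u - ζ 2 x u • B x) = b at h1
    have h3 : u = (a + (a * c x + b) * d x) • L x + (a * c x + b) • A x + ζ 2 x u • B x := by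
      rw [sub_eq_iff_eq_add.1 h1, hX0 x, hX1 x]
      simp only [map_add, map_smul, h2L x hx, h2A x hx, h2B x hx]
      simp only [smul_eq_mul]
      module
    have h4 := congrArg (fderiv ℝ T x) h3
    simp only [map_add, map_smul, hTL x hx, hTA x hx, hTB x hx, hut, smul_eq_mul, mul_one,
      mul_zero, add_zero] at h4
    rw [← h4, zero_smul, zero_add] at h3
    exact mem_span_range_two.2 ⟨_, _, h3.symm⟩

end Engel

/-! ### Contact fields and their lifts. -/

section ContactField

variable {E F : Type*} [NormedAddCommGroup E] [NormedSpace ℝ E]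
  [NormedAddCommGroup F] [NormedSpace ℝ F]

theorem lieBracket_add_smul {v X W : E → E} {f : E → ℝ} {x : E} (hv : DifferentiableAt ℝ v x)
    (hX : DifferentiableAt ℝ X x) (hf : DifferentiableAt ℝ f x) :
    lieBracket ℝ (fun y => v y + f y • X y) W x =
      lieBracket ℝ v W x + f x • lieBracket ℝ X W x - fderiv ℝ f x (W x) • X x := by
  have h := lieBracket_add_smul_add_smul (W := W) hv hX hX hf (differentiableAt_const (0 : ℝ))
  simpa using h

/-- The contact vector field with generating function `h`. -/
theorem exists_contact_field [FiniteDimensional ℝ F] (hdim : Module.finrank ℝ F = 3) {W : Set F}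
    (hW : IsOpen W) {Y : Fin 2 → F → F} {η : Fin 3 → F → F →L[ℝ] ℝ}
    (hY : ∀ i, ContDiffOn ℝ ∞ (Y i) W) (hη : ∀ i, ContDiffOn ℝ ∞ (η i) W)
    (hdual : ∀ p ∈ W, ∀ i j, η i p (contactFrame Y j p) = if i = j then 1 else 0) {h : F → ℝ}
    (hh : ContDiffOn ℝ ∞ h W) :
    ∃ w : F → F, ContDiffOn ℝ ∞ w W ∧
      (∀ p ∈ W, ∀ i, lieBracket ℝ w (Y i) p ∈ Submodule.span ℝ (Set.range fun i => Y i p)) ∧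
      ∀ p ∈ W, η 2 p (w p) = h p ∧ (h p = 0 → η 0 p (w p) = fderiv ℝ h p (Y 1 p) ∧
        η 1 p (w p) = -fderiv ℝ h p (Y 0 p)) := by
  let Z := lieBracket ℝ (Y 0) (Y 1)
  have hZ : ContDiffOn ℝ ∞ Z W := contDiffOn_lieBracket hW (hY 0) (hY 1)
  have hspan : ∀ p ∈ W, ∀ u, u ∈ Submodule.span ℝ (Set.range fun j => contactFrame Y j p) := by
    intro p hp u
    rw [eq_sum_of_dual_of_card_eq_finrank (hdual p hp) (by simp [hdim]) u]
    exact Submodule.sum_mem _ fun i _ => Submodule.smul_mem _ _ (Submodule.subset_span ⟨i, rfl⟩)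
  -- In dimension 3 the contact frame spans everything, so any field can be corrected, in particular
  -- h·[Y₀, Y₁].
  obtain ⟨h1, h2⟩ := lieBracket_corrected_mem hW hY hη hdual (v := fun p => h p • Z p)
    (hh.smul hZ) fun p hp i => hspan p hp _
  refine ⟨_, h1, h2, fun p hp => ?_⟩
  have e0 : ∀ i, η i p (Y 0 p) = if i = 0 then 1 else 0 := fun i => hdual p hp i 0
  have e1 : ∀ i, η i p (Y 1 p) = if i = 1 then 1 else 0 := fun i => hdual p hp i 1
  have e2 : ∀ i, η i p (Z p) = if i = 2 then 1 else 0 := fun i => hdual p hp i 2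
  have hn := hW.mem_nhds hp
  -- Where h = 0, the only surviving part of [hZ, X] is −X(h) Z; this gives the Y₀- and
  -- Y₁-components of the corrected field.
  have hbr : ∀ X : F → F, h p = 0 →
      η 2 p (lieBracket ℝ (fun p => h p • Z p) X p) = -fderiv ℝ h p (X p) := by
    intro X h0
    have h3 := lieBracket_add_smul (W := X) (differentiableAt_const (0 : F))
      ((hZ.contDiffAt hn).differentiableAt (by simp))
      ((hh.contDiffAt hn).differentiableAt (by simp))
    simp only [zero_add] at h3
    rw [h3, h0]
    have h4 : lieBracket ℝ (fun _ => (0 : F)) X p = 0 := by simp [lieBracket]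
    simp [h4, e2]
  refine ⟨by simp [e0, e1, e2], fun h0 => ⟨?_, ?_⟩⟩
  · simp [e0, e1, h0, hbr (Y 1) h0]
  · simp [e0, e1, h0, hbr (Y 0) h0]

/-- A contact field on the leaf space of the characteristic field `L` lifts to a field that
preserves the distribution spanned by `L` and `A`. -/
theorem exists_engel_lift {Φ : OpenPartialHomeomorph E (F × ℝ)} (hΦ : IsSmoothChart Φ)
    {V : Set E} {W : Set F} (hV : IsOpen V) (hVΦ : V ⊆ Φ.source) (hW : IsOpen W)
    (hVW : ∀ x ∈ V, (Φ x).1 ∈ W) {L A : E → E} {β : E → E →L[ℝ] ℝ} (hL : ContDiffOn ℝ ∞ L V)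
    (hA : ContDiffOn ℝ ∞ A V) (hβ : ContDiffOn ℝ ∞ β V)
    (hLΦ : ∀ x ∈ V, fderiv ℝ Φ x (L x) = (0, 1)) (hAt : ∀ x ∈ V, (fderiv ℝ Φ x (A x)).2 = 0)
    (hβA : ∀ x ∈ V, β x (A x) = 0) (hβB : ∀ x ∈ V, β x (lieBracket ℝ L A x) = 1)
    {Y : Fin 2 → F → F} {η : Fin 3 → F → F →L[ℝ] ℝ}
    (hY : ∀ i, ContDiffOn ℝ ∞ (Y i) W) (hη : ∀ i, ContDiffOn ℝ ∞ (η i) W)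
    (hdual : ∀ p ∈ W, ∀ i j, η i p (contactFrame Y j p) = if i = j then 1 else 0)
    (hspan : ∀ x ∈ V, ∀ u, u ∈ Submodule.span ℝ (Set.range ![A x, lieBracket ℝ L A x]) ↔
      (fderiv ℝ Φ x u).2 = 0 ∧
        (fderiv ℝ Φ x u).1 ∈ Submodule.span ℝ (Set.range fun i => Y i (Φ x).1))
    {w : F → F} (hw : ContDiffOn ℝ ∞ w W)
    (hwY : ∀ p ∈ W, ∀ i, lieBracket ℝ w (Y i) p ∈ Submodule.span ℝ (Set.range fun i => Y i p)) :
    ∃ v : E → E, ContDiffOn ℝ ∞ v V ∧ ∀ x ∈ V, (fderiv ℝ Φ x (v x)).1 = w (Φ x).1 ∧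
      lieBracket ℝ v L x ∈ Submodule.span ℝ (Set.range ![L x, A x]) ∧
      lieBracket ℝ v A x ∈ Submodule.span ℝ (Set.range ![L x, A x]) := by
  have hΦV := hΦ.1.mono hVΦ
  have hP : ContDiffOn ℝ ∞ (fun x => (Φ x).1) V := contDiff_fst.comp_contDiffOn hΦV
  have hT : ContDiffOn ℝ ∞ (fun x => (Φ x).2) V := contDiff_snd.comp_contDiffOn hΦV
  have hPd : ∀ x ∈ V, ∀ u, fderiv ℝ (fun x => (Φ x).1) x u = (fderiv ℝ Φ x u).1 := fun x hx u => by
    rw [fderiv.fst (hΦ.differentiableAt (hVΦ hx))]; rfl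
  have hTd : ∀ x ∈ V, ∀ u, fderiv ℝ (fun x => (Φ x).2) x u = (fderiv ℝ Φ x u).2 := fun x hx u => by
    rw [fderiv.snd (hΦ.differentiableAt (hVΦ hx))]; rfl
  let v₀ : E → E := fun x => fderiv ℝ Φ.symm (Φ x) (w (Φ x).1, 0)
  have hv₀ : ContDiffOn ℝ ∞ v₀ V :=
    ((hΦ.2.fderiv_of_isOpen (m := ∞) Φ.open_target (by simp)).comp hΦV
      fun x hx => Φ.map_source (hVΦ hx)).clm_apply ((hw.comp hP hVW).prodMk contDiffOn_const)
  have hΦv₀ : ∀ x ∈ V, fderiv ℝ Φ x (v₀ x) = (w (Φ x).1, 0) := fun x hx =>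
    hΦ.fderiv_fderiv_symm (hVΦ hx) _
  have hPv₀ : ∀ x ∈ V, fderiv ℝ (fun x => (Φ x).1) x (v₀ x) = w (Φ x).1 := fun x hx => by
    rw [hPd x hx, hΦv₀ x hx]
  have hTv₀ : ∀ x ∈ V, fderiv ℝ (fun x => (Φ x).2) x (v₀ x) = 0 := fun x hx => by
    rw [hTd x hx, hΦv₀ x hx]
  -- `L` projects to zero in the leaf space, an empty combination of fields (hence `Fin 0`), while
  -- its last coordinate and that of `v₀` are constant.
  have hvL : ∀ x ∈ V, lieBracket ℝ v₀ L x = 0 := fun x hx => by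
    have h1 : fderiv ℝ (fun x => (Φ x).1) x (lieBracket ℝ v₀ L x) ∈ (⊥ : Submodule ℝ F) :=
      fderiv_lieBracket_mem_of_related (ι := Fin 0) (Y := fun _ _ => 0) (c := fun _ _ => 0) hV hW
        hP hVW hv₀ hL hw (fun i => i.elim0) (fun i => i.elim0) hPv₀
        (fun y hy => by rw [hPd y hy, hLΦ y hy]; simp) hx (fun i => i.elim0) (fun i => i.elim0)
    have h2 : fderiv ℝ (fun x => (Φ x).2) x (lieBracket ℝ v₀ L x) = 0 :=
      fderiv_lieBracket_eq_zero hV hT hv₀ hL hTv₀ (b := 1)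
        (fun y hy => by rw [hTd y hy, hLΦ y hy]) hx
    rw [Submodule.mem_bot, hPd x hx] at h1
    rw [hTd x hx] at h2
    refine hΦ.fderiv_injective (hVΦ hx) ?_
    rw [map_zero]
    exact Prod.ext h1 h2
  have hvA : ∀ x ∈ V, lieBracket ℝ v₀ A x ∈
      Submodule.span ℝ (Set.range ![A x, lieBracket ℝ L A x]) := fun x hx => by
    rw [hspan x hx, ← hPd x hx, ← hTd x hx]
    refine ⟨fderiv_lieBracket_eq_zero hV hT hv₀ hA hTv₀ (b := 0)
      (fun y hy => by rw [hTd y hy, hAt y hy]) hx, ?_⟩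
    refine fderiv_lieBracket_mem_of_related (Y := Y)
      (c := fun i y => η i.castSucc (Φ y).1 (fderiv ℝ (fun x => (Φ x).1) y (A y))) hV hW
      hP hVW hv₀ hA hw hY (fun i => ((hη _).comp hP hVW).clm_apply
        (contDiffOn_fderiv_apply hV hP hA)) hPv₀ (fun y hy => ?_) hx
      (fun i => Submodule.subset_span ⟨i, rfl⟩) (hwY _ (hVW x hx))
    have h1 : fderiv ℝ (fun x => (Φ x).1) y (A y) ∈
        Submodule.span ℝ (Set.range fun i => Y i (Φ y).1) := by
      rw [hPd y hy]
      exact ((hspan y hy _).1 (Submodule.subset_span ⟨0, rfl⟩)).2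
    refine eq_sum_of_mem_span_of_dual (fun i j => ?_) h1
    have h2 := hdual _ (hVW y hy) i.castSucc j.castSucc
    fin_cases i <;> fin_cases j <;> exact h2
  have hbr := contDiffOn_lieBracket hV hv₀ hA
  -- `β` reads off the [L, A]-component. Since [τL, A] = τ[L, A] − A(τ)L, this τ removes that
  -- component from [v₀, A], and adding τL changes [v₀, L] = 0 only by a multiple of `L`.
  have hτ : ContDiffOn ℝ ∞ (fun x => -β x (lieBracket ℝ v₀ A x)) V := (hβ.clm_apply hbr).neg
  refine ⟨fun x => v₀ x + (-β x (lieBracket ℝ v₀ A x)) • L x, hv₀.add (hτ.smul hL),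
    fun x hx => ⟨by simp [hΦv₀ x hx, hLΦ x hx], ?_, ?_⟩⟩
  all_goals
    have hn := hV.mem_nhds hx
    rw [lieBracket_add_smul ((hv₀.contDiffAt hn).differentiableAt (by simp))
      ((hL.contDiffAt hn).differentiableAt (by simp))
      ((hτ.contDiffAt hn).differentiableAt (by simp)), mem_span_range_two]
  · refine ⟨-fderiv ℝ (fun x => -β x (lieBracket ℝ v₀ A x)) x (L x), 0, ?_⟩
    simp [hvL x hx]
  · obtain ⟨a, b, hab⟩ := mem_span_range_two.1 (hvA x hx)
    refine ⟨-fderiv ℝ (fun x => -β x (lieBracket ℝ v₀ A x)) x (A x), a, ?_⟩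
    have hb : β x (lieBracket ℝ v₀ A x) = b := by
      rw [← hab]
      simp [hβA x hx, hβB x hx]
    simp only [Matrix.cons_val_zero, Matrix.cons_val_one] at hab ⊢
    rw [hb, ← hab]
    module

end ContactField

/-- The planes ⟨A, [L, A]⟩ are invariant under `L` and descend to a contact distribution on its leaf
space, where `A` projects at `x₀` to Y₀. Two generating functions suffice: the constant 1 gives a
field transversal to the contact plane, and a function vanishing at p₀ gives one in the contact
plane but independent of Y₀. -/
theorem exists_symmetries_of_generalPosition {D : Euc 4 → Submodule ℝ (Euc 4)} {U : Set (Euc 4)}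
    (hU : IsOpen U) {X : Fin 2 → Euc 4 → Euc 4} (hX : ∀ i, ContDiffOn ℝ ∞ (X i) U)
    (hD : ∀ x ∈ U, D x = Submodule.span ℝ (Set.range fun i => X i x)) {x₀ : Euc 4} (hx₀ : x₀ ∈ U)
    (hli : LinearIndependent ℝ fun i => contactFrame X i x₀)
    (hgen : lieBracket ℝ (X 1) (lieBracket ℝ (X 0) (X 1)) x₀ ∉
      Submodule.span ℝ (Set.range fun i => contactFrame X i x₀)) :
    ∃ V : Set (Euc 4), IsOpen V ∧ x₀ ∈ V ∧ V ⊆ U ∧ HasTransversalSymmetriesOn D V := by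
  obtain ⟨Φ, L, A, β, hΦ, hxΦ, hΦU, hL, hA, hβ, h⟩ := exists_engel_chart hU hX hD hx₀ hli hgen
  have hB := contDiffOn_lieBracket Φ.open_source hL hA
  have hpair : ∀ x, (fun i => (![A, lieBracket ℝ L A] : Fin 2 → Euc 4 → Euc 4) i x) =
      ![A x, lieBracket ℝ L A x] := fun x => range_eq_pair _ x
  obtain ⟨V, W, Y, η, hV, hxV, hVΦ, hW, hVW, hY, hη, hdual, hY0, hspan⟩ :=
    exists_contact_slice hΦ hL (fun x hx => (h x hx).1) (X := ![A, lieBracket ℝ L A])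
      (by intro i; fin_cases i; exacts [hA, hB])
      (by
        intro x hx i
        fin_cases i
        exacts [(h x hx).2.2.1, (h x hx).2.2.2.1])
      (fun x hx => (h x hx).2.2.2.2.2.2.1)
      (by
        intro x hx i
        rw [hpair]
        fin_cases i
        exacts [Submodule.subset_span ⟨1, rfl⟩, (h x hx).2.2.2.2.2.2.2]) hxΦ
  simp only [hpair] at hspan
  have hlift := fun {w : Euc 3 → Euc 3} => exists_engel_lift (w := w) hΦ hV hVΦ hW hVW
    (hL.mono hVΦ) (hA.mono hVΦ) (hβ.mono hVΦ) (fun x hx => (h x (hVΦ hx)).1)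
    (fun x hx => (h x (hVΦ hx)).2.2.1) (fun x hx => (h x (hVΦ hx)).2.2.2.2.1)
    (fun x hx => (h x (hVΦ hx)).2.2.2.2.2.1) hY hη hdual hspan
  let p₀ := (Φ x₀).1
  have hp₀ : p₀ ∈ W := hVW x₀ hxV
  obtain ⟨w₁, hw₁, hw₁Y, hw₁η⟩ := exists_contact_field (by simp) hW hY hη hdual
    (h := fun _ => 1) contDiffOn_const
  -- This function vanishes at p₀ and has derivative 1 along Y₀, so w₂(p₀) has η₂-component 0 and
  -- η₁-component −1.
  obtain ⟨w₂, hw₂, hw₂Y, hw₂η⟩ := exists_contact_field (by simp) hW hY hη hdual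
    (h := fun p => η 0 p₀ (p - p₀))
    ((η 0 p₀).contDiff.comp (contDiff_id.sub contDiff_const)).contDiffOn
  obtain ⟨v₁, hv₁, hv₁D⟩ := hlift hw₁ hw₁Y
  obtain ⟨v₂, hv₂, hv₂D⟩ := hlift hw₂ hw₂Y
  have e0 : ∀ i, η i p₀ (Y 0 p₀) = if i = 0 then 1 else 0 := fun i => hdual p₀ hp₀ i 0
  have hη1 : η 2 p₀ (w₁ p₀) = 1 := (hw₁η p₀ hp₀).1
  have hη2 : η 2 p₀ (w₂ p₀) = 0 := by simp [(hw₂η p₀ hp₀).1]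
  have hη2' : η 1 p₀ (w₂ p₀) = -1 := by
    rw [((hw₂η p₀ hp₀).2 (by simp)).2]
    have h1 : HasFDerivAt (fun p => η 0 p₀ (p - p₀)) (η 0 p₀) p₀ :=
      (η 0 p₀).hasFDerivAt.comp p₀ ((hasFDerivAt_id p₀).sub_const p₀)
    rw [h1.fderiv, e0 0, if_pos rfl]
  have hli4 : LinearIndependent ℝ ![L x₀, A x₀, v₁ x₀, v₂ x₀] := by
    rw [Fintype.linearIndependent_iff]
    intro a ha
    simp only [Fin.sum_univ_four, Matrix.cons_val] at ha
    have hA0 : (fderiv ℝ Φ x₀ (A x₀)).1 = Y 0 p₀ := hY0 0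
    have hP := congrArg (fun u => (fderiv ℝ Φ x₀ u).1) ha
    simp only [map_add, map_smul, Prod.fst_add, Prod.smul_fst, (h x₀ hxΦ).1, hA0,
      (hv₁D x₀ hxV).1, (hv₂D x₀ hxV).1, map_zero, Prod.fst_zero, smul_zero, zero_add] at hP
    change a 1 • Y 0 p₀ + a 2 • w₁ p₀ + a 3 • w₂ p₀ = 0 at hP
    have h2 : a 2 = 0 := by
      have := congrArg (η 2 p₀) hP
      simpa [e0, hη1, hη2] using this
    rw [h2, zero_smul, add_zero] at hP
    have h3 : a 3 = 0 := by
      have := congrArg (η 1 p₀) hP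
      simpa [e0, hη2'] using this
    rw [h3, zero_smul, add_zero] at hP
    have h1 : a 1 = 0 := by
      have := congrArg (η 0 p₀) hP
      simpa [e0] using this
    rw [h1, h2, h3] at ha
    have h0 : a 0 = 0 := by
      have := congrArg (fun u => (fderiv ℝ Φ x₀ u).2) ha
      simpa [(h x₀ hxΦ).1] using this
    intro i
    fin_cases i
    exacts [h0, h1, h2, h3]
  have hDV : ∀ x ∈ V, D x = Submodule.span ℝ (Set.range ![L x, A x]) := fun x hx =>
    (h x (hVΦ hx)).2.1
  obtain ⟨V', hV', hxV', hV'V, hs⟩ := exists_transversal_symmetries (D := D) (by simp) hV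
    (hL.mono hVΦ) (hA.mono hVΦ) hDV hv₁ hv₂
    (fun x hx => by rw [hDV x hx]; exact (hv₁D x hx).2.1)
    (fun x hx => by rw [hDV x hx]; exact (hv₁D x hx).2.2)
    (fun x hx => by rw [hDV x hx]; exact (hv₂D x hx).2.1)
    (fun x hx => by rw [hDV x hx]; exact (hv₂D x hx).2.2) hxV hli4
  exact ⟨V', hV', hxV', hV'V.trans (hVΦ.trans hΦU), v₁, v₂, hs⟩

/-! ### Derived distributions in terms of a frame. -/

section Derived

variable {E : Type*} [NormedAddCommGroup E] [NormedSpace ℝ E] {Ω : Set E} {D : E → Submodule ℝ E}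

theorem contDiffOn_of_mem_derivedSections (hΩ : IsOpen Ω) (k : ℕ) :
    ∀ Y ∈ derivedSections Ω D k, ContDiffOn ℝ ∞ Y Ω := by
  induction k with
  | zero => exact fun Y hY => hY.1
  | succ k ih =>
    intro Y hY
    obtain ⟨Y₁, h₁, Y₂, h₂, rfl⟩ := Submodule.mem_sup.1 hY
    refine (ih Y₁ h₁).add ?_
    clear hY
    induction h₂ using Submodule.span_induction with
    | mem Z hZ =>
      obtain ⟨V, hV, W, hW, rfl⟩ := hZ
      exact contDiffOn_lieBracket hΩ hV.1 (ih W hW)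
    | zero => exact contDiffOn_const
    | add Z Z' _ _ hZ hZ' => exact hZ.add hZ'
    | smul c Z _ hZ => exact contDiffOn_const.smul hZ

theorem derivedSpace_le_succ (k : ℕ) (x : E) : derivedSpace Ω D k x ≤ derivedSpace Ω D (k + 1) x :=
  Submodule.map_mono le_sup_left

theorem lieBracket_mem_derivedSections {k : ℕ} {V W : E → E} (hV : V ∈ sections Ω D)
    (hW : W ∈ derivedSections Ω D k) : lieBracket ℝ V W ∈ derivedSections Ω D (k + 1) :=
  Submodule.mem_sup_right (Submodule.subset_span ⟨V, hV, W, hW, rfl⟩)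

theorem mem_derivedSpace {k : ℕ} {V : E → E} (hV : V ∈ derivedSections Ω D k) (x : E) :
    V x ∈ derivedSpace Ω D k x :=
  Submodule.mem_map_of_mem (f := (LinearMap.proj x : (E → E) →ₗ[ℝ] E)) hV

theorem derivedSpace_zero_le {x : E} (hx : x ∈ Ω) : derivedSpace Ω D 0 x ≤ D x := by
  rintro _ ⟨V, hV, rfl⟩
  exact hV.2 x hx

variable [FiniteDimensional ℝ E]

/-- Sections live on all of Ω but frames only on `U`. The cutoff field is a pointwise multiple of
`X` on `U` and zero elsewhere, so it is a section of `D`. -/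
theorem exists_section {U : Set E} (hU : IsOpen U) {X : E → E} (hX : ContDiffOn ℝ ∞ X U)
    (hXD : ∀ x ∈ U, X x ∈ D x) {x : E} (hx : x ∈ U) :
    ∃ X' ∈ sections Ω D, X' =ᶠ[𝓝 x] X := by
  obtain ⟨X', h1, -, h2, h3, h4⟩ := exists_cutoff hU hX hx
  refine ⟨X', ⟨h1.contDiffOn, fun y _ => ?_⟩, h2⟩
  by_cases hy : y ∈ U
  · obtain ⟨c, hc⟩ := h3 y hy
    rw [hc]
    exact (D y).smul_mem c (hXD y hy)
  · rw [h4 y hy]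
    exact (D y).zero_mem

/-- A frame of `D` and a frame of a distribution that contains `∂⁽ᵏ⁾D` generate `∂⁽ᵏ⁺¹⁾D` by their
brackets. -/
theorem derivedSpace_succ_le (hΩ : IsOpen Ω) {U : Set E} (hU : IsOpen U) (hUΩ : U ⊆ Ω) {r s : ℕ}
    {X : Fin r → E → E} (hX : ∀ i, ContDiffOn ℝ ∞ (X i) U)
    (hD : ∀ x ∈ U, D x ≤ Submodule.span ℝ (Set.range fun i => X i x))
    {Z : Fin s → E → E} (hZ : ∀ i, ContDiffOn ℝ ∞ (Z i) U) {k : ℕ}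
    (hk : ∀ x ∈ U, derivedSpace Ω D k x ≤ Submodule.span ℝ (Set.range fun i => Z i x))
    {x : E} (hx : x ∈ U) (hXli : LinearIndependent ℝ fun i => X i x)
    (hZli : LinearIndependent ℝ fun i => Z i x) {S : Submodule ℝ E} (hXS : ∀ i, X i x ∈ S)
    (hZS : ∀ i, Z i x ∈ S) (hXZ : ∀ i j, lieBracket ℝ (X i) (Z j) x ∈ S) :
    derivedSpace Ω D (k + 1) x ≤ S := by
  obtain ⟨V₁, hV₁, hxV₁, hV₁U, ξ, hξ, hξX⟩ := exists_dual_frame hU hX hx hXli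
  obtain ⟨V₂, hV₂, hxV₂, hV₂U, ζ, hζ, hζZ⟩ := exists_dual_frame hU hZ hx hZli
  have hn := hU.mem_nhds hx
  have hn₁ := hV₁.mem_nhds hxV₁
  have hn₂ := hV₂.mem_nhds hxV₂
  rintro _ ⟨Y, hY, rfl⟩
  obtain ⟨Y₁, h₁, Y₂, h₂, rfl⟩ := Submodule.mem_sup.1 hY
  change Y₁ x + Y₂ x ∈ S
  refine S.add_mem ?_ ?_
  · refine Submodule.span_le.2 ?_ (hk x hx (mem_derivedSpace h₁ x))
    rintro _ ⟨i, rfl⟩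
    exact hZS i
  · have hle : Submodule.span ℝ {Z | ∃ X ∈ sections Ω D, ∃ Y ∈ derivedSections Ω D k,
        Z = lieBracket ℝ X Y} ≤ S.comap (LinearMap.proj x : (E → E) →ₗ[ℝ] E) := by
      refine Submodule.span_le.2 ?_
      rintro _ ⟨V, hV, W, hW, rfl⟩
      change lieBracket ℝ V W x ∈ S
      have hVd := hV.1.mono (hV₁U.trans hUΩ)
      have hWd := (contDiffOn_of_mem_derivedSections hΩ k W hW).mono (hV₂U.trans hUΩ)
      refine lieBracket_sum_smul_mem (f := fun i y => ξ i y (V y)) (g := fun i y => ζ i y (W y))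
        ?_ (fun i => (((hξ i).clm_apply hVd).contDiffAt hn₁).differentiableAt (by simp))
        (fun i => ((hX i).contDiffAt hn).differentiableAt (by simp)) ?_
        (fun i => (((hζ i).clm_apply hWd).contDiffAt hn₂).differentiableAt (by simp))
        (fun i => ((hZ i).contDiffAt hn).differentiableAt (by simp)) hXS hZS hXZ
      · filter_upwards [hn₁] with y hy using eq_sum_of_mem_span_of_dual (hξX y hy)
          (hD y (hV₁U hy) (hV.2 y (hUΩ (hV₁U hy))))
      · filter_upwards [hn₂] with y hy using eq_sum_of_mem_span_of_dual (hζZ y hy)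
          (hk y (hV₂U hy) (mem_derivedSpace hW y))
    exact hle h₂

section Frame

variable {U : Set E} {X : Fin 2 → E → E}

/-- Brackets depend only on germs, so near `x` the frame may be replaced by sections over Ω. -/
theorem span_contactFrame_le_derivedSpace (hU : IsOpen U)
    (hX : ∀ i, ContDiffOn ℝ ∞ (X i) U)
    (hD : ∀ x ∈ U, D x = Submodule.span ℝ (Set.range fun i => X i x)) {x : E} (hx : x ∈ U) :
    Submodule.span ℝ (Set.range fun i => contactFrame X i x) ≤ derivedSpace Ω D 1 x ∧
      ∀ i, lieBracket ℝ (X i) (lieBracket ℝ (X 0) (X 1)) x ∈ derivedSpace Ω D 2 x := by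
  have hXD : ∀ i, ∀ y ∈ U, X i y ∈ D y := fun i y hy => by
    rw [hD y hy]; exact Submodule.subset_span ⟨i, rfl⟩
  choose X' hX' hXX' using fun i => exists_section (Ω := Ω) hU (hX i) (hXD i) hx
  have hbr : lieBracket ℝ (X' 0) (X' 1) =ᶠ[𝓝 x] lieBracket ℝ (X 0) (X 1) :=
    (hXX' 0).lieBracket_vectorField (hXX' 1)
  have h01 : lieBracket ℝ (X' 0) (X' 1) ∈ derivedSections Ω D 1 :=
    lieBracket_mem_derivedSections (hX' 0) (hX' 1)
  have hi : ∀ i, X i x ∈ derivedSpace Ω D 1 x := fun i => by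
    rw [← (hXX' i).eq_of_nhds]
    exact derivedSpace_le_succ 0 x (mem_derivedSpace (k := 0) (hX' i) x)
  refine ⟨Submodule.span_le.2 ?_, fun i => ?_⟩
  · rintro _ ⟨i, rfl⟩
    fin_cases i
    · exact hi 0
    · exact hi 1
    · change lieBracket ℝ (X 0) (X 1) x ∈ derivedSpace Ω D 1 x
      rw [← hbr.eq_of_nhds]
      exact mem_derivedSpace h01 x
  · rw [← (hXX' i).lieBracket_vectorField_eq hbr]
    exact mem_derivedSpace (lieBracket_mem_derivedSections (hX' i) h01) x

theorem derivedSpace_one_eq (hΩ : IsOpen Ω) (hU : IsOpen U) (hUΩ : U ⊆ Ω)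
    (hX : ∀ i, ContDiffOn ℝ ∞ (X i) U) (hli : ∀ x ∈ U, LinearIndependent ℝ fun i => X i x)
    (hD : ∀ x ∈ U, D x = Submodule.span ℝ (Set.range fun i => X i x)) {x : E} (hx : x ∈ U) :
    derivedSpace Ω D 1 x = Submodule.span ℝ (Set.range fun i => contactFrame X i x) := by
  refine le_antisymm ?_ (span_contactFrame_le_derivedSpace hU hX hD hx).1
  have hmem : ∀ i, contactFrame X i x ∈
      Submodule.span ℝ (Set.range fun i => contactFrame X i x) := fun i =>
    Submodule.subset_span ⟨i, rfl⟩
  have hXm : ∀ i, X i x ∈ Submodule.span ℝ (Set.range fun i => contactFrame X i x) := fun i => by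
    fin_cases i
    exacts [hmem 0, hmem 1]
  refine derivedSpace_succ_le hΩ hU hUΩ hX (fun y hy => (hD y hy).le) hX
    (fun y hy => (derivedSpace_zero_le (hUΩ hy)).trans (hD y hy).le) hx (hli x hx) (hli x hx)
    hXm hXm fun i j => ?_
  fin_cases i <;> fin_cases j
  · simp
  · exact hmem 2
  · rw [lieBracket_swap]
    exact Submodule.neg_mem _ (hmem 2)
  · simp

/-- The contact frame spans ∂⁽¹⁾D on all of `U`, so sections of ∂⁽¹⁾D expand in it near `x`; the
bracket condition itself is needed at `x` only. -/
theorem derivedSpace_two_le (hΩ : IsOpen Ω) (hU : IsOpen U) (hUΩ : U ⊆ Ω)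
    (hX : ∀ i, ContDiffOn ℝ ∞ (X i) U) (hli : ∀ x ∈ U, LinearIndependent ℝ fun i => X i x)
    (hD : ∀ x ∈ U, D x = Submodule.span ℝ (Set.range fun i => X i x)) {x : E} (hx : x ∈ U)
    (hcli : LinearIndependent ℝ fun i => contactFrame X i x)
    (hinv : ∀ i, lieBracket ℝ (X i) (lieBracket ℝ (X 0) (X 1)) x ∈
      Submodule.span ℝ (Set.range fun i => contactFrame X i x)) :
    derivedSpace Ω D 2 x ≤ Submodule.span ℝ (Set.range fun i => contactFrame X i x) := by
  have hmem : ∀ i, contactFrame X i x ∈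
      Submodule.span ℝ (Set.range fun i => contactFrame X i x) := fun i =>
    Submodule.subset_span ⟨i, rfl⟩
  refine derivedSpace_succ_le hΩ hU hUΩ hX (fun y hy => (hD y hy).le)
    (contDiffOn_contactFrame hU hX)
    (fun y hy => (derivedSpace_one_eq hΩ hU hUΩ hX hli hD hy).le) hx (hli x hx) hcli
    (fun i => by fin_cases i; exacts [hmem 0, hmem 1]) hmem fun i j => ?_
  fin_cases i <;> fin_cases j
  · change lieBracket ℝ (X 0) (X 0) x ∈ _
    simp
  · exact hmem 2
  · exact hinv 0
  · change lieBracket ℝ (X 1) (X 0) x ∈ _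
    rw [lieBracket_swap]
    exact Submodule.neg_mem _ (hmem 2)
  · change lieBracket ℝ (X 1) (X 1) x ∈ _
    simp
  · exact hinv 1

end Frame

end Derived

/-! ### Exchanging the two frame fields. -/

section Swap

variable {E : Type*} [NormedAddCommGroup E] [NormedSpace ℝ E]

theorem lieBracket_swap_neg (X Y : E → E) :
    lieBracket ℝ Y X = fun y => -lieBracket ℝ X Y y := funext fun _ => lieBracket_swap

theorem span_contactFrame_swap (X : Fin 2 → E → E) (x : E) :
    Submodule.span ℝ (Set.range fun i => contactFrame ![X 1, X 0] i x) =
      Submodule.span ℝ (Set.range fun i => contactFrame X i x) := by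
  ext u
  simp only [mem_span_range_three, contactFrame, Matrix.cons_val,
    lieBracket_swap_neg (X 0) (X 1)]
  constructor
  · rintro ⟨a, b, c, rfl⟩
    exact ⟨b, a, -c, by module⟩
  · rintro ⟨a, b, c, rfl⟩
    exact ⟨b, a, -c, by module⟩

theorem linearIndependent_contactFrame_swap {X : Fin 2 → E → E} {x : E}
    (h : LinearIndependent ℝ fun i => contactFrame X i x) :
    LinearIndependent ℝ fun i => contactFrame ![X 1, X 0] i x := by
  rw [linearIndependent_iff_card_eq_finrank_span] at h ⊢
  rw [h, Set.finrank, Set.finrank, span_contactFrame_swap]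

end Swap

/-- The Engel chart assumes that bracketing with X₁ leaves ∂⁽¹⁾Π. If X₀ does so instead, exchanging
the two only changes the sign of X₂ and preserves all spans. -/
theorem exists_symmetries_of_not_mem {D : Euc 4 → Submodule ℝ (Euc 4)} {U : Set (Euc 4)}
    (hU : IsOpen U) {X : Fin 2 → Euc 4 → Euc 4} (hX : ∀ i, ContDiffOn ℝ ∞ (X i) U)
    (hD : ∀ x ∈ U, D x = Submodule.span ℝ (Set.range fun i => X i x)) {x₀ : Euc 4} (hx₀ : x₀ ∈ U)
    (hli : LinearIndependent ℝ fun i => contactFrame X i x₀) {i : Fin 2}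
    (hgen : lieBracket ℝ (X i) (lieBracket ℝ (X 0) (X 1)) x₀ ∉
      Submodule.span ℝ (Set.range fun i => contactFrame X i x₀)) :
    ∃ V : Set (Euc 4), IsOpen V ∧ x₀ ∈ V ∧ V ⊆ U ∧ HasTransversalSymmetriesOn D V := by
  have hi : i = 0 ∨ i = 1 := by omega
  rcases hi with rfl | rfl
  · refine exists_symmetries_of_generalPosition hU (X := ![X 1, X 0])
      (fun i => by fin_cases i; exacts [hX 1, hX 0]) (fun x hx => ?_) hx₀
      (linearIndependent_contactFrame_swap hli) ?_
    · rw [hD x hx]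
      ext u
      simp only [mem_span_range_two, Matrix.cons_val_zero, Matrix.cons_val_one]
      constructor <;> exact fun ⟨a, b, h⟩ => ⟨b, a, by rw [← h, add_comm]⟩
    · rw [span_contactFrame_swap]
      change lieBracket ℝ (X 0) (lieBracket ℝ (X 1) (X 0)) x₀ ∉ _
      have h1 : lieBracket ℝ (X 0) (lieBracket ℝ (X 1) (X 0)) x₀ =
          -lieBracket ℝ (X 0) (lieBracket ℝ (X 0) (X 1)) x₀ := by
        rw [lieBracket_swap_neg (X 0) (X 1)]
        generalize lieBracket ℝ (X 0) (X 1) = Z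
        simp only [lieBracket, fderiv_fun_neg, neg_apply, map_neg]
        abel
      rwa [h1, Submodule.neg_mem_iff]
  · exact exists_symmetries_of_generalPosition hU hX hD hx₀ hli hgen

end PlaneField

/-! ### The three cases combined. -/

theorem mainTheorem3 (Ω : Set (EuclideanSpace ℝ (Fin 4))) (hΩ : IsOpen Ω)
    (D : EuclideanSpace ℝ (Fin 4) → Submodule ℝ (EuclideanSpace ℝ (Fin 4)))
    (hD : PlaneField.IsDistributionOn 2 Ω D) (hreg : PlaneField.IsRegularOn Ω D) :
    ∀ x₀ ∈ Ω, ∃ U : Set (EuclideanSpace ℝ (Fin 4)), IsOpen U ∧ x₀ ∈ U ∧ U ⊆ Ω ∧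
      (PlaneField.IsIntegrableOn U D ∨ PlaneField.IsContactProductOn U D ∨
        PlaneField.IsGeneralPositionOn Ω U D) ∧
      ∃ v w : EuclideanSpace ℝ (Fin 4) → EuclideanSpace ℝ (Fin 4),
        PlaneField.IsSymmetryOn D U v ∧ PlaneField.IsSymmetryOn D U w ∧
        ∀ x ∈ U, LinearIndependent ℝ ![v x, w x] ∧
          IsCompl (D x) (Submodule.span ℝ {v x, w x}) := by
  intro x₀ hx₀
  obtain ⟨U₀, hU₀, hxU₀, hU₀Ω, X, hX, hXD⟩ := hD x₀ hx₀
  have hli := fun x hx => (hXD x hx).1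
  have hDX := fun x hx => (hXD x hx).2
  have hd1 : ∀ x ∈ U₀, PlaneField.derivedSpace Ω D 1 x =
      Submodule.span ℝ (Set.range fun i => PlaneField.contactFrame X i x) := fun x hx =>
    PlaneField.derivedSpace_one_eq hΩ hU₀ hU₀Ω hX hli hDX hx
  have hDle : ∀ x ∈ U₀, D x ≤
      Submodule.span ℝ (Set.range fun i => PlaneField.contactFrame X i x) := fun x hx => by
    rw [hDX x hx, Submodule.span_le]
    rintro _ ⟨i, rfl⟩
    fin_cases i
    exacts [Submodule.subset_span ⟨0, rfl⟩, Submodule.subset_span ⟨1, rfl⟩]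
  have hDr : ∀ x ∈ U₀, Module.finrank ℝ (D x) = 2 := fun x hx => by
    rw [hDX x hx, finrank_span_eq_card (hli x hx), Fintype.card_fin]
  -- On `N` the ranks of ∂⁽¹⁾D and ∂⁽²⁾D are those at `x₀`. An inclusion of spans with equal ranks
  -- is an equality, so relations tested at `x₀` spread to nearby points.
  obtain ⟨N, hNr, hN, hxN⟩ := eventually_nhds_iff.1 ((hreg 1 x₀ hx₀).and (hreg 2 x₀ hx₀))
  by_cases h1 : VectorField.lieBracket ℝ (X 0) (X 1) x₀ ∈ D x₀
  · obtain ⟨V, hV, hxV, hVU, h_int, hsym⟩ := PlaneField.exists_integrable_of_involutive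
      (hU₀.inter hN) (fun i => (hX i).mono Set.inter_subset_left) (fun x hx => hli x hx.1)
      (fun x hx => hDX x hx.1) (by
        rintro x ⟨hx, hxN'⟩
        have h2 : PlaneField.derivedSpace Ω D 1 x₀ = D x₀ := by
          rw [hd1 x₀ hxU₀]
          refine le_antisymm (Submodule.span_le.2 ?_) (hDle x₀ hxU₀)
          have hm : ∀ i, X i x₀ ∈ D x₀ := fun i => by
            rw [hDX x₀ hxU₀]; exact Submodule.subset_span ⟨i, rfl⟩
          rintro _ ⟨i, rfl⟩
          fin_cases i
          exacts [hm 0, hm 1, h1]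
        have h3 := (hNr x hxN').1
        rw [h2, hDr x₀ hxU₀, hd1 x hx] at h3
        rw [Submodule.eq_of_le_of_finrank_eq (hDle x hx) (by rw [hDr x hx, h3])]
        exact Submodule.subset_span ⟨2, rfl⟩) ⟨hxU₀, hxN⟩
    exact ⟨V, hV, hxV, (hVU.trans Set.inter_subset_left).trans hU₀Ω, Or.inl h_int, hsym⟩
  have hcli₀ : LinearIndependent ℝ fun i => PlaneField.contactFrame X i x₀ := by
    rw [hDX x₀ hxU₀] at h1
    have h2 := linearIndependent_finSnoc.2 ⟨hli x₀ hxU₀, h1⟩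
    have h3 : (fun i => PlaneField.contactFrame X i x₀) =
        Fin.snoc (fun i => X i x₀) (VectorField.lieBracket ℝ (X 0) (X 1) x₀) := by
      funext i
      fin_cases i <;> rfl
    rw [h3]
    exact h2
  obtain ⟨U₁, hU₁, hxU₁, hU₁U, hcli⟩ := PlaneField.exists_linearIndependent_nhds
    (hU₀.inter hN) (fun i => (PlaneField.contDiffOn_contactFrame hU₀ hX i).mono
      Set.inter_subset_left) ⟨hxU₀, hxN⟩ hcli₀
  have hU₁₀ : U₁ ⊆ U₀ := hU₁U.trans Set.inter_subset_left
  have hX₁ : ∀ i, ContDiffOn ℝ ∞ (X i) U₁ := fun i => (hX i).mono hU₁₀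
  have hDX₁ := fun x hx => hDX x (hU₁₀ hx)
  have hfr : ∀ x ∈ U₁, Module.finrank ℝ
      (Submodule.span ℝ (Set.range fun i => PlaneField.contactFrame X i x)) = 3 := fun x hx => by
    rw [finrank_span_eq_card (hcli x hx), Fintype.card_fin]
  have hle2 : ∀ x ∈ U₁, Submodule.span ℝ (Set.range fun i => PlaneField.contactFrame X i x) ≤
      PlaneField.derivedSpace Ω D 2 x := fun x hx => by
    rw [← hd1 x (hU₁₀ hx)]
    exact PlaneField.derivedSpace_le_succ 1 x
  have hbr2 : ∀ x ∈ U₁, ∀ i, VectorField.lieBracket ℝ (X i)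
      (VectorField.lieBracket ℝ (X 0) (X 1)) x ∈ PlaneField.derivedSpace Ω D 2 x := fun x hx =>
    (PlaneField.span_contactFrame_le_derivedSpace hU₁ hX₁ hDX₁ hx).2
  by_cases h2 : ∀ i, VectorField.lieBracket ℝ (X i) (VectorField.lieBracket ℝ (X 0) (X 1)) x₀ ∈
      Submodule.span ℝ (Set.range fun i => PlaneField.contactFrame X i x₀)
  · have h3 : PlaneField.derivedSpace Ω D 2 x₀ =
        Submodule.span ℝ (Set.range fun i => PlaneField.contactFrame X i x₀) :=
      le_antisymm (PlaneField.derivedSpace_two_le hΩ hU₀ hU₀Ω hX hli hDX hxU₀ hcli₀ h2)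
        (hle2 x₀ hxU₁)
    obtain ⟨V, hV, hxV, hVU, hprod, hsym⟩ := PlaneField.exists_contactProduct hU₁ hX₁ hcli hDX₁
      (fun x hx i => by
        have h4 := (hNr x (hU₁U hx).2).2
        rw [h3, hfr x₀ hxU₁] at h4
        rw [Submodule.eq_of_le_of_finrank_eq (hle2 x hx) (by rw [hfr x hx, h4])]
        exact hbr2 x hx i) hxU₁
    exact ⟨V, hV, hxV, (hVU.trans hU₁₀).trans hU₀Ω, Or.inr (Or.inl hprod), hsym⟩
  · push Not at h2
    obtain ⟨i, hi⟩ := h2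
    obtain ⟨V, hV, hxV, hVU, hsym⟩ := PlaneField.exists_symmetries_of_not_mem hU₁ hX₁ hDX₁ hxU₁
      hcli₀ hi
    -- ∂⁽²⁾D strictly contains a space of dimension 3 inside ℝ⁴.
    have h4 : Module.finrank ℝ (PlaneField.derivedSpace Ω D 2 x₀) = 4 := by
      have h5 : Submodule.span ℝ (Set.range fun i => PlaneField.contactFrame X i x₀) <
          PlaneField.derivedSpace Ω D 2 x₀ :=
        lt_of_le_of_ne (hle2 x₀ hxU₁) fun h => hi (by rw [h]; exact hbr2 x₀ hxU₁ i)
      have h6 := Submodule.finrank_lt_finrank_of_lt h5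
      have h7 := Submodule.finrank_le (PlaneField.derivedSpace Ω D 2 x₀)
      rw [hfr x₀ hxU₁] at h6
      rw [finrank_euclideanSpace_fin] at h7
      omega
    refine ⟨V, hV, hxV, (hVU.trans hU₁₀).trans hU₀Ω, Or.inr (Or.inr fun x hx => ?_), hsym⟩
    have hx₁ := hVU hx
    have h5 := (hNr x (hU₁U hx₁).2).2
    rw [h4] at h5
    have h6 := hfr x hx₁
    rw [← hd1 x (hU₁₀ hx₁)] at h6
    refine ⟨fun h => ?_, fun h => ?_, Submodule.eq_top_of_finrank_eq (by
      rw [h5, finrank_euclideanSpace_fin])⟩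
    · rw [h, hDr x (hU₁₀ hx₁)] at h6
      omega
    · rw [h, h6] at h5
      omega
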